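/- A \emph{cell} is a unit square of the plane whose vertices have integer coordinates. A \emph{polyomino} is a nonempty finite union of cells whose interior is connected; polyominoes are considered up to translation. A \emph{column} of a polyomino consists of all its cells with the same horizontal projection. A \emph{simplex-duplex polyomino} is a polyomino in which every column has one or two connected components and no two neighbouring columns both have two connected components; a column with two components is called \emph{duplex}. For all $n,k\ge 0$ the number of simplex-duplex polyominoes with $n$ cells and $k$ duplex columns is finite; let $G(q,w)$ be the formal power series in which the coefficient of $q^nw^k$ is this number. For integers $i\ge 1$, $m\ge 1$, $c,s\ge 0$ put $$a_m(i)=\frac{(-3)^{i-1}q^{i^2+2i-2}w^{i-1}}{(1-q)^{2i-2}\left[\prod_{k=1}^{i-1}(1-q^k)\right]^4(1-q^i)^m},\qquad c_{m,s}(i)=\frac{(-3)^{s}q^{i^2+4i}w^{i}}{(1-q)^{2i}\left[\prod_{k=1}^{i-1}(1-q^k)\right]^4(1-q^i)^m},$$ $$F_{c,m}(i)=c+4\sum_{k=1}^{i-1}\frac{q^k}{1-q^k}+\frac{mq^i}{1-q^i},\qquad H_{c,m}(i)=F_{c,m}(i)^2-c+4\sum_{k=1}^{i-1}\frac{q^{2k}}{(1-q^k)^2}+\frac{mq^{2i}}{(1-q^i)^2}.$$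 Define twelve series (all sums over $i\ge 1$; they converge as formal power series in $q,w$): $$\tilde\alpha=\sum_i a_1(i),\quad \tilde\beta=\sum_i a_2(i),\quad \tilde\gamma=\sum_i c_{3,i-1}(i),\quad \tilde\delta=\sum_i c_{4,i}(i),$$ $$\tilde\epsilon=\sum_i a_1(i)F_{2i-2,1}(i),\quad \tilde\zeta=\sum_i a_2(i)F_{2i-2,2}(i),\quad \tilde\eta=\sum_i c_{3,i-1}(i)F_{2i,3}(i),\quad \tilde\theta=\sum_i c_{4,i}(i)F_{2i,4}(i),$$ $$\tilde\iota=\tfrac12\sum_i a_1(i)H_{2i-2,1}(i),\quad \tilde\kappa=\tfrac12\sum_i a_2(i)H_{2i-2,2}(i),\quad \tilde\lambda=\tfrac12\sum_i c_{3,i-1}(i)H_{2i,3}(i),\quad \tilde\mu=\tfrac12\sum_i c_{4,i}(i)H_{2i,4}(i).$$ Let $$NUM=(1-q)^4(\tilde{\alpha}+\tilde{\gamma}+2\tilde{\alpha}\tilde{\eta}-2\tilde{\gamma}\tilde{\epsilon})+q^2w(1-q)^2(\tilde{\iota}+\tilde{\lambda}-\tilde{\alpha}\tilde{\kappa}-\tilde{\alpha}\tilde{\mu}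 +\tilde{\beta}\tilde{\iota}+\tilde{\beta}\tilde{\lambda}-\tilde{\gamma}\tilde{\kappa}-\tilde{\gamma}\tilde{\mu} +\tilde{\delta}\tilde{\iota}+\tilde{\delta}\tilde{\lambda}-2\tilde{\epsilon}\tilde{\lambda}+2\tilde{\eta}\tilde{\iota} +2\tilde{\alpha}\tilde{\zeta}\tilde{\lambda}-2\tilde{\alpha}\tilde{\eta}\tilde{\kappa} -2\tilde{\alpha}\tilde{\eta}\tilde{\mu}+2\tilde{\alpha}\tilde{\theta}\tilde{\lambda}-2\tilde{\beta}\tilde{\epsilon}\tilde{\lambda} +2\tilde{\beta}\tilde{\eta}\tilde{\iota}+2\tilde{\gamma}\tilde{\epsilon}\tilde{\kappa}+2\tilde{\gamma}\tilde{\epsilon}\tilde{\mu} -2\tilde{\gamma}\tilde{\zeta}\tilde{\iota}-2\tilde{\gamma}\tilde{\theta}\tilde{\iota} -2\tilde{\delta}\tilde{\epsilon}\tilde{\lambda}+2\tilde{\delta}\tilde{\eta}\tilde{\iota}) +2q^2w(1-q^2)(\tilde{\alpha}\tilde{\lambda} -\tilde{\gamma}\tilde{\iota})$$ and $$DEN=(1-q)^4(1-\tilde{\beta}+\tilde{\delta}-\tilde{\epsilon}+\tilde{\eta}-\tilde{\alpha}\tilde{\zeta}+\tilde{\alpha}\tilde{\theta}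 +\tilde{\beta}\tilde{\epsilon}-\tilde{\beta}\tilde{\eta}+\tilde{\gamma}\tilde{\zeta} -\tilde{\gamma}\tilde{\theta} -\tilde{\delta}\tilde{\epsilon}+\tilde{\delta}\tilde{\eta})-2(1-q)^3(\tilde{\gamma}+\tilde{\alpha}\tilde{\eta}-\tilde{\gamma}\tilde{\epsilon}) -2q^2w(1-q)^2(\tilde{\kappa}-\tilde{\beta}\tilde{\mu}+\tilde{\delta}\tilde{\kappa}-\tilde{\epsilon}\tilde{\kappa}+\tilde{\zeta}\tilde{\iota} -\tilde{\zeta}\tilde{\lambda}+\tilde{\eta}\tilde{\kappa}-\tilde{\alpha}\tilde{\zeta}\tilde{\mu}+\tilde{\alpha}\tilde{\theta}\tilde{\kappa} +\tilde{\beta}\tilde{\epsilon}\tilde{\mu}-\tilde{\beta}\tilde{\eta}\tilde{\mu}-\tilde{\beta}\tilde{\theta}\tilde{\iota} +\tilde{\beta}\tilde{\theta}\tilde{\lambda}+\tilde{\gamma}\tilde{\zeta}\tilde{\mu}-\tilde{\gamma}\tilde{\theta}\tilde{\kappa} -\tilde{\delta}\tilde{\epsilon}\tilde{\kappa}+\tilde{\delta}\tilde{\zeta}\tilde{\iota}-\tilde{\delta}\tilde{\zeta}\tilde{\lambda}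 +\tilde{\delta}\tilde{\eta}\tilde{\kappa}) -4q^2w(1-q)(\tilde{\beta}\tilde{\lambda}-\tilde{\gamma}\tilde{\kappa}+\tilde{\alpha}\tilde{\zeta}\tilde{\lambda} -\tilde{\alpha}\tilde{\eta}\tilde{\kappa}-\tilde{\beta}\tilde{\epsilon}\tilde{\lambda}+\tilde{\beta}\tilde{\eta}\tilde{\iota} +\tilde{\gamma}\tilde{\epsilon}\tilde{\kappa}-\tilde{\gamma}\tilde{\zeta}\tilde{\iota}) -2q^3w(1-q)(\tilde{\iota}+\tilde{\alpha}\tilde{\kappa}-\tilde{\alpha}\tilde{\mu}-\tilde{\beta}\tilde{\iota}+\tilde{\delta}\tilde{\iota} -\tilde{\epsilon}\tilde{\lambda}+\tilde{\eta}\tilde{\iota}-\tilde{\alpha}\tilde{\zeta}\tilde{\lambda}+\tilde{\alpha}\tilde{\eta}\tilde{\kappa} -\tilde{\alpha}\tilde{\eta}\tilde{\mu}+\tilde{\alpha}\tilde{\theta}\tilde{\lambda}+\tilde{\beta}\tilde{\epsilon}\tilde{\lambda} -\tilde{\beta}\tilde{\eta}\tilde{\iota}-\tilde{\gamma}\tilde{\epsilon}\tilde{\kappa}+\tilde{\gamma}\tilde{\epsilon}\tilde{\mu}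 +\tilde{\gamma}\tilde{\zeta}\tilde{\iota}-\tilde{\gamma}\tilde{\theta}\tilde{\iota}-\tilde{\delta}\tilde{\epsilon}\tilde{\lambda} +\tilde{\delta}\tilde{\eta}\tilde{\iota}) -4q^3w(\tilde{\alpha}\tilde{\lambda}-\tilde{\gamma}\tilde{\iota}).$$ Then $DEN$ is invertible as a formal power series and $$G(q,w)=\frac{NUM}{DEN}.$$ -/

import Mathlib

open scoped MvPowerSeries.WithPiTopology

noncomputable section

namespace SimplexDuplex

/-! Polyominoes. A cell is represented by its lower left corner, a point of `ℤ × ℤ`; the first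
coordinate is the horizontal one. -/

/-- Two cells are adjacent when they share an edge. -/
def cellGraph : SimpleGraph (ℤ × ℤ) where
  Adj a b := |a.1 - b.1| + |a.2 - b.2| = 1
  symm := ⟨fun a b h => by rw [abs_sub_comm b.1, abs_sub_comm b.2]; exact h⟩
  loopless := ⟨fun a h => by simp at h⟩

/-- A polyomino: a finite set of cells which is nonempty and edge-connected. -/
def IsPolyomino (P : Finset (ℤ × ℤ)) : Prop :=
  (cellGraph.induce (P : Set (ℤ × ℤ))).Connected

/-- The horizontal positions of the columns of `P`. -/
def columnIndices (P : Finset (ℤ × ℤ)) : Finset ℤ := P.image Prod.fst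

/-- The column of `P` at the horizontal position `x`. -/
def column (P : Finset (ℤ × ℤ)) (x : ℤ) : Finset (ℤ × ℤ) := P.filter (fun c => c.1 = x)

/-- The number of connected components of a finite set of cells. -/
def numComponents (c : Finset (ℤ × ℤ)) : ℕ :=
  Nat.card (cellGraph.induce (c : Set (ℤ × ℤ))).ConnectedComponent

/-- Every column has one or two connected components. -/
def IsColumnDuplex (P : Finset (ℤ × ℤ)) : Prop :=
  IsPolyomino P ∧ ∀ x ∈ columnIndices P,
    numComponents (column P x) = 1 ∨ numComponents (column P x) = 2

/-- The horizontal positions of the duplex columns of `P`. -/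
def duplexIndices (P : Finset (ℤ × ℤ)) : Finset ℤ :=
  (columnIndices P).filter (fun x => numComponents (column P x) = 2)

/-- A column-duplex polyomino without two neighbouring duplex columns. -/
def IsSimplexDuplex (P : Finset (ℤ × ℤ)) : Prop :=
  IsColumnDuplex P ∧ ∀ x ∈ duplexIndices P, x + 1 ∉ duplexIndices P

/-- Two sets of cells are identified when one is a translate of the other. -/
def translationSetoid : Setoid (Finset (ℤ × ℤ)) where
  r P Q := ∃ v : ℤ × ℤ, Q = P.image (fun c => c + v)
  iseqv :=
    { refl := fun P => ⟨0, by simp⟩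
      symm := by
        rintro P Q ⟨v, rfl⟩
        refine ⟨-v, ?_⟩
        simp only [Finset.image_image, Function.comp_def, add_neg_cancel_right, Finset.image_id']
      trans := by
        rintro P Q R ⟨v, rfl⟩ ⟨u, rfl⟩
        refine ⟨v + u, ?_⟩
        simp only [Finset.image_image, Function.comp_def, add_assoc] }

/-- The simplex-duplex polyominoes, up to translation, with area `n` and `k` duplex columns. -/
def classes (n k : ℕ) : Set (Quotient translationSetoid) :=
  Quotient.mk translationSetoid ''
    {P | IsSimplexDuplex P ∧ P.card = n ∧ (duplexIndices P).card = k}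

/-! Formal power series in the variables `q` and `w`, with coefficientwise convergence. All
inverses below are inverses of power series with constant coefficient `1`. -/

/-- Formal power series in two variables. -/
abbrev Ser : Type := MvPowerSeries (Fin 2) ℚ

/-- The variable marking the area. -/
def q : Ser := MvPowerSeries.X 0

/-- The variable marking the duplex columns. -/
def w : Ser := MvPowerSeries.X 1

/-- The area and duplex columns generating function: the coefficient of `q ^ n * w ^ k` is the
number of simplex-duplex polyominoes with area `n` and `k` duplex columns. -/
def G : Ser := fun e => ((classes (e 0) (e 1)).ncard : ℚ)

/-- The common factor of the terms of `alpha` (`m = 1`) and `beta` (`m = 2`). -/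
def baseA (m : ℕ) (i : ℕ+) : Ser :=
  (-3) ^ ((i : ℕ) - 1) * q ^ ((i : ℕ) ^ 2 + 2 * i - 2) * w ^ ((i : ℕ) - 1) *
    ((1 - q) ^ (2 * (i : ℕ) - 2) * (∏ k ∈ Finset.Ico 1 (i : ℕ), (1 - q ^ k)) ^ 4 *
      (1 - q ^ (i : ℕ)) ^ m)⁻¹

/-- The common factor of the terms of `gamma` (`m = 3`, `s = i - 1`) and `delta` (`m = 4`,
`s = i`). -/
def baseC (m s : ℕ) (i : ℕ+) : Ser :=
  (-3) ^ s * q ^ ((i : ℕ) ^ 2 + 4 * i) * w ^ (i : ℕ) *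
    ((1 - q) ^ (2 * (i : ℕ)) * (∏ k ∈ Finset.Ico 1 (i : ℕ), (1 - q ^ k)) ^ 4 *
      (1 - q ^ (i : ℕ)) ^ m)⁻¹

/-- The factor `c + 4 ∑_{k=1}^{i-1} q^k / (1 - q^k) + m q^i / (1 - q^i)`. -/
def factor₁ (c m : ℕ) (i : ℕ+) : Ser :=
  (c : Ser) + 4 * ∑ k ∈ Finset.Ico 1 (i : ℕ), q ^ k * (1 - q ^ k)⁻¹ +
    (m : Ser) * q ^ (i : ℕ) * (1 - q ^ (i : ℕ))⁻¹

/-- The factor `(factor₁ c m i)^2 - c + 4 ∑_{k=1}^{i-1} q^(2k) / (1 - q^k)^2 +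
m q^(2i) / (1 - q^i)^2`. -/
def factor₂ (c m : ℕ) (i : ℕ+) : Ser :=
  factor₁ c m i ^ 2 - (c : Ser) +
    4 * ∑ k ∈ Finset.Ico 1 (i : ℕ), q ^ (2 * k) * ((1 - q ^ k) ^ 2)⁻¹ +
    (m : Ser) * q ^ (2 * (i : ℕ)) * ((1 - q ^ (i : ℕ)) ^ 2)⁻¹

/-! The terms of the twelve series. -/

def alphaTerm (i : ℕ+) : Ser := baseA 1 i

def betaTerm (i : ℕ+) : Ser := baseA 2 i

def gammaTerm (i : ℕ+) : Ser := baseC 3 ((i : ℕ) - 1) i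

def deltaTerm (i : ℕ+) : Ser := baseC 4 i i

def epsilonTerm (i : ℕ+) : Ser := baseA 1 i * factor₁ (2 * (i : ℕ) - 2) 1 i

def zetaTerm (i : ℕ+) : Ser := baseA 2 i * factor₁ (2 * (i : ℕ) - 2) 2 i

def etaTerm (i : ℕ+) : Ser := baseC 3 ((i : ℕ) - 1) i * factor₁ (2 * (i : ℕ)) 3 i

def thetaTerm (i : ℕ+) : Ser := baseC 4 i i * factor₁ (2 * (i : ℕ)) 4 i

def iotaTerm (i : ℕ+) : Ser := baseA 1 i * factor₂ (2 * (i : ℕ) - 2) 1 i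

def kappaTerm (i : ℕ+) : Ser := baseA 2 i * factor₂ (2 * (i : ℕ) - 2) 2 i

def lambdaTerm (i : ℕ+) : Ser := baseC 3 ((i : ℕ) - 1) i * factor₂ (2 * (i : ℕ)) 3 i

def muTerm (i : ℕ+) : Ser := baseC 4 i i * factor₂ (2 * (i : ℕ)) 4 i

/-! The twelve series. -/

def alpha : Ser := ∑' i : ℕ+, alphaTerm i

def beta : Ser := ∑' i : ℕ+, betaTerm i

def gamma : Ser := ∑' i : ℕ+, gammaTerm i

def delta : Ser := ∑' i : ℕ+, deltaTerm i

def epsilon : Ser := ∑' i : ℕ+, epsilonTerm i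

def zeta : Ser := ∑' i : ℕ+, zetaTerm i

def eta : Ser := ∑' i : ℕ+, etaTerm i

def theta : Ser := ∑' i : ℕ+, thetaTerm i

def iota : Ser := MvPowerSeries.C (1 / 2 : ℚ) * ∑' i : ℕ+, iotaTerm i

def kappa : Ser := MvPowerSeries.C (1 / 2 : ℚ) * ∑' i : ℕ+, kappaTerm i

def lambda : Ser := MvPowerSeries.C (1 / 2 : ℚ) * ∑' i : ℕ+, lambdaTerm i

def mu : Ser := MvPowerSeries.C (1 / 2 : ℚ) * ∑' i : ℕ+, muTerm i

/-- The numerator. -/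
def NUM : Ser :=
  (1 - q)^4 * (alpha + gamma + 2 * alpha * eta - 2 * gamma * epsilon) + q^2 * w * (1 - q)^2
    * (iota + lambda - alpha * kappa - alpha * mu + beta * iota + beta * lambda - gamma *
    kappa - gamma * mu + delta * iota + delta * lambda - 2 * epsilon * lambda + 2 * eta *
    iota + 2 * alpha * zeta * lambda - 2 * alpha * eta * kappa - 2 * alpha * eta * mu + 2 *
    alpha * theta * lambda - 2 * beta * epsilon * lambda + 2 * beta * eta * iota + 2 * gamma
    * epsilon * kappa + 2 * gamma * epsilon * mu - 2 * gamma * zeta * iota - 2 * gamma *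
    theta * iota - 2 * delta * epsilon * lambda + 2 * delta * eta * iota) + 2 * q^2 * w * (1
    - q^2) * (alpha * lambda - gamma * iota)

/-- The denominator. -/
def DEN : Ser :=
  (1 - q)^4 * (1 - beta + delta - epsilon + eta - alpha * zeta + alpha * theta + beta *
    epsilon - beta * eta + gamma * zeta - gamma * theta - delta * epsilon + delta * eta) - 2
    * (1 - q)^3 * (gamma + alpha * eta - gamma * epsilon) - 2 * q^2 * w * (1 - q)^2 * (kappa
    - beta * mu + delta * kappa - epsilon * kappa + zeta * iota - zeta * lambda + eta *
    kappa - alpha * zeta * mu + alpha * theta * kappa + beta * epsilon * mu - beta * eta *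
    mu - beta * theta * iota + beta * theta * lambda + gamma * zeta * mu - gamma * theta *
    kappa - delta * epsilon * kappa + delta * zeta * iota - delta * zeta * lambda + delta *
    eta * kappa) - 4 * q^2 * w * (1 - q) * (beta * lambda - gamma * kappa + alpha * zeta *
    lambda - alpha * eta * kappa - beta * epsilon * lambda + beta * eta * iota + gamma *
    epsilon * kappa - gamma * zeta * iota) - 2 * q^3 * w * (1 - q) * (iota + alpha * kappa -
    alpha * mu - beta * iota + delta * iota - epsilon * lambda + eta * iota - alpha * zeta *
    lambda + alpha * eta * kappa - alpha * eta * mu + alpha * theta * lambda + beta *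
    epsilon * lambda - beta * eta * iota - gamma * epsilon * kappa + gamma * epsilon * mu +
    gamma * zeta * iota - gamma * theta * iota - delta * epsilon * lambda + delta * eta *
    iota) - 4 * q^3 * w * (alpha * lambda - gamma * iota)

end SimplexDuplex

end

/-!
The polyominoes are built column by column and counted according to the height of the last column.

A simplex column is a cut: a set of cells with a connected column is connected exactly when the parts
on the two sides of that column, each taken with it, are (`conn_iff_of_cut`). As duplex columns have
no duplex neighbours, a polyomino with a simplex last column is therefore a single column, a duplex
column followed by a simplex one, or a smaller polyomino with a simplex last column that is extended
by a simplex column or by a duplex and a simplex column (`decompose_bijective`). A polyomino with a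
duplex last column is one with a simplex last column followed by a duplex column
(`ofEnd_bijective`).

What remains is to count the placements of the new columns. Let the neighbours of a duplex column
have heights `s + 1` and `κ + 1`, its components sizes `a` and `b`, and its gap size `g`. The
three columns are connected when each component is touched and one of the neighbours touches both.
A neighbour of height `s + 1` touches both components in `s - g` positions and at least one in
`a + b + 2 * s - (s - g)` positions, so by inclusion and exclusion there are
`(s - g) * (a + b + 2 * κ) + (κ - g) * (a + b + 2 * s) - 3 * (s - g) * (κ - g)` placements, with
truncated subtraction (`card_blockPairs`). Summation over `g` gives binomial coefficients and a sum
over the gaps below `min s κ` (`card_duplexPlacements`).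

Let `Φ t` be the sum of `q ^ area * w ^ (number of duplex columns) * t ^ s` over the polyominoes with
a last column that is simplex of height `s + 1`. The decomposition becomes a functional equation
that expresses `Φ t` by `Φ (q * t)` and by the binomial moments `A`, `B`, `D` of `s` of order zero,
one and two, the Taylor coefficients of `Φ` at `t = 1` (`QAdic.functional_equation`). It is applied at
`t = q ^ i * (1 + X)`, in the power series in `X` over the series in `q` and `w`. Since `Φ (q * t)`
has a factor divisible by `q`, the equation can be iterated (`QAdic.hasSum_iterate`,
`moment_one_add_X`) and gives `Φ (1 + X)` as a linear combination of four explicit sums, with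
coefficients linear in `1`, `A`, `B`, `D`. The summands are products of simple factors, so that their
coefficients of order one and two in `X` come from logarithmic derivatives (`IsJet`). This produces
the factors `factor₁` and `factor₂`: the coefficients of order zero, one and two of the four sums are
the twelve series.

Comparison of these coefficients is a system of three linear equations for `A`, `B`, `D`
(`moment_equations`). The generating function is `A + q ^ 2 * w / (1 - q) ^ 2 * D`
(`G_eq_moments`), and Cramer's rule yields `NUM / DEN` (`G_mul_DEN`). All twelve series have
constant coefficient zero, whence `DEN` has constant coefficient one.
-/

noncomputable section

namespace SimplexDuplex

open scoped PowerSeries.WithPiTopology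

/-! ### Connectedness of finite sets of cells -/

lemma adj_iff {a b : ℤ × ℤ} : cellGraph.Adj a b ↔
    (a.1 = b.1 ∧ (a.2 = b.2 + 1 ∨ b.2 = a.2 + 1)) ∨
      (a.2 = b.2 ∧ (a.1 = b.1 + 1 ∨ b.1 = a.1 + 1)) := by
  change |a.1 - b.1| + |a.2 - b.2| = 1 ↔ _
  rcases abs_cases (a.1 - b.1) with h | h <;> rcases abs_cases (a.2 - b.2) with h' | h' <;> omega

/-- Connectedness in a form without walks: `S` is nonempty, and a property of cells that passes
from each cell of `S` to its neighbours in `S` passes from each cell of `S` to all others. -/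
def Conn (S : Finset (ℤ × ℤ)) : Prop :=
  S.Nonempty ∧ ∀ f : ℤ × ℤ → Prop,
    (∀ a ∈ S, ∀ b ∈ S, cellGraph.Adj a b → f a → f b) → ∀ a ∈ S, ∀ b ∈ S, f a → f b

lemma reachable_invariant {S : Finset (ℤ × ℤ)} {f : ℤ × ℤ → Prop}
    (hf : ∀ a ∈ S, ∀ b ∈ S, cellGraph.Adj a b → f a → f b)
    {a b : (S : Set (ℤ × ℤ))} (h : (cellGraph.induce (S : Set (ℤ × ℤ))).Reachable a b)
    (ha : f a) : f b := by
  obtain ⟨p⟩ := h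
  induction p with
  | nil => exact ha
  | cons h _ ih => exact ih (hf _ (Subtype.prop _) _ (Subtype.prop _) h ha)

lemma Conn.reachable {S : Finset (ℤ × ℤ)} (h : Conn S) (a b : (S : Set (ℤ × ℤ))) :
    (cellGraph.induce (S : Set (ℤ × ℤ))).Reachable a b := by
  obtain ⟨_, h'⟩ := h.2
    (fun c => ∃ hc : c ∈ S, (cellGraph.induce (S : Set (ℤ × ℤ))).Reachable a ⟨c, hc⟩)
    (by
      rintro c hc d hd hcd ⟨_, h'⟩
      refine ⟨hd, h'.trans (SimpleGraph.Adj.reachable ?_)⟩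
      exact hcd) a a.2 b b.2 ⟨a.2, SimpleGraph.Reachable.refl _⟩
  exact h'

lemma isPolyomino_iff_conn {S : Finset (ℤ × ℤ)} : IsPolyomino S ↔ Conn S := by
  constructor
  · intro h
    have := h.nonempty
    refine ⟨?_, fun f hf a ha b hb => reachable_invariant hf (h.preconnected ⟨a, ha⟩ ⟨b, hb⟩)⟩
    obtain ⟨a⟩ := this
    exact ⟨a, a.2⟩
  · intro h
    obtain ⟨a, ha⟩ := h.1
    exact { preconnected := h.reachable, nonempty := ⟨⟨a, ha⟩⟩ }

/-- Some cell of `S` is adjacent to some cell of `T`. -/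
def Touch (S T : Finset (ℤ × ℤ)) : Prop := ∃ a ∈ S, ∃ b ∈ T, cellGraph.Adj a b

lemma Touch.symm {S T : Finset (ℤ × ℤ)} (h : Touch S T) : Touch T S := by
  obtain ⟨a, ha, b, hb, h⟩ := h
  exact ⟨b, hb, a, ha, h.symm⟩

lemma touch_comm {S T : Finset (ℤ × ℤ)} : Touch S T ↔ Touch T S := ⟨Touch.symm, Touch.symm⟩

/-- A disjoint union of connected pieces is connected exactly when the touching graph of the
pieces is. -/
lemma conn_iff_of_pieces {ι : Type*} [Nonempty ι] {p : ι → Finset (ℤ × ℤ)} {S : Finset (ℤ × ℤ)}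
    (hp : ∀ i, Conn (p i)) (hd : ∀ i j c, c ∈ p i → c ∈ p j → i = j)
    (hS : ∀ c, c ∈ S ↔ ∃ i, c ∈ p i) :
    Conn S ↔ ∀ φ : ι → Prop, (∀ i j, Touch (p i) (p j) → φ i → φ j) → ∀ i j, φ i → φ j := by
  constructor
  · intro h φ hφ i j hi
    obtain ⟨a, ha⟩ := (hp i).1
    obtain ⟨b, hb⟩ := (hp j).1
    obtain ⟨k, hk, hk'⟩ := h.2 (fun c => ∃ i, c ∈ p i ∧ φ i) (by
      rintro c hc d hd' hcd ⟨k, hk, hk'⟩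
      obtain ⟨l, hl⟩ := (hS d).1 hd'
      exact ⟨l, hl, hφ k l ⟨c, hk, d, hl, hcd⟩ hk'⟩) a ((hS a).2 ⟨i, ha⟩) b ((hS b).2 ⟨j, hb⟩)
      ⟨i, ha, hi⟩
    rwa [hd j k b hb hk]
  · intro h
    constructor
    · obtain ⟨i⟩ := ‹Nonempty ι›
      obtain ⟨a, ha⟩ := (hp i).1
      exact ⟨a, (hS a).2 ⟨i, ha⟩⟩
    · intro f hf a ha b hb hfa
      obtain ⟨i, hi⟩ := (hS a).1 ha
      obtain ⟨j, hj⟩ := (hS b).1 hb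
      have key : ∀ k, ∀ c ∈ p k, ∀ d ∈ p k, f c → f d := fun k =>
        (hp k).2 f fun c hc d hd => hf c ((hS c).2 ⟨k, hc⟩) d ((hS d).2 ⟨k, hd⟩)
      refine h (fun k => ∀ c ∈ p k, f c) ?_ i j (fun c hc => key i a hi c hc hfa) b hj
      rintro k l ⟨c, hc, d, hd, hcd⟩ hk e he
      exact key l d hd e he (hf c ((hS c).2 ⟨k, hc⟩) d ((hS d).2 ⟨l, hd⟩) hcd (hk c hc))

lemma mem_column {S : Finset (ℤ × ℤ)} {x : ℤ} {c : ℤ × ℤ} :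
    c ∈ column S x ↔ c ∈ S ∧ c.1 = x := by
  simp [column]

/-- The part of `S` in the columns up to `x`. -/
def leftPart (S : Finset (ℤ × ℤ)) (x : ℤ) : Finset (ℤ × ℤ) := S.filter (fun c => c.1 ≤ x)

/-- The part of `S` in the columns from `x` on. -/
def rightPart (S : Finset (ℤ × ℤ)) (x : ℤ) : Finset (ℤ × ℤ) := S.filter (fun c => x ≤ c.1)

lemma mem_leftPart {S : Finset (ℤ × ℤ)} {x : ℤ} {c : ℤ × ℤ} :
    c ∈ leftPart S x ↔ c ∈ S ∧ c.1 ≤ x := by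
  simp [leftPart]

lemma mem_rightPart {S : Finset (ℤ × ℤ)} {x : ℤ} {c : ℤ × ℤ} :
    c ∈ rightPart S x ↔ c ∈ S ∧ x ≤ c.1 := by
  simp [rightPart]

/-- A connected column is a cut: connectedness can be tested on its two sides separately. To see
that one side of a connected set is connected, extend an edge-invariant property of that side
to the other side by its value on the cut. -/
lemma conn_iff_of_cut {S : Finset (ℤ × ℤ)} {x : ℤ} (hc : Conn (column S x)) :
    Conn S ↔ Conn (leftPart S x) ∧ Conn (rightPart S x) := by
  obtain ⟨⟨m, hm⟩, hc⟩ := hc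
  have hm' := mem_column.1 hm
  constructor
  · intro h
    constructor
    · refine ⟨⟨m, mem_leftPart.2 ⟨hm'.1, hm'.2.le⟩⟩, fun f hf a ha b hb hfa => ?_⟩
      have ha' := mem_leftPart.1 ha
      have hb' := mem_leftPart.1 hb
      have hcol : ∀ c ∈ column S x, ∀ d ∈ column S x, f c → f d := hc f fun c hc d hd =>
        hf c (mem_leftPart.2 ⟨(mem_column.1 hc).1, (mem_column.1 hc).2.le⟩)
          d (mem_leftPart.2 ⟨(mem_column.1 hd).1, (mem_column.1 hd).2.le⟩)
      have := h.2 (fun c => (c.1 ≤ x ∧ f c) ∨ (x < c.1 ∧ f m)) (by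
        rintro c hc d hd hcd (⟨h1, h2⟩ | ⟨h1, h2⟩)
        · by_cases hdx : d.1 ≤ x
          · exact Or.inl ⟨hdx, hf c (mem_leftPart.2 ⟨hc, h1⟩) d (mem_leftPart.2 ⟨hd, hdx⟩) hcd h2⟩
          · refine Or.inr ⟨by omega, hcol c (mem_column.2 ⟨hc, ?_⟩) m hm h2⟩
            rcases adj_iff.1 hcd with h | h <;> omega
        · by_cases hdx : d.1 ≤ x
          · refine Or.inl ⟨hdx, hcol m hm d (mem_column.2 ⟨hd, ?_⟩) h2⟩
            rcases adj_iff.1 hcd with h | h <;> omega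
          · exact Or.inr ⟨by omega, h2⟩) a ha'.1 b hb'.1 (Or.inl ⟨ha'.2, hfa⟩)
      rcases this with h | h
      · exact h.2
      · omega
    · refine ⟨⟨m, mem_rightPart.2 ⟨hm'.1, hm'.2.ge⟩⟩, fun f hf a ha b hb hfa => ?_⟩
      have ha' := mem_rightPart.1 ha
      have hb' := mem_rightPart.1 hb
      have hcol : ∀ c ∈ column S x, ∀ d ∈ column S x, f c → f d := hc f fun c hc d hd =>
        hf c (mem_rightPart.2 ⟨(mem_column.1 hc).1, (mem_column.1 hc).2.ge⟩)
          d (mem_rightPart.2 ⟨(mem_column.1 hd).1, (mem_column.1 hd).2.ge⟩)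
      have := h.2 (fun c => (x ≤ c.1 ∧ f c) ∨ (c.1 < x ∧ f m)) (by
        rintro c hc d hd hcd (⟨h1, h2⟩ | ⟨h1, h2⟩)
        · by_cases hdx : x ≤ d.1
          · exact Or.inl
              ⟨hdx, hf c (mem_rightPart.2 ⟨hc, h1⟩) d (mem_rightPart.2 ⟨hd, hdx⟩) hcd h2⟩
          · refine Or.inr ⟨by omega, hcol c (mem_column.2 ⟨hc, ?_⟩) m hm h2⟩
            rcases adj_iff.1 hcd with h | h <;> omega
        · by_cases hdx : x ≤ d.1
          · refine Or.inl ⟨hdx, hcol m hm d (mem_column.2 ⟨hd, ?_⟩) h2⟩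
            rcases adj_iff.1 hcd with h | h <;> omega
          · exact Or.inr ⟨by omega, h2⟩) a ha'.1 b hb'.1 (Or.inl ⟨ha'.2, hfa⟩)
      rcases this with h | h
      · exact h.2
      · omega
  · rintro ⟨hL, hR⟩
    refine ⟨⟨m, hm'.1⟩, fun f hf => ?_⟩
    have kL : ∀ a ∈ leftPart S x, ∀ b ∈ leftPart S x, f a → f b := hL.2 f fun c hc d hd =>
      hf c (mem_leftPart.1 hc).1 d (mem_leftPart.1 hd).1
    have kR : ∀ a ∈ rightPart S x, ∀ b ∈ rightPart S x, f a → f b := hR.2 f fun c hc d hd =>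
      hf c (mem_rightPart.1 hc).1 d (mem_rightPart.1 hd).1
    have mL : m ∈ leftPart S x := mem_leftPart.2 ⟨hm'.1, hm'.2.le⟩
    have mR : m ∈ rightPart S x := mem_rightPart.2 ⟨hm'.1, hm'.2.ge⟩
    intro a ha b hb hfa
    have h1 : f m := by
      rcases le_total a.1 x with h | h
      · exact kL a (mem_leftPart.2 ⟨ha, h⟩) m mL hfa
      · exact kR a (mem_rightPart.2 ⟨ha, h⟩) m mR hfa
    rcases le_total b.1 x with h | h
    · exact kL m mL b (mem_leftPart.2 ⟨hb, h⟩) h1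
    · exact kR m mR b (mem_rightPart.2 ⟨hb, h⟩) h1

/-! ### Vertical segments and the components of a column -/

/-- The vertical segment of `h` cells with lowest cell `(x, y)`. -/
def seg (x y : ℤ) (h : ℕ) : Finset (ℤ × ℤ) := {x} ×ˢ Finset.Ico y (y + h)

/-- Two vertical segments of `a` and `b` cells separated by a gap of `g` cells, with lowest cell
`(x, y)`. -/
def dseg (x y : ℤ) (a g b : ℕ) : Finset (ℤ × ℤ) := seg x y a ∪ seg x (y + a + g) b

lemma mem_seg {x y : ℤ} {h : ℕ} {c : ℤ × ℤ} :
    c ∈ seg x y h ↔ c.1 = x ∧ y ≤ c.2 ∧ c.2 < y + h := by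
  rw [seg, Finset.mem_product, Finset.mem_singleton, Finset.mem_Ico]

lemma mem_dseg {x y : ℤ} {a g b : ℕ} {c : ℤ × ℤ} : c ∈ dseg x y a g b ↔
    c.1 = x ∧ (y ≤ c.2 ∧ c.2 < y + a ∨ y + a + g ≤ c.2 ∧ c.2 < y + a + g + b) := by
  simp only [dseg, Finset.mem_union, mem_seg]; tauto

lemma card_seg (x y : ℤ) (h : ℕ) : (seg x y h).card = h := by
  simp [seg]

lemma card_dseg (x y : ℤ) (a g b : ℕ) : (dseg x y a g b).card = a + b := by
  rw [dseg, Finset.card_union_of_disjoint, card_seg, card_seg]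
  rw [Finset.disjoint_left]
  intro c h1 h2
  rw [mem_seg] at h1 h2
  omega

lemma conn_seg {x y : ℤ} {h : ℕ} (hh : 1 ≤ h) : Conn (seg x y h) := by
  refine ⟨⟨(x, y), mem_seg.2 ⟨rfl, le_refl _, by omega⟩⟩, fun f hf => ?_⟩
  have key : ∀ n : ℕ, n < h → (f (x, y) ↔ f (x, y + n)) := by
    intro n
    induction n with
    | zero => simp
    | succ n ih =>
      intro hn
      have m1 : (x, y + (n : ℤ)) ∈ seg x y h := mem_seg.2 ⟨rfl, by simp, by simp; omega⟩
      have m2 : (x, y + ((n + 1 : ℕ) : ℤ)) ∈ seg x y h :=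
        mem_seg.2 ⟨rfl, by simp; omega, by simp; omega⟩
      have hadj : cellGraph.Adj (x, y + (n : ℤ)) (x, y + ((n + 1 : ℕ) : ℤ)) :=
        adj_iff.2 (by simp; omega)
      exact (ih (by omega)).trans ⟨hf _ m1 _ m2 hadj, hf _ m2 _ m1 hadj.symm⟩
  have key' : ∀ c ∈ seg x y h, (f (x, y) ↔ f c) := by
    rintro ⟨c1, c2⟩ hc
    obtain ⟨h1, h2, h3⟩ := mem_seg.1 hc
    simp only at h1 h2 h3
    have := key (c2 - y).toNat (by omega)
    subst h1
    rwa [Int.toNat_of_nonneg (by omega), add_sub_cancel] at this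
  intro a ha b hb hfa
  exact (key' b hb).1 ((key' a ha).2 hfa)

lemma touch_seg_succ {x y y' : ℤ} {h k : ℕ} (hh : 1 ≤ h) (hk : 1 ≤ k) :
    Touch (seg x y h) (seg (x + 1) y' k) ↔ y < y' + k ∧ y' < y + h := by
  constructor
  · rintro ⟨a, ha, b, hb, hab⟩
    rw [mem_seg] at ha hb
    rw [adj_iff] at hab
    omega
  · intro hy
    refine ⟨(x, max y y'), mem_seg.2 ⟨rfl, ?_⟩, (x + 1, max y y'), mem_seg.2 ⟨rfl, ?_⟩,
      adj_iff.2 (by simp)⟩ <;> simp only <;> omega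

lemma not_touch_seg_of_add_two_le {x x' y y' : ℤ} {h k : ℕ} (hx : x + 2 ≤ x') :
    ¬ Touch (seg x y h) (seg x' y' k) := by
  rintro ⟨a, ha, b, hb, hab⟩
  rw [mem_seg] at ha hb
  rw [adj_iff] at hab
  omega

lemma not_touch_seg_of_gap {x y y' : ℤ} {h k : ℕ} (hy : y + h < y') :
    ¬ Touch (seg x y h) (seg x y' k) := by
  rintro ⟨a, ha, b, hb, hab⟩
  rw [mem_seg] at ha hb
  rw [adj_iff] at hab
  omega

/-- A function that is constant along edges and takes all values of `ι` separates components. -/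
lemma card_le_numComponents {ι : Type*} {S : Finset (ℤ × ℤ)} (f : ℤ × ℤ → ι)
    (hf : ∀ a ∈ S, ∀ b ∈ S, cellGraph.Adj a b → f a = f b) (hs : ∀ i, ∃ c ∈ S, f c = i) :
    Nat.card ι ≤ numComponents S := by
  choose c hc hfc using hs
  refine Nat.card_le_card_of_injective
    (fun i => (cellGraph.induce (S : Set (ℤ × ℤ))).connectedComponentMk ⟨c i, hc i⟩) ?_
  intro i j hij
  have := reachable_invariant (f := fun d => f d = i)
    (fun a ha b hb hab h => (hf a ha b hb hab).symm.trans h)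
    (SimpleGraph.ConnectedComponent.exact hij) (hfc i)
  exact this.symm.trans (hfc j)

/-- A disjoint union of connected pieces that do not touch has the pieces as components. -/
lemma numComponents_of_pieces {ι : Type*} [Finite ι] {p : ι → Finset (ℤ × ℤ)}
    {S : Finset (ℤ × ℤ)} (hp : ∀ i, Conn (p i)) (hd : ∀ i j c, c ∈ p i → c ∈ p j → i = j)
    (ht : ∀ i j, Touch (p i) (p j) → i = j) (hS : ∀ c, c ∈ S ↔ ∃ i, c ∈ p i) :
    numComponents S = Nat.card ι := by
  classical
  apply le_antisymm
  · choose c hc using fun i => (hp i).1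
    refine Nat.card_le_card_of_surjective (fun i =>
      (cellGraph.induce (S : Set (ℤ × ℤ))).connectedComponentMk ⟨c i, (hS _).2 ⟨i, hc i⟩⟩) ?_
    intro C
    induction C using SimpleGraph.ConnectedComponent.ind with | _ v =>
    obtain ⟨i, hi⟩ := (hS v).1 v.2
    refine ⟨i, SimpleGraph.ConnectedComponent.sound ?_⟩
    have := (hp i).reachable ⟨c i, hc i⟩ ⟨v, hi⟩
    exact this.map (SimpleGraph.induceHomOfLE cellGraph
      (s := (p i : Set (ℤ × ℤ))) (fun d hd => (hS d).2 ⟨i, hd⟩)).toHom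
  · rcases isEmpty_or_nonempty ι with h | ⟨⟨i₀⟩⟩
    · simp
    · refine card_le_numComponents (fun c => if h : ∃ i, c ∈ p i then h.choose else i₀) ?_ ?_
      · intro a ha b hb hab
        have ha' := (hS a).1 ha
        have hb' := (hS b).1 hb
        simp only [dif_pos ha', dif_pos hb']
        exact ht _ _ ⟨a, ha'.choose_spec, b, hb'.choose_spec, hab⟩
      · intro i
        obtain ⟨c, hc⟩ := (hp i).1
        have h' : ∃ i, c ∈ p i := ⟨i, hc⟩
        exact ⟨c, (hS c).2 h', by simp only [dif_pos h']; exact hd _ _ c h'.choose_spec hc⟩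

lemma numComponents_empty : numComponents ∅ = 0 := by
  rw [numComponents_of_pieces (ι := Empty) (p := fun _ => ∅)] <;> simp

lemma numComponents_seg {x y : ℤ} {h : ℕ} (hh : 1 ≤ h) : numComponents (seg x y h) = 1 := by
  rw [numComponents_of_pieces (ι := Unit) (p := fun _ => seg x y h)] <;> simp [conn_seg hh]

lemma numComponents_dseg {x y : ℤ} {a g b : ℕ} (ha : 1 ≤ a) (hg : 1 ≤ g) (hb : 1 ≤ b) :
    numComponents (dseg x y a g b) = 2 := by
  have ht : ¬ Touch (seg x y a) (seg x (y + a + g) b) := not_touch_seg_of_gap (by omega)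
  have ht' : ¬ Touch (seg x (y + a + g) b) (seg x y a) := fun h => ht h.symm
  rw [numComponents_of_pieces (ι := Bool)
    (p := fun i => cond i (seg x (y + a + g) b) (seg x y a))]
  · simp
  · simp [conn_seg ha, conn_seg hb]
  · simp only [Bool.forall_bool, cond_true, cond_false, mem_seg]
    refine ⟨⟨by simp, fun c h1 h2 => by omega⟩, fun c h1 h2 => by omega, by simp⟩
  · simp [ht, ht']
  · simp [dseg]

/-- A maximal vertical segment at the bottom of a set of cells in one column. -/
lemma exists_lowest_run {S : Finset (ℤ × ℤ)} {x : ℤ} (hx : ∀ c ∈ S, c.1 = x) (hS : S.Nonempty) :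
    ∃ y : ℤ, ∃ a : ℕ, 1 ≤ a ∧ (∀ c ∈ seg x y a, c ∈ S) ∧ (∀ c ∈ S, y ≤ c.2) ∧
      (x, y + a) ∉ S := by
  classical
  obtain ⟨m, hm, hmin⟩ := S.exists_min_image Prod.snd hS
  have hex : ∃ a : ℕ, (x, m.2 + (a : ℤ)) ∉ S := by
    by_contra! hall
    have : Set.InjOn (fun a : ℕ => (x, m.2 + (a : ℤ))) (Set.univ : Set ℕ) := by
      intro a _ b _ hab
      simpa using hab
    exact Set.infinite_univ (Set.Finite.of_finite_image
      (S.finite_toSet.subset (by rintro _ ⟨a, -, rfl⟩; exact hall a)) this)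
  have hmS : (x, m.2) ∈ S := by rwa [← hx m hm]
  refine ⟨m.2, Nat.find hex, ?_, ?_, hmin, Nat.find_spec hex⟩
  · rw [Nat.one_le_iff_ne_zero]
    intro h0
    have := Nat.find_spec hex
    rw [h0] at this
    simp [hmS] at this
  · rintro ⟨c1, c2⟩ hc
    obtain ⟨h1, h2, h3⟩ := mem_seg.1 hc
    simp only at h1 h2 h3
    have := Nat.find_min hex (m := (c2 - m.2).toNat) (by omega)
    rw [not_not, Int.toNat_of_nonneg (by omega), add_sub_cancel] at this
    rwa [h1]

/-- A nonempty part of a column is a segment, or two segments with a gap between them, or has at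
least three components. -/
lemma column_trichotomy {S : Finset (ℤ × ℤ)} {x : ℤ} (hx : ∀ c ∈ S, c.1 = x) (hS : S.Nonempty) :
    (∃ y : ℤ, ∃ h : ℕ, 1 ≤ h ∧ S = seg x y h) ∨
    (∃ y : ℤ, ∃ a g b : ℕ, 1 ≤ a ∧ 1 ≤ g ∧ 1 ≤ b ∧ S = dseg x y a g b) ∨
    3 ≤ numComponents S := by
  classical
  obtain ⟨y, a, ha, hsub, hmin, hgap⟩ := exists_lowest_run hx hS
  by_cases hS1 : S \ seg x y a = ∅
  · refine Or.inl ⟨y, a, ha, le_antisymm (Finset.sdiff_eq_empty_iff_subset.1 hS1) hsub⟩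
  obtain ⟨y', b, hb, hsub', hmin', hgap'⟩ := exists_lowest_run (S := S \ seg x y a) (x := x)
    (fun c hc => hx c (Finset.mem_sdiff.1 hc).1) (Finset.nonempty_iff_ne_empty.2 hS1)
  have hy' : (x, y') ∈ S \ seg x y a := hsub' _ (mem_seg.2 ⟨rfl, le_refl _, by simp; omega⟩)
  have hyy : y + a < y' := by
    rw [Finset.mem_sdiff, mem_seg] at hy'
    have h1 := hmin _ hy'.1
    have h2 : y' ≠ y + a := fun h => hgap (h ▸ hy'.1)
    have h3 := hy'.2
    simp only [true_and, not_and, not_lt] at h1 h3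
    have := h3 h1
    omega
  have hgap2 : (x, y' + b) ∉ S := fun h => hgap' (by
    rw [Finset.mem_sdiff, mem_seg]; exact ⟨h, by simp only; omega⟩)
  by_cases hS2 : (S \ seg x y a) \ seg x y' b = ∅
  · right; left
    refine ⟨y, a, (y' - (y + a)).toNat, b, ha, by omega, hb, ?_⟩
    have e : y + a + ((y' - (y + a)).toNat : ℤ) = y' := by omega
    rw [dseg, e]
    ext c
    rw [Finset.mem_union]
    constructor
    · intro hc
      by_contra h
      rw [not_or] at h
      have : c ∈ (S \ seg x y a) \ seg x y' b := by simp [hc, h]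
      rw [hS2] at this
      simp at this
    · rintro (h | h)
      · exact hsub c h
      · exact (Finset.mem_sdiff.1 (hsub' c h)).1
  · right; right
    obtain ⟨m, hm⟩ := Finset.nonempty_iff_ne_empty.2 hS2
    rw [Finset.mem_sdiff] at hm
    have hm1 := hmin' m hm.1
    have hmS := (Finset.mem_sdiff.1 hm.1).1
    have hmx := hx m hmS
    have hm2 : y' + b ≤ m.2 := by
      have := hm.2
      rw [mem_seg] at this
      simp only [hmx, true_and, not_and, not_lt] at this
      exact this hm1
    have : Nat.card (Fin 3) ≤ numComponents S := by
      -- the first cells above the two lowest runs are not in `S`, so an edge cannot pass them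
      refine card_le_numComponents
        (fun c => if c.2 ≤ y + a then (0 : Fin 3) else if c.2 ≤ y' + b then 1 else 2) ?_ ?_
      · intro c hc d hd hcd
        have e1 := hx c hc
        have e2 := hx d hd
        have n1 : c.2 ≠ y + a := fun h => hgap (by rw [← h, ← e1]; exact hc)
        have n2 : d.2 ≠ y + a := fun h => hgap (by rw [← h, ← e2]; exact hd)
        have n3 : c.2 ≠ y' + b := fun h => hgap2 (by rw [← h, ← e1]; exact hc)
        have n4 : d.2 ≠ y' + b := fun h => hgap2 (by rw [← h, ← e2]; exact hd)
        rw [adj_iff] at hcd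
        split_ifs <;> first | rfl | omega
      · intro i
        fin_cases i
        · exact ⟨(x, y), hsub _ (mem_seg.2 ⟨rfl, le_refl _, by simp; omega⟩), by simp⟩
        · refine ⟨(x, y'), (Finset.mem_sdiff.1 hy').1, ?_⟩
          simp [hyy]
        · have hne : m.2 ≠ y' + b := fun h => hgap2 (by rw [← h, ← hmx]; exact hmS)
          refine ⟨m, hmS, ?_⟩
          have h1 : ¬ m.2 ≤ y + a := by omega
          have h2 : ¬ m.2 ≤ y' + b := by omega
          simp [h1, h2]
    simpa using this

lemma numComponents_column_eq_one {P : Finset (ℤ × ℤ)} {x : ℤ} :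
    numComponents (column P x) = 1 ↔ ∃ y : ℤ, ∃ h : ℕ, 1 ≤ h ∧ column P x = seg x y h := by
  constructor
  · intro h
    have hne : (column P x).Nonempty := by
      rw [Finset.nonempty_iff_ne_empty]
      intro h0
      rw [h0, numComponents_empty] at h
      omega
    rcases column_trichotomy (x := x) (fun c hc => (mem_column.1 hc).2) hne with
      h' | ⟨y, a, g, b, ha, hg, hb, h'⟩ | h'
    · exact h'
    · rw [h', numComponents_dseg ha hg hb] at h
      omega
    · omega
  · rintro ⟨y, h, hh, e⟩
    rw [e, numComponents_seg hh]

lemma numComponents_column_eq_two {P : Finset (ℤ × ℤ)} {x : ℤ} :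
    numComponents (column P x) = 2 ↔ ∃ y : ℤ, ∃ a g b : ℕ, 1 ≤ a ∧ 1 ≤ g ∧ 1 ≤ b ∧
      column P x = dseg x y a g b := by
  constructor
  · intro h
    have hne : (column P x).Nonempty := by
      rw [Finset.nonempty_iff_ne_empty]
      intro h0
      rw [h0, numComponents_empty] at h
      omega
    rcases column_trichotomy (x := x) (fun c hc => (mem_column.1 hc).2) hne with
      ⟨y, k, hk, h'⟩ | h' | h'
    · rw [h', numComponents_seg hk] at h
      omega
    · exact h'
    · omega
  · rintro ⟨y, a, g, b, ha, hg, hb, e⟩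
    rw [e, numComponents_dseg ha hg hb]

/-! ### Columns, translations and cuts of simplex-duplex polyominoes -/

/-- The number of components of the column of `P` at `x`. -/
def columnComponents (P : Finset (ℤ × ℤ)) (x : ℤ) : ℕ := numComponents (column P x)

lemma mem_columnIndices {P : Finset (ℤ × ℤ)} {x : ℤ} :
    x ∈ columnIndices P ↔ (column P x).Nonempty := by
  simp only [columnIndices, Finset.mem_image, Finset.Nonempty, mem_column]

lemma columnComponents_pos {P : Finset (ℤ × ℤ)} {x : ℤ} (h : (column P x).Nonempty) :
    1 ≤ columnComponents P x := by
  rcases column_trichotomy (x := x) (fun c hc => (mem_column.1 hc).2) h with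
    ⟨y, k, hk, e⟩ | ⟨y, a, g, b, ha, hg, hb, e⟩ | h'
  · rw [columnComponents, e, numComponents_seg hk]
  · rw [columnComponents, e, numComponents_dseg ha hg hb]
    omega
  · exact le_trans (by omega) h'

lemma columnComponents_of_empty {P : Finset (ℤ × ℤ)} {x : ℤ} (h : column P x = ∅) :
    columnComponents P x = 0 := by
  rw [columnComponents, h, numComponents_empty]

lemma column_eq_empty_of_columnComponents {P : Finset (ℤ × ℤ)} {x : ℤ}
    (h : columnComponents P x = 0) : column P x = ∅ := by
  by_contra hne
  have := columnComponents_pos (Finset.nonempty_iff_ne_empty.2 hne)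
  omega

lemma mem_duplexIndices {P : Finset (ℤ × ℤ)} {x : ℤ} :
    x ∈ duplexIndices P ↔ columnComponents P x = 2 := by
  rw [duplexIndices, Finset.mem_filter, mem_columnIndices]
  refine ⟨fun h => h.2, fun h => ⟨?_, h⟩⟩
  by_contra hne
  rw [columnComponents_of_empty (Finset.not_nonempty_iff_eq_empty.1 hne)] at h
  omega

lemma isSimplexDuplex_iff {P : Finset (ℤ × ℤ)} : IsSimplexDuplex P ↔
    Conn P ∧ (∀ x, columnComponents P x ≤ 2) ∧
      ∀ x, columnComponents P x = 2 → columnComponents P (x + 1) ≠ 2 := by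
  simp only [IsSimplexDuplex, IsColumnDuplex, isPolyomino_iff_conn, mem_duplexIndices, and_assoc]
  refine and_congr_right fun _ => and_congr_left fun _ => ⟨fun h x => ?_, fun h x hx => ?_⟩
  · by_cases hx : (column P x).Nonempty
    · have := h x (mem_columnIndices.2 hx)
      rw [columnComponents]
      omega
    · rw [columnComponents_of_empty (Finset.not_nonempty_iff_eq_empty.1 hx)]
      omega
  · have := columnComponents_pos (mem_columnIndices.1 hx)
    have := h x
    rw [columnComponents] at *
    omega

lemma columnComponents_of_seg {P : Finset (ℤ × ℤ)} {x y : ℤ} {h : ℕ} (hh : 1 ≤ h)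
    (e : column P x = seg x y h) : columnComponents P x = 1 := by
  rw [columnComponents, e, numComponents_seg hh]

lemma columnComponents_of_dseg {P : Finset (ℤ × ℤ)} {x y : ℤ} {a g b : ℕ} (ha : 1 ≤ a)
    (hg : 1 ≤ g) (hb : 1 ≤ b) (e : column P x = dseg x y a g b) : columnComponents P x = 2 := by
  rw [columnComponents, e, numComponents_dseg ha hg hb]

/-- The translate of `P` by `v`. -/
def shift (v : ℤ × ℤ) (P : Finset (ℤ × ℤ)) : Finset (ℤ × ℤ) := P.image (fun c => c + v)

lemma mem_shift {v c : ℤ × ℤ} {P : Finset (ℤ × ℤ)} : c ∈ shift v P ↔ c - v ∈ P := by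
  simp only [shift, Finset.mem_image]
  constructor
  · rintro ⟨d, hd, rfl⟩
    rwa [add_sub_cancel_right]
  · exact fun h => ⟨_, h, sub_add_cancel _ _⟩

lemma shift_shift (u v : ℤ × ℤ) (P : Finset (ℤ × ℤ)) : shift u (shift v P) = shift (u + v) P := by
  ext c
  rw [mem_shift, mem_shift, mem_shift, sub_sub]

lemma shift_zero (P : Finset (ℤ × ℤ)) : shift 0 P = P := by
  ext c
  rw [mem_shift, sub_zero]

lemma card_shift (v : ℤ × ℤ) (P : Finset (ℤ × ℤ)) : (shift v P).card = P.card :=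
  Finset.card_image_of_injective _ (add_left_injective v)

/-- Translation as an isomorphism of the induced graphs. -/
def shiftIso (v : ℤ × ℤ) (P : Finset (ℤ × ℤ)) :
    cellGraph.induce (P : Set (ℤ × ℤ)) ≃g cellGraph.induce (shift v P : Set (ℤ × ℤ)) where
  toEquiv := (Equiv.addRight v).subtypeEquiv (by
    intro c
    rw [Finset.mem_coe, Finset.mem_coe, mem_shift, Equiv.coe_addRight, add_sub_cancel_right])
  map_rel_iff' := by
    intro a b
    simp [adj_iff]
    omega

lemma numComponents_shift (v : ℤ × ℤ) (P : Finset (ℤ × ℤ)) :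
    numComponents (shift v P) = numComponents P :=
  (Nat.card_congr (shiftIso v P).connectedComponentEquiv).symm

lemma conn_shift {v : ℤ × ℤ} {P : Finset (ℤ × ℤ)} : Conn (shift v P) ↔ Conn P := by
  rw [← isPolyomino_iff_conn, ← isPolyomino_iff_conn]
  exact (shiftIso v P).connected_iff.symm

lemma column_shift (v : ℤ × ℤ) (P : Finset (ℤ × ℤ)) (x : ℤ) :
    column (shift v P) x = shift v (column P (x - v.1)) := by
  ext c
  rw [mem_column, mem_shift, mem_shift, mem_column, Prod.fst_sub, sub_left_inj]

lemma columnComponents_shift (v : ℤ × ℤ) (P : Finset (ℤ × ℤ)) (x : ℤ) :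
    columnComponents (shift v P) x = columnComponents P (x - v.1) := by
  rw [columnComponents, column_shift, numComponents_shift, columnComponents]

lemma isSimplexDuplex_shift {v : ℤ × ℤ} {P : Finset (ℤ × ℤ)} :
    IsSimplexDuplex (shift v P) ↔ IsSimplexDuplex P := by
  simp only [isSimplexDuplex_iff, conn_shift, columnComponents_shift]
  refine and_congr_right fun _ => and_congr ⟨fun h x => ?_, fun h x => h _⟩
    ⟨fun h x => ?_, fun h x => ?_⟩
  · simpa using h (x + v.1)
  · have := h (x + v.1)
    rwa [add_sub_cancel_right, add_right_comm, add_sub_cancel_right] at this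
  · have := h (x - v.1)
    rwa [sub_add_eq_add_sub] at this

lemma duplexIndices_shift (v : ℤ × ℤ) (P : Finset (ℤ × ℤ)) :
    (duplexIndices (shift v P)).card = (duplexIndices P).card := by
  have : duplexIndices (shift v P) = (duplexIndices P).image (fun x => x + v.1) := by
    ext x
    simp only [mem_duplexIndices, columnComponents_shift, Finset.mem_image]
    exact ⟨fun h => ⟨_, h, sub_add_cancel _ _⟩, by rintro ⟨y, hy, rfl⟩; simpa using hy⟩
  rw [this, Finset.card_image_of_injective _ (add_left_injective v.1)]

lemma shift_seg (v : ℤ × ℤ) (x y : ℤ) (h : ℕ) :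
    shift v (seg x y h) = seg (x + v.1) (y + v.2) h := by
  ext c
  rw [mem_shift, mem_seg, mem_seg, Prod.fst_sub, Prod.snd_sub]
  omega

lemma column_leftPart {P : Finset (ℤ × ℤ)} {x x' : ℤ} (h : x' ≤ x) :
    column (leftPart P x) x' = column P x' := by
  ext c
  simp only [mem_column, mem_leftPart]
  exact ⟨fun hc => ⟨hc.1.1, hc.2⟩, fun hc => ⟨⟨hc.1, by omega⟩, hc.2⟩⟩

lemma column_leftPart_of_lt {P : Finset (ℤ × ℤ)} {x x' : ℤ} (h : x < x') :
    column (leftPart P x) x' = ∅ := by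
  ext c
  simp only [mem_column, mem_leftPart, Finset.notMem_empty, iff_false]
  omega

lemma column_rightPart {P : Finset (ℤ × ℤ)} {x x' : ℤ} (h : x ≤ x') :
    column (rightPart P x) x' = column P x' := by
  ext c
  simp only [mem_column, mem_rightPart]
  exact ⟨fun hc => ⟨hc.1.1, hc.2⟩, fun hc => ⟨⟨hc.1, by omega⟩, hc.2⟩⟩

lemma column_rightPart_of_lt {P : Finset (ℤ × ℤ)} {x x' : ℤ} (h : x' < x) :
    column (rightPart P x) x' = ∅ := by
  ext c
  simp only [mem_column, mem_rightPart, Finset.notMem_empty, iff_false]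
  omega

/-- A simplex column cuts a simplex-duplex polyomino into two simplex-duplex polyominoes. -/
lemma isSimplexDuplex_iff_of_cut {Q : Finset (ℤ × ℤ)} {x y : ℤ} {h : ℕ} (hh : 1 ≤ h)
    (e : column Q x = seg x y h) : IsSimplexDuplex Q ↔
      IsSimplexDuplex (leftPart Q x) ∧ IsSimplexDuplex (rightPart Q x) := by
  have hx := columnComponents_of_seg hh e
  have l1 : ∀ x' ≤ x, columnComponents (leftPart Q x) x' = columnComponents Q x' :=
    fun x' hx' => by rw [columnComponents, column_leftPart hx', columnComponents]
  have l2 : ∀ x', x < x' → columnComponents (leftPart Q x) x' = 0 :=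
    fun x' hx' => columnComponents_of_empty (column_leftPart_of_lt hx')
  have r1 : ∀ x', x ≤ x' → columnComponents (rightPart Q x) x' = columnComponents Q x' :=
    fun x' hx' => by rw [columnComponents, column_rightPart hx', columnComponents]
  have r2 : ∀ x' < x, columnComponents (rightPart Q x) x' = 0 :=
    fun x' hx' => columnComponents_of_empty (column_rightPart_of_lt hx')
  simp only [isSimplexDuplex_iff, conn_iff_of_cut (S := Q) (x := x) (e ▸ conn_seg hh)]
  constructor
  · rintro ⟨⟨hL, hR⟩, h2, hc⟩
    refine ⟨⟨hL, fun x' => ?_, fun x' => ?_⟩, ⟨hR, fun x' => ?_, fun x' => ?_⟩⟩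
    · rcases le_or_gt x' x with h' | h'
      · exact (l1 x' h').trans_le (h2 x')
      · rw [l2 x' h']
        omega
    · rcases lt_or_ge x' x with h' | h'
      · rw [l1 x' h'.le, l1 (x' + 1) (by omega)]
        exact hc x'
      · rw [l2 (x' + 1) (by omega)]
        omega
    · rcases lt_or_ge x' x with h' | h'
      · rw [r2 x' h']
        omega
      · exact (r1 x' h').trans_le (h2 x')
    · rcases lt_or_ge x' x with h' | h'
      · rw [r2 x' h']
        omega
      · rw [r1 x' h', r1 (x' + 1) (by omega)]
        exact hc x'
  · rintro ⟨⟨hL, h2, hc⟩, hR, h2', hc'⟩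
    refine ⟨⟨hL, hR⟩, fun x' => ?_, fun x' => ?_⟩
    · rcases le_total x' x with h' | h'
      · exact (l1 x' h').symm.trans_le (h2 x')
      · exact (r1 x' h').symm.trans_le (h2' x')
    · rcases lt_or_ge x' x with h' | h'
      · rw [← l1 x' h'.le, ← l1 (x' + 1) (by omega)]
        exact hc x'
      · rw [← r1 x' h', ← r1 (x' + 1) (by omega)]
        exact hc' x'

lemma card_cut {Q : Finset (ℤ × ℤ)} {x y : ℤ} {h : ℕ} (e : column Q x = seg x y h) :
    (leftPart Q x).card + (rightPart Q x).card = Q.card + h := by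
  rw [← Finset.card_union_add_card_inter]
  have h1 : leftPart Q x ∪ rightPart Q x = Q := by
    ext c
    simp only [Finset.mem_union, mem_leftPart, mem_rightPart]
    have := le_total c.1 x
    tauto
  have h2 : leftPart Q x ∩ rightPart Q x = column Q x := by
    ext c
    simp only [Finset.mem_inter, mem_leftPart, mem_rightPart, mem_column]
    refine ⟨fun h => ⟨h.1.1, by omega⟩, fun h => ⟨⟨h.1, by omega⟩, h.1, by omega⟩⟩
  rw [h1, h2, e, card_seg]

lemma duplexIndices_cut {Q : Finset (ℤ × ℤ)} {x y : ℤ} {h : ℕ} (hh : 1 ≤ h)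
    (e : column Q x = seg x y h) : (duplexIndices Q).card =
      (duplexIndices (leftPart Q x)).card + (duplexIndices (rightPart Q x)).card := by
  have hx := columnComponents_of_seg hh e
  rw [← Finset.card_union_of_disjoint]
  · congr 1
    ext x'
    simp only [Finset.mem_union, mem_duplexIndices]
    rcases lt_trichotomy x' x with h' | h' | h'
    · simp only [columnComponents, column_leftPart h'.le, column_rightPart_of_lt h',
        numComponents_empty]
      omega
    · subst h'
      simp only [columnComponents, column_leftPart le_rfl, column_rightPart le_rfl]
      omega
    · simp only [columnComponents, column_rightPart h'.le, column_leftPart_of_lt h',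
        numComponents_empty]
      omega
  · rw [Finset.disjoint_left]
    intro x' h1 h2
    rw [mem_duplexIndices] at h1 h2
    rcases lt_trichotomy x' x with h' | h' | h'
    · rw [columnComponents, column_rightPart_of_lt h', numComponents_empty] at h2
      omega
    · subst h'
      rw [columnComponents, column_leftPart le_rfl] at h1
      rw [columnComponents] at hx
      omega
    · rw [columnComponents, column_leftPart_of_lt h', numComponents_empty] at h1
      omega

/-- A connected set lies on one side of each of its empty columns. -/
lemma Conn.lt_of_column_eq_empty {Q : Finset (ℤ × ℤ)} (hQ : Conn Q) {x : ℤ}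
    (e : column Q x = ∅) {c : ℤ × ℤ} (hc : c ∈ Q) (hcx : x < c.1) : ∀ d ∈ Q, x < d.1 := by
  intro d hd
  have hne : ∀ d ∈ Q, d.1 ≠ x := by
    intro d hd hdx
    have : d ∈ column Q x := mem_column.2 ⟨hd, hdx⟩
    rw [e] at this
    simp at this
  refine hQ.2 (fun c => x < c.1) (fun a ha b hb hab h => ?_) c hc d hd hcx
  have := hne b hb
  rw [adj_iff] at hab
  omega

/-! ### Blocks of neighbouring columns -/

/-- The heights, relative to the lowest cell of a duplex column with component sizes `a` and `b`
and gap `g`, at which a neighbouring segment of `h` cells touches at least one component. -/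
def touchAny (h a g b : ℕ) : Finset ℤ :=
  Finset.Ioo (-(h : ℤ)) a ∪ Finset.Ioo ((a : ℤ) + g - h) (a + g + b)

/-- The relative heights at which a neighbouring segment touches both components. -/
def touchBoth (h a g : ℕ) : Finset ℤ := Finset.Ioo ((a : ℤ) + g - h) a

/-- The pairs of relative heights of two segments, one on each side of a duplex column, for which
the three columns form a connected set. -/
def blockPairs (h k a g b : ℕ) : Finset (ℤ × ℤ) :=
  touchBoth h a g ×ˢ touchAny k a g b ∪ touchAny h a g b ×ˢ touchBoth k a g

lemma column_union (S T : Finset (ℤ × ℤ)) (x : ℤ) :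
    column (S ∪ T) x = column S x ∪ column T x := by
  rw [column, Finset.filter_union, column, column]

lemma column_eq_self {S : Finset (ℤ × ℤ)} {x : ℤ} (h : ∀ c ∈ S, c.1 = x) : column S x = S :=
  Finset.filter_true_of_mem h

lemma column_eq_empty {S : Finset (ℤ × ℤ)} {x : ℤ} (h : ∀ c ∈ S, c.1 ≠ x) : column S x = ∅ :=
  Finset.filter_false_of_mem h

lemma column_seg (x y : ℤ) (h : ℕ) (x' : ℤ) :
    column (seg x y h) x' = if x = x' then seg x y h else ∅ := by
  split_ifs with hx
  · exact column_eq_self fun c hc => (mem_seg.1 hc).1.trans hx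
  · exact column_eq_empty fun c hc => by rw [(mem_seg.1 hc).1]; exact hx

lemma column_dseg (x y : ℤ) (a g b : ℕ) (x' : ℤ) :
    column (dseg x y a g b) x' = if x = x' then dseg x y a g b else ∅ := by
  split_ifs with hx
  · exact column_eq_self fun c hc => (mem_dseg.1 hc).1.trans hx
  · exact column_eq_empty fun c hc => by rw [(mem_dseg.1 hc).1]; exact hx

lemma isSimplexDuplex_seg {x y : ℤ} {h : ℕ} (hh : 1 ≤ h) : IsSimplexDuplex (seg x y h) := by
  have : ∀ x', columnComponents (seg x y h) x' ≤ 1 := by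
    intro x'
    rw [columnComponents, column_seg]
    split_ifs
    · exact (numComponents_seg hh).le
    · simp [numComponents_empty]
  refine isSimplexDuplex_iff.2 ⟨conn_seg hh, fun x' => (this x').trans (by omega), fun x' h => ?_⟩
  have := this x'
  omega

lemma duplexIndices_seg {x y : ℤ} {h : ℕ} (hh : 1 ≤ h) : duplexIndices (seg x y h) = ∅ := by
  ext x'
  rw [mem_duplexIndices, columnComponents, column_seg]
  split_ifs
  · simp [numComponents_seg hh]
  · simp [numComponents_empty]

lemma conn_seg_seg {x y y' : ℤ} {h k : ℕ} (hh : 1 ≤ h) (hk : 1 ≤ k) :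
    Conn (seg x y h ∪ seg (x + 1) y' k) ↔ y < y' + k ∧ y' < y + h := by
  rw [conn_iff_of_pieces (ι := Bool)
    (p := fun i => cond i (seg (x + 1) y' k) (seg x y h))]
  · simp only [Bool.forall_bool, cond_true, cond_false, touch_seg_succ hh hk,
      touch_comm (S := seg (x + 1) y' k) (T := seg x y h)]
    constructor
    · intro H
      by_contra hn
      have := H (fun i => i = true) (by simp [hn])
      simp at this
    · intro H φ hφ
      exact ⟨⟨id, hφ.1.2 H⟩, ⟨hφ.2.1 H, id⟩⟩
  · simp [conn_seg hh, conn_seg hk]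
  · simp only [Bool.forall_bool, cond_true, cond_false, mem_seg]
    refine ⟨⟨by simp, fun c h1 h2 => by omega⟩, fun c h1 h2 => by omega, by simp⟩
  · simp

lemma isSimplexDuplex_seg_seg {x y y' : ℤ} {h k : ℕ} (hh : 1 ≤ h) (hk : 1 ≤ k) :
    IsSimplexDuplex (seg x y h ∪ seg (x + 1) y' k) ↔ y < y' + k ∧ y' < y + h := by
  have : ∀ x', columnComponents (seg x y h ∪ seg (x + 1) y' k) x' ≤ 1 := by
    intro x'
    rw [columnComponents, column_union, column_seg, column_seg]
    split_ifs
    · omega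
    · simp [(numComponents_seg hh).le]
    · simp [(numComponents_seg hk).le]
    · simp [numComponents_empty]
  rw [isSimplexDuplex_iff, conn_seg_seg hh hk]
  refine ⟨fun h => h.1, fun h => ⟨h, fun x' => (this x').trans (by omega), fun x' h => ?_⟩⟩
  have := this x'
  omega

lemma duplexIndices_seg_seg {x y y' : ℤ} {h k : ℕ} (hh : 1 ≤ h) (hk : 1 ≤ k) :
    duplexIndices (seg x y h ∪ seg (x + 1) y' k) = ∅ := by
  ext x'
  rw [mem_duplexIndices, columnComponents, column_union, column_seg, column_seg]
  split_ifs
  · omega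
  · simp [numComponents_seg hh]
  · simp [numComponents_seg hk]
  · simp [numComponents_empty]

/-- The set of columns consisting of the segments of heights `h` and `k` at `x` and `x + 2` and of
a duplex column between them. -/
def block (x y z y' : ℤ) (h a g b k : ℕ) : Finset (ℤ × ℤ) :=
  seg x y h ∪ dseg (x + 1) z a g b ∪ seg (x + 2) y' k

/-- The conditions under which a cycle of four pieces, only some of whose edges are present, is
connected: each middle piece has an edge, and one of them has both. -/
lemma four_cycle_connected_iff {p : Fin 4 → Finset (ℤ × ℤ)} (h03 : ¬ Touch (p 0) (p 3))
    (h12 : ¬ Touch (p 1) (p 2)) :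
    (∀ φ : Fin 4 → Prop, (∀ i j, Touch (p i) (p j) → φ i → φ j) → ∀ i j, φ i → φ j) ↔
      (Touch (p 0) (p 1) ∧ Touch (p 0) (p 2)) ∧ (Touch (p 3) (p 1) ∨ Touch (p 3) (p 2)) ∨
      (Touch (p 0) (p 1) ∨ Touch (p 0) (p 2)) ∧ (Touch (p 3) (p 1) ∧ Touch (p 3) (p 2)) := by
  constructor
  · intro H
    have key : ∀ s a b t : Prop, (Touch (p 0) (p 1) → (s ↔ a)) →
        (Touch (p 0) (p 2) → (s ↔ b)) → (Touch (p 3) (p 1) → (t ↔ a)) →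
        (Touch (p 3) (p 2) → (t ↔ b)) → (s ↔ a) ∧ (s ↔ b) ∧ (s ↔ t) := by
      intro s a b t h1 h2 h3 h4
      have := H ![s, a, b, t] (by
        intro i j
        fin_cases i <;> fin_cases j <;> intro ht <;>
          first | exact id | exact (h1 ht).1 | exact (h1 ht.symm).2 | exact (h2 ht).1 |
            exact (h2 ht.symm).2 | exact (h3 ht).1 | exact (h3 ht.symm).2 | exact (h4 ht).1 |
            exact (h4 ht.symm).2 | exact absurd ht h03 | exact absurd ht.symm h03 |
            exact absurd ht h12 | exact absurd ht.symm h12)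
      exact ⟨⟨this 0 1, this 1 0⟩, ⟨this 0 2, this 2 0⟩, ⟨this 0 3, this 3 0⟩⟩
    have k1 := key True False False False
    have k2 := key False True False False
    have k3 := key False False True False
    have k4 := key False False False True
    have k5 := key True True False False
    have k6 := key True False True False
    simp only [iff_false, iff_true, not_true, imp_false, imp_true_iff, true_imp_iff,
      and_false, and_true] at k1 k2 k3 k4 k5 k6
    tauto
  · intro H φ hφ
    have e : ∀ i j, Touch (p i) (p j) → (φ i ↔ φ j) :=
      fun i j h => ⟨hφ i j h, hφ j i h.symm⟩
    obtain ⟨a1, a2, a3⟩ : (φ 0 ↔ φ 1) ∧ (φ 0 ↔ φ 2) ∧ (φ 0 ↔ φ 3) := by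
      rcases H with ⟨⟨h1, h2⟩, h3 | h3⟩ | ⟨h1 | h1, h3, h4⟩
      · exact ⟨e _ _ h1, e _ _ h2, (e _ _ h1).trans (e _ _ h3).symm⟩
      · exact ⟨e _ _ h1, e _ _ h2, (e _ _ h2).trans (e _ _ h3).symm⟩
      · have := (e _ _ h1).trans (e _ _ h3).symm
        exact ⟨e _ _ h1, this.trans (e _ _ h4), this⟩
      · have := (e _ _ h1).trans (e _ _ h4).symm
        exact ⟨this.trans (e _ _ h3), e _ _ h1, this⟩
    have : ∀ i, φ 0 ↔ φ i := by
      intro i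
      fin_cases i
      · rfl
      · exact a1
      · exact a2
      · exact a3
    intro i j hi
    exact (this j).1 ((this i).2 hi)

lemma mem_touchBoth_iff {h a g b : ℕ} (ha : 1 ≤ a) (hb : 1 ≤ b) {i : ℤ} :
    i ∈ touchBoth h a g ↔ (i < a ∧ 0 < i + h) ∧ (i < a + g + b ∧ a + g < i + h) := by
  rw [touchBoth, Finset.mem_Ioo]
  omega

lemma mem_touchAny_iff {h a g b : ℕ} {i : ℤ} :
    i ∈ touchAny h a g b ↔ (i < a ∧ 0 < i + h) ∨ (i < a + g + b ∧ a + g < i + h) := by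
  rw [touchAny, Finset.mem_union, Finset.mem_Ioo, Finset.mem_Ioo]
  omega

lemma touch_seg_pred {x x' y y' : ℤ} {h k : ℕ} (hx : x = x' + 1) (hh : 1 ≤ h) (hk : 1 ≤ k) :
    Touch (seg x y h) (seg x' y' k) ↔ y' < y + h ∧ y < y' + k := by
  subst hx
  rw [touch_comm, touch_seg_succ hk hh]

lemma conn_block {x y z y' : ℤ} {h a g b k : ℕ} (hh : 1 ≤ h) (ha : 1 ≤ a) (hg : 1 ≤ g)
    (hb : 1 ≤ b) (hk : 1 ≤ k) : Conn (block x y z y' h a g b k) ↔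
      (y - z, y' - z) ∈ blockPairs h k a g b := by
  rw [conn_iff_of_pieces (ι := Fin 4) (p := ![seg x y h, seg (x + 1) z a,
    seg (x + 1) (z + a + g) b, seg (x + 2) y' k])]
  · rw [four_cycle_connected_iff (not_touch_seg_of_add_two_le le_rfl)
      (not_touch_seg_of_gap (by omega)), blockPairs, Finset.mem_union, Finset.mem_product,
      Finset.mem_product, mem_touchBoth_iff ha hb, mem_touchBoth_iff ha hb, mem_touchAny_iff,
      mem_touchAny_iff]
    have t1 : Touch (seg x y h) (seg (x + 1) z a) ↔ y - z < a ∧ 0 < y - z + h := by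
      rw [touch_seg_succ hh ha]; omega
    have t2 : Touch (seg x y h) (seg (x + 1) (z + a + g) b) ↔
        y - z < a + g + b ∧ a + g < y - z + h := by
      rw [touch_seg_succ hh hb]; omega
    have t3 : Touch (seg (x + 2) y' k) (seg (x + 1) z a) ↔ y' - z < a ∧ 0 < y' - z + k := by
      rw [touch_seg_pred (by ring) hk ha]; omega
    have t4 : Touch (seg (x + 2) y' k) (seg (x + 1) (z + a + g) b) ↔
        y' - z < a + g + b ∧ a + g < y' - z + k := by
      rw [touch_seg_pred (by ring) hk hb]; omega
    simp only [← t1, ← t2, ← t3, ← t4]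
    rfl
  · intro i
    fin_cases i
    exacts [conn_seg hh, conn_seg ha, conn_seg hb, conn_seg hk]
  · intro i j c
    fin_cases i <;> fin_cases j <;> simp [mem_seg] <;> omega
  · intro c
    simp only [block, dseg, Finset.mem_union, Fin.exists_fin_succ]
    simp [or_assoc]

lemma columnComponents_block {x y z y' : ℤ} {h a g b k : ℕ} (hh : 1 ≤ h) (ha : 1 ≤ a)
    (hg : 1 ≤ g) (hb : 1 ≤ b) (hk : 1 ≤ k) (x' : ℤ) :
    columnComponents (block x y z y' h a g b k) x' ≤ 2 ∧
      (columnComponents (block x y z y' h a g b k) x' = 2 ↔ x' = x + 1) := by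
  rw [columnComponents, block, column_union, column_union, column_seg, column_seg, column_dseg]
  split_ifs <;> try omega
  · simp only [Finset.union_empty, numComponents_seg hh]
    omega
  · simp only [Finset.union_empty, Finset.empty_union, numComponents_dseg ha hg hb]
    exact ⟨le_rfl, iff_of_true trivial (by omega)⟩
  · simp only [Finset.empty_union, numComponents_seg hk]
    omega
  · simp only [Finset.empty_union, numComponents_empty]
    omega

/-- With a single duplex column, no two duplex columns are neighbours, so only connectedness is in
question. -/
lemma isSimplexDuplex_of_single {S : Finset (ℤ × ℤ)} {x : ℤ}
    (h : ∀ x', columnComponents S x' ≤ 2 ∧ (columnComponents S x' = 2 ↔ x' = x)) :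
    IsSimplexDuplex S ↔ Conn S := by
  rw [isSimplexDuplex_iff]
  refine ⟨fun h => h.1, fun hc => ⟨hc, fun x' => (h x').1, fun x' h1 h2 => ?_⟩⟩
  rw [(h _).2] at h1 h2
  omega

lemma duplexIndices_of_single {S : Finset (ℤ × ℤ)} {x : ℤ}
    (h : ∀ x', columnComponents S x' ≤ 2 ∧ (columnComponents S x' = 2 ↔ x' = x)) :
    duplexIndices S = {x} := by
  ext x'
  rw [mem_duplexIndices, (h x').2, Finset.mem_singleton]

/-- Three pieces of which the last two do not touch are connected exactly when the first one touches
both. -/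
lemma conn_three_pieces {p : Fin 3 → Finset (ℤ × ℤ)} (h12 : ¬ Touch (p 1) (p 2)) :
    (∀ φ : Fin 3 → Prop, (∀ i j, Touch (p i) (p j) → φ i → φ j) → ∀ i j, φ i → φ j) ↔
      Touch (p 0) (p 1) ∧ Touch (p 0) (p 2) := by
  constructor
  · intro H
    have key : ∀ s a b : Prop, (Touch (p 0) (p 1) → (s ↔ a)) →
        (Touch (p 0) (p 2) → (s ↔ b)) → (s ↔ a) ∧ (s ↔ b) := by
      intro s a b h1 h2
      have := H ![s, a, b] (by
        intro i j
        fin_cases i <;> fin_cases j <;> intro ht <;>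
          first | exact id | exact (h1 ht).1 | exact (h1 ht.symm).2 | exact (h2 ht).1 |
            exact (h2 ht.symm).2 | exact absurd ht h12 | exact absurd ht.symm h12)
      exact ⟨⟨this 0 1, this 1 0⟩, ⟨this 0 2, this 2 0⟩⟩
    have k2 := key False True False
    have k3 := key False False True
    simp only [iff_true, not_true, imp_false, imp_true_iff, true_imp_iff,
      and_false, and_true] at k2 k3
    tauto
  · intro H φ hφ
    have e1 := hφ 0 1 H.1
    have e1' := hφ 1 0 H.1.symm
    have e2 := hφ 0 2 H.2
    have e2' := hφ 2 0 H.2.symm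
    have : ∀ i, φ 0 ↔ φ i := by
      intro i
      fin_cases i
      · rfl
      · exact ⟨e1, e1'⟩
      · exact ⟨e2, e2'⟩
    intro i j hi
    exact (this j).1 ((this i).2 hi)

/-- A duplex column next to a single segment, on either side, is connected exactly when the
segment touches both components. -/
lemma conn_seg_dseg {x x' y z : ℤ} {h a g b : ℕ} (hx : x' = x + 1 ∨ x = x' + 1) (hh : 1 ≤ h)
    (ha : 1 ≤ a) (hg : 1 ≤ g) (hb : 1 ≤ b) :
    Conn (seg x y h ∪ dseg x' z a g b) ↔ y - z ∈ touchBoth h a g := by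
  rw [conn_iff_of_pieces (ι := Fin 3) (p := ![seg x y h, seg x' z a, seg x' (z + a + g) b])]
  · rw [conn_three_pieces (not_touch_seg_of_gap (by omega)), mem_touchBoth_iff ha hb]
    have t1 : Touch (seg x y h) (seg x' z a) ↔ y - z < a ∧ 0 < y - z + h := by
      rcases hx with rfl | rfl
      · rw [touch_seg_succ hh ha]; omega
      · rw [touch_seg_pred rfl hh ha]; omega
    have t2 : Touch (seg x y h) (seg x' (z + a + g) b) ↔
        y - z < a + g + b ∧ a + g < y - z + h := by
      rcases hx with rfl | rfl
      · rw [touch_seg_succ hh hb]; omega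
      · rw [touch_seg_pred rfl hh hb]; omega
    rw [← t1, ← t2]
    rfl
  · intro i
    fin_cases i
    exacts [conn_seg hh, conn_seg ha, conn_seg hb]
  · intro i j c
    fin_cases i <;> fin_cases j <;> simp [mem_seg] <;> omega
  · intro c
    simp only [dseg, Finset.mem_union, Fin.exists_fin_succ]
    simp

lemma columnComponents_seg_dseg {x x' y z : ℤ} {h a g b : ℕ} (hx : x' = x + 1 ∨ x = x' + 1)
    (hh : 1 ≤ h) (ha : 1 ≤ a) (hg : 1 ≤ g) (hb : 1 ≤ b) (u : ℤ) :
    columnComponents (seg x y h ∪ dseg x' z a g b) u ≤ 2 ∧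
      (columnComponents (seg x y h ∪ dseg x' z a g b) u = 2 ↔ u = x') := by
  rw [columnComponents, column_union, column_seg, column_dseg]
  split_ifs <;> try omega
  · simp only [Finset.union_empty, numComponents_seg hh]
    omega
  · simp only [Finset.empty_union, numComponents_dseg ha hg hb]
    exact ⟨le_rfl, iff_of_true trivial (by omega)⟩
  · simp only [Finset.empty_union, numComponents_empty]
    omega

lemma not_conn_dseg {x z : ℤ} {a g b : ℕ} (ha : 1 ≤ a) (hg : 1 ≤ g) (hb : 1 ≤ b) :
    ¬ Conn (dseg x z a g b) := by
  intro h
  have := isPolyomino_iff_conn.2 h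
  have h2 := numComponents_dseg (x := x) (y := z) ha hg hb
  have h3 := this.preconnected.subsingleton_connectedComponent
  rw [numComponents] at h2
  have := Finite.card_le_one_iff_subsingleton (α :=
    (cellGraph.induce (dseg x z a g b : Set (ℤ × ℤ))).ConnectedComponent)
  have := this.2 h3
  omega

/-! ### Removing the last columns -/

/-- Simplex-duplex polyominoes whose last column is simplex, with lowest cell `(0, 0)`. -/
def SimplexEnded : Type :=
  {P : Finset (ℤ × ℤ) // IsSimplexDuplex P ∧ (∀ c ∈ P, c.1 ≤ 0) ∧
    ∃ s : ℕ, column P 0 = seg 0 0 (s + 1)}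

/-- Simplex-duplex polyominoes whose last column is duplex, with lowest cell `(0, 0)`. -/
def DuplexEnded : Type :=
  {P : Finset (ℤ × ℤ) // IsSimplexDuplex P ∧ (∀ c ∈ P, c.1 ≤ 0) ∧
    ∃ a g b : ℕ, column P 0 = dseg 0 0 (a + 1) (g + 1) (b + 1)}

/-- The height of the last column, minus one. -/
def SimplexEnded.size (P : SimplexEnded) : ℕ := (column P.1 0).card - 1

lemma SimplexEnded.column_zero (P : SimplexEnded) : column P.1 0 = seg 0 0 (P.size + 1) := by
  obtain ⟨s, hs⟩ := P.2.2.2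
  rw [SimplexEnded.size, hs, card_seg, Nat.add_sub_cancel]

lemma seg_inj {x y x' y' : ℤ} {h h' : ℕ} (hh : 1 ≤ h) (e : seg x y h = seg x' y' h') :
    x = x' ∧ y = y' ∧ h = h' := by
  have hcard := congrArg Finset.card e
  rw [card_seg, card_seg] at hcard
  subst hcard
  have m1 : (x, y) ∈ seg x' y' h := e ▸ mem_seg.2 ⟨rfl, le_refl _, by simp; omega⟩
  have m2 : (x', y') ∈ seg x y h := e ▸ mem_seg.2 ⟨rfl, le_refl _, by simp; omega⟩
  rw [mem_seg] at m1 m2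
  simp only at m1 m2
  omega

lemma dseg_inj {x y x' y' : ℤ} {a g b a' g' b' : ℕ} (ha : 1 ≤ a) (hg : 1 ≤ g) (hb : 1 ≤ b)
    (ha' : 1 ≤ a') (hg' : 1 ≤ g') (hb' : 1 ≤ b')
    (e : dseg x y a g b = dseg x' y' a' g' b') :
    x = x' ∧ y = y' ∧ a = a' ∧ g = g' ∧ b = b' := by
  have hcard := congrArg Finset.card e
  rw [card_dseg, card_dseg] at hcard
  have key : ∀ v u : ℤ, (v = x ∧ (y ≤ u ∧ u < y + a ∨ y + a + g ≤ u ∧ u < y + a + g + b)) ↔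
      (v = x' ∧ (y' ≤ u ∧ u < y' + a' ∨ y' + a' + g' ≤ u ∧ u < y' + a' + g' + b')) := by
    intro v u
    rw [← mem_dseg (c := (v, u)), ← mem_dseg (c := (v, u)), e]
  have hx : x = x' := ((key x y).1 (by omega)).1
  subst hx
  have k := fun u => key x u
  simp only [true_and] at k
  have e1 : y = y' := by
    have := k y
    have := k y'
    omega
  subst e1
  have k1 := k (y + a)
  have k2 := k (y + a')
  have e2 : a = a' := by omega
  subst e2
  have k3 := k (y + a + g)
  have k4 := k (y + a + g')
  omega

lemma SimplexEnded.column_shift (P : SimplexEnded) (x y : ℤ) :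
    column (shift (x, y) P.1) x = seg x y (P.size + 1) := by
  rw [SimplexDuplex.column_shift, sub_self, P.column_zero, shift_seg, zero_add, zero_add]

/-- The translate of `P` whose last column has its lowest cell at `(x, y)`, together with the
columns `B` on its right. -/
def glue (P : SimplexEnded) (x y : ℤ) (B : Finset (ℤ × ℤ)) : Finset (ℤ × ℤ) := shift (x, y) P.1 ∪ B

lemma SimplexEnded.fst_le_of_mem_shift (P : SimplexEnded) {x y : ℤ} {c : ℤ × ℤ}
    (hc : c ∈ shift (x, y) P.1) : c.1 ≤ x := by
  have := P.2.2.1 _ (mem_shift.1 hc)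
  rw [Prod.fst_sub] at this
  simpa using this

lemma column_glue {P : SimplexEnded} {x y : ℤ} {B : Finset (ℤ × ℤ)}
    (hBx : column B x = seg x y (P.size + 1)) :
    column (glue P x y B) x = seg x y (P.size + 1) := by
  rw [glue, column_union, P.column_shift, hBx, Finset.union_self]

lemma leftPart_glue {P : SimplexEnded} {x y : ℤ} {B : Finset (ℤ × ℤ)} (hB : ∀ c ∈ B, x ≤ c.1)
    (hBx : column B x = seg x y (P.size + 1)) :
    leftPart (glue P x y B) x = shift (x, y) P.1 := by
  ext c
  rw [mem_leftPart, glue, Finset.mem_union]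
  constructor
  · rintro ⟨h | h, hx⟩
    · exact h
    · have h1 : c ∈ column B x := mem_column.2 ⟨h, le_antisymm hx (hB c h)⟩
      rw [hBx, ← P.column_shift] at h1
      exact (mem_column.1 h1).1
  · exact fun h => ⟨Or.inl h, P.fst_le_of_mem_shift h⟩

lemma rightPart_glue {P : SimplexEnded} {x y : ℤ} {B : Finset (ℤ × ℤ)} (hB : ∀ c ∈ B, x ≤ c.1)
    (hBx : column B x = seg x y (P.size + 1)) :
    rightPart (glue P x y B) x = B := by
  ext c
  rw [mem_rightPart, glue, Finset.mem_union]
  constructor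
  · rintro ⟨h | h, hx⟩
    · have h1 : c ∈ column (shift (x, y) P.1) x :=
        mem_column.2 ⟨h, le_antisymm (P.fst_le_of_mem_shift h) hx⟩
      rw [P.column_shift, ← hBx] at h1
      exact (mem_column.1 h1).1
    · exact h
  · exact fun h => ⟨Or.inr h, hB c h⟩

lemma isSimplexDuplex_glue {P : SimplexEnded} {x y : ℤ} {B : Finset (ℤ × ℤ)} (hB : ∀ c ∈ B, x ≤ c.1)
    (hBx : column B x = seg x y (P.size + 1))
    (h : IsSimplexDuplex B) : IsSimplexDuplex (glue P x y B) := by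
  rw [isSimplexDuplex_iff_of_cut (by omega) (column_glue hBx), leftPart_glue hB hBx,
    rightPart_glue hB hBx, isSimplexDuplex_shift]
  exact ⟨P.2.1, h⟩

lemma card_glue {P : SimplexEnded} {x y : ℤ} {B : Finset (ℤ × ℤ)} (hB : ∀ c ∈ B, x ≤ c.1)
    (hBx : column B x = seg x y (P.size + 1)) :
    (glue P x y B).card + (P.size + 1) = P.1.card + B.card := by
  rw [← card_cut (column_glue hBx), leftPart_glue hB hBx, rightPart_glue hB hBx, card_shift]

lemma card_duplexIndices_glue {P : SimplexEnded} {x y : ℤ} {B : Finset (ℤ × ℤ)} (hB : ∀ c ∈ B, x ≤ c.1)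
    (hBx : column B x = seg x y (P.size + 1)) :
    (duplexIndices (glue P x y B)).card =
    (duplexIndices P.1).card + (duplexIndices B).card := by
  rw [duplexIndices_cut (by omega) (column_glue hBx), leftPart_glue hB hBx,
    rightPart_glue hB hBx, duplexIndices_shift]

lemma column_glue_of_lt {P : SimplexEnded} {x y : ℤ} {B : Finset (ℤ × ℤ)} (hB : ∀ c ∈ B, x ≤ c.1)
    (hBx : column B x = seg x y (P.size + 1))
    {x' : ℤ} (h : x < x') : column (glue P x y B) x' = column B x' := by
  rw [← column_rightPart h.le, rightPart_glue hB hBx]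

lemma glue_inj {P P' : SimplexEnded} {x y y' : ℤ} {B B' : Finset (ℤ × ℤ)}
    (hB : ∀ c ∈ B, x ≤ c.1) (hBx : column B x = seg x y (P.size + 1))
    (hB' : ∀ c ∈ B', x ≤ c.1) (hBx' : column B' x = seg x y' (P'.size + 1))
    (e : glue P x y B = glue P' x y' B') : P = P' ∧ y = y' ∧ B = B' := by
  have e1 := column_glue hBx
  rw [e, column_glue hBx'] at e1
  obtain ⟨-, rfl, -⟩ := seg_inj (by omega) e1
  refine ⟨Subtype.ext ?_, rfl, ?_⟩
  · have e2 := leftPart_glue hB hBx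
    rw [e, leftPart_glue hB' hBx'] at e2
    have := congrArg (shift (-(x, y'))) e2
    rw [shift_shift, shift_shift, neg_add_cancel, shift_zero, shift_zero] at this
    exact this.symm
  · rw [← rightPart_glue hB hBx, e, rightPart_glue hB' hBx']

/-- Cutting at a simplex column inverts gluing. -/
lemma exists_eq_glue {Q : Finset (ℤ × ℤ)} (hQ : IsSimplexDuplex Q) {x y : ℤ} {s : ℕ}
    (e : column Q x = seg x y (s + 1)) :
    ∃ P : SimplexEnded, P.size = s ∧ Q = glue P x y (rightPart Q x) := by
  have h1 := ((isSimplexDuplex_iff_of_cut (by omega) e).1 hQ).1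
  have hcol : column (shift (-(x, y)) (leftPart Q x)) 0 = seg 0 0 (s + 1) := by
    rw [column_shift, Prod.fst_neg, sub_neg_eq_add, zero_add, column_leftPart le_rfl, e,
      shift_seg]
    simp
  have hle : ∀ c ∈ shift (-(x, y)) (leftPart Q x), c.1 ≤ 0 := by
    intro c hc
    have := (mem_leftPart.1 (mem_shift.1 hc)).2
    rw [Prod.fst_sub, Prod.fst_neg] at this
    simp only at this
    omega
  refine ⟨⟨shift (-(x, y)) (leftPart Q x), isSimplexDuplex_shift.2 h1, hle, s, hcol⟩, ?_, ?_⟩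
  · change (column (shift (-(x, y)) (leftPart Q x)) 0).card - 1 = s
    rw [hcol, card_seg, Nat.add_sub_cancel]
  · change Q = shift (x, y) (shift (-(x, y)) (leftPart Q x)) ∪ rightPart Q x
    rw [shift_shift, add_neg_cancel, shift_zero]
    ext c
    rw [Finset.mem_union, mem_leftPart, mem_rightPart]
    have := le_total c.1 x
    tauto

/-- The gaps and the relative heights of the two neighbours with which a duplex column can stand
between two segments. The sizes are given minus one. -/
def duplexPlacements (s κ a b : ℕ) : Finset (Σ _ : ℕ, ℤ × ℤ) :=
  (Finset.range (s + κ)).sigma fun g => blockPairs (s + 1) (κ + 1) (a + 1) (g + 1) (b + 1)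

/-- The gaps and relative heights with which a duplex column can stand next to a single segment,
the sizes being given minus one. -/
def endPlacements (s a : ℕ) : Finset (Σ _ : ℕ, ℤ) :=
  (Finset.range s).sigma fun g => touchBoth (s + 1) (a + 1) (g + 1)

lemma mem_endPlacements {s a g : ℕ} {i : ℤ} :
    (⟨g, i⟩ : Σ _ : ℕ, ℤ) ∈ endPlacements s a ↔ i ∈ touchBoth (s + 1) (a + 1) (g + 1) := by
  rw [endPlacements, Finset.mem_sigma, Finset.mem_range, and_iff_right_iff_imp]
  intro h
  rw [touchBoth, Finset.mem_Ioo] at h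
  push_cast at h
  simp only at *
  omega

lemma mem_duplexPlacements {s κ a b g : ℕ} {v : ℤ × ℤ} :
    (⟨g, v⟩ : Σ _ : ℕ, ℤ × ℤ) ∈ duplexPlacements s κ a b ↔
      v ∈ blockPairs (s + 1) (κ + 1) (a + 1) (g + 1) (b + 1) := by
  rw [duplexPlacements, Finset.mem_sigma, Finset.mem_range, and_iff_right_iff_imp]
  intro h
  rw [blockPairs, Finset.mem_union, Finset.mem_product, Finset.mem_product, touchBoth, touchBoth,
    Finset.mem_Ioo, Finset.mem_Ioo] at h
  push_cast at h
  simp only at *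
  omega

/-- A single column of height `κ + 1`. -/
def ofColumn (κ : ℕ) : SimplexEnded :=
  ⟨seg 0 0 (κ + 1), isSimplexDuplex_seg (by omega), fun c hc => (mem_seg.1 hc).1.le, κ, by
    rw [column_seg, if_pos rfl]⟩

/-- The columns of a first duplex column followed by a segment of height `κ + 1`. -/
def startBlock (κ a b : ℕ) (v : Σ _ : ℕ, ℤ) : Finset (ℤ × ℤ) :=
  seg 0 0 (κ + 1) ∪ dseg (-1) (-v.2) (a + 1) (v.1 + 1) (b + 1)

/-- A duplex column followed by a segment of height `κ + 1`. -/
def ofStart (d : Σ d : ℕ × ℕ × ℕ, endPlacements d.1 d.2.1) : SimplexEnded :=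
  ⟨startBlock d.1.1 d.1.2.1 d.1.2.2 d.2.1, by
    rw [startBlock, isSimplexDuplex_of_single (columnComponents_seg_dseg (Or.inr (by ring))
      (by omega) (by omega) (by omega) (by omega)), conn_seg_dseg (Or.inr (by ring))
      (by omega) (by omega) (by omega) (by omega), sub_neg_eq_add, zero_add,
      ← mem_endPlacements]
    exact d.2.2, by
    intro c hc
    rw [startBlock, Finset.mem_union, mem_seg, mem_dseg] at hc
    omega, d.1.1, by
    rw [startBlock, column_union, column_seg, column_dseg, if_pos rfl, if_neg (by omega),
      Finset.union_empty]⟩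

/-- The columns from a segment of height `s + 1` at `-1` to a segment of height `κ + 1` at `0`. -/
def simpleBlock (s κ : ℕ) (y : ℤ) : Finset (ℤ × ℤ) := seg (-1) y (s + 1) ∪ seg (-1 + 1) 0 (κ + 1)

lemma simpleBlock_bounds {s κ : ℕ} {y : ℤ} {c : ℤ × ℤ} (hc : c ∈ simpleBlock s κ y) :
    -1 ≤ c.1 ∧ c.1 ≤ 0 := by
  rw [simpleBlock, Finset.mem_union, mem_seg, mem_seg] at hc
  omega

lemma column_simpleBlock (s κ : ℕ) (y : ℤ) :
    column (simpleBlock s κ y) (-1) = seg (-1) y (s + 1) := by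
  rw [simpleBlock, column_union, column_seg, column_seg, if_pos rfl, if_neg (by omega),
    Finset.union_empty]

lemma column_simpleBlock_zero (s κ : ℕ) (y : ℤ) :
    column (simpleBlock s κ y) 0 = seg 0 0 (κ + 1) := by
  simp [simpleBlock, column_union, column_seg]

/-- Adding a simplex column of height `κ + 1`. -/
def ofSimple (d : Σ P : SimplexEnded, Σ κ : ℕ, Finset.Ioo (-((P.size : ℤ) + 1)) ((κ : ℤ) + 1)) :
    SimplexEnded :=
  have hB := fun c hc => (simpleBlock_bounds (s := d.1.size) (κ := d.2.1) (y := d.2.2.1)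
    (c := c) hc).1
  ⟨glue d.1 (-1) d.2.2.1 (simpleBlock d.1.size d.2.1 d.2.2.1),
    isSimplexDuplex_glue hB (column_simpleBlock _ _ _) (by
      rw [simpleBlock, isSimplexDuplex_seg_seg (by omega) (by omega)]
      have := Finset.mem_Ioo.1 d.2.2.2
      push_cast
      omega), by
    intro c hc
    rcases Finset.mem_union.1 hc with h | h
    · exact (d.1.fst_le_of_mem_shift h).trans (by omega)
    · exact (simpleBlock_bounds h).2, d.2.1, by
    rw [column_glue_of_lt hB (column_simpleBlock _ _ _) (by omega), column_simpleBlock_zero]⟩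

/-- The columns from a segment of height `s + 1` at `-2`, over a duplex column, to a segment of
height `κ + 1` at `0`. -/
def duplexBlock (s κ a b : ℕ) (v : Σ _ : ℕ, ℤ × ℤ) : Finset (ℤ × ℤ) :=
  block (-2) (v.2.1 - v.2.2) (-v.2.2) 0 (s + 1) (a + 1) (v.1 + 1) (b + 1) (κ + 1)

lemma duplexBlock_bounds {s κ a b : ℕ} {v : Σ _ : ℕ, ℤ × ℤ} {c : ℤ × ℤ}
    (hc : c ∈ duplexBlock s κ a b v) : -2 ≤ c.1 ∧ c.1 ≤ 0 := by
  rw [duplexBlock, block, Finset.mem_union, Finset.mem_union, mem_seg, mem_dseg, mem_seg] at hc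
  omega

lemma column_duplexBlock (s κ a b : ℕ) (v : Σ _ : ℕ, ℤ × ℤ) :
    column (duplexBlock s κ a b v) (-2) = seg (-2) (v.2.1 - v.2.2) (s + 1) := by
  simp [duplexBlock, block, column_union, column_seg, column_dseg]

lemma column_duplexBlock_neg_one (s κ a b : ℕ) (v : Σ _ : ℕ, ℤ × ℤ) :
    column (duplexBlock s κ a b v) (-1) = dseg (-1) (-v.2.2) (a + 1) (v.1 + 1) (b + 1) := by
  simp [duplexBlock, block, column_union, column_seg, column_dseg]

lemma column_duplexBlock_zero (s κ a b : ℕ) (v : Σ _ : ℕ, ℤ × ℤ) :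
    column (duplexBlock s κ a b v) 0 = seg 0 0 (κ + 1) := by
  simp [duplexBlock, block, column_union, column_seg, column_dseg]

/-- Adding a duplex column and a simplex column of height `κ + 1`. -/
def ofDuplex (d : Σ P : SimplexEnded, Σ d : ℕ × ℕ × ℕ, duplexPlacements P.size d.1 d.2.1 d.2.2) :
    SimplexEnded :=
  have hB := fun c hc => (duplexBlock_bounds (s := d.1.size) (κ := d.2.1.1) (a := d.2.1.2.1)
    (b := d.2.1.2.2) (v := d.2.2.1) (c := c) hc).1
  ⟨glue d.1 (-2) _ (duplexBlock d.1.size d.2.1.1 d.2.1.2.1 d.2.1.2.2 d.2.2.1),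
    isSimplexDuplex_glue hB (column_duplexBlock _ _ _ _ _) (by
      rw [duplexBlock, isSimplexDuplex_of_single (columnComponents_block (by omega) (by omega)
        (by omega) (by omega) (by omega)), conn_block (by omega) (by omega)
        (by omega) (by omega) (by omega), sub_neg_eq_add, sub_add_cancel, sub_neg_eq_add,
        zero_add, ← mem_duplexPlacements]
      exact d.2.2.2), by
    intro c hc
    rcases Finset.mem_union.1 hc with h | h
    · exact (d.1.fst_le_of_mem_shift h).trans (by omega)
    · exact (duplexBlock_bounds h).2, d.2.1.1, by
    rw [column_glue_of_lt hB (column_duplexBlock _ _ _ _ _) (by omega),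
      column_duplexBlock_zero]⟩

lemma SimplexEnded.size_eq (P : SimplexEnded) {s : ℕ} (h : column P.1 0 = seg 0 0 (s + 1)) :
    P.size = s := by
  rw [SimplexEnded.size, h, card_seg, Nat.add_sub_cancel]

lemma column_ofStart_zero (d : Σ d : ℕ × ℕ × ℕ, endPlacements d.1 d.2.1) :
    column (ofStart d).1 0 = seg 0 0 (d.1.1 + 1) := by
  simp [ofStart, startBlock, column_union, column_seg, column_dseg]

lemma column_ofStart_neg_one (d : Σ d : ℕ × ℕ × ℕ, endPlacements d.1 d.2.1) :
    column (ofStart d).1 (-1) = dseg (-1) (-d.2.1.2) (d.1.2.1 + 1) (d.2.1.1 + 1) (d.1.2.2 + 1) := by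
  simp [ofStart, startBlock, column_union, column_seg, column_dseg]

lemma column_ofStart_neg_two (d : Σ d : ℕ × ℕ × ℕ, endPlacements d.1 d.2.1) :
    column (ofStart d).1 (-2) = ∅ := by
  simp [ofStart, startBlock, column_union, column_seg, column_dseg]

section

variable (d : Σ P : SimplexEnded, Σ κ : ℕ, Finset.Ioo (-((P.size : ℤ) + 1)) ((κ : ℤ) + 1))

lemma column_ofSimple_neg_one :
    column (ofSimple d).1 (-1) = seg (-1) d.2.2.1 (d.1.size + 1) :=
  column_glue (column_simpleBlock _ _ _)

lemma column_ofSimple_zero : column (ofSimple d).1 0 = seg 0 0 (d.2.1 + 1) :=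
  (column_glue_of_lt (fun _ hc => (simpleBlock_bounds hc).1) (column_simpleBlock _ _ _)
    (by omega)).trans (column_simpleBlock_zero _ _ _)

end

section

variable (d : Σ P : SimplexEnded, Σ d : ℕ × ℕ × ℕ, duplexPlacements P.size d.1 d.2.1 d.2.2)

lemma column_ofDuplex_neg_two :
    column (ofDuplex d).1 (-2) = seg (-2) (d.2.2.1.2.1 - d.2.2.1.2.2) (d.1.size + 1) :=
  column_glue (column_duplexBlock _ _ _ _ _)

lemma column_ofDuplex_neg_one : column (ofDuplex d).1 (-1) =
    dseg (-1) (-d.2.2.1.2.2) (d.2.1.2.1 + 1) (d.2.2.1.1 + 1) (d.2.1.2.2 + 1) :=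
  (column_glue_of_lt (fun _ hc => (duplexBlock_bounds hc).1) (column_duplexBlock _ _ _ _ _)
    (by omega)).trans (column_duplexBlock_neg_one _ _ _ _ _)

lemma column_ofDuplex_zero : column (ofDuplex d).1 0 = seg 0 0 (d.2.1.1 + 1) :=
  (column_glue_of_lt (fun _ hc => (duplexBlock_bounds hc).1) (column_duplexBlock _ _ _ _ _)
    (by omega)).trans (column_duplexBlock_zero _ _ _ _ _)

end

lemma size_ofColumn (κ : ℕ) : (ofColumn κ).size = κ :=
  (ofColumn κ).size_eq (by simp [ofColumn, column_seg])

lemma size_ofStart (d) : (ofStart d).size = d.1.1 := (ofStart d).size_eq (column_ofStart_zero d)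

lemma size_ofSimple (d) : (ofSimple d).size = d.2.1 :=
  (ofSimple d).size_eq (column_ofSimple_zero d)

lemma size_ofDuplex (d) : (ofDuplex d).size = d.2.1.1 :=
  (ofDuplex d).size_eq (column_ofDuplex_zero d)

lemma columnComponents_ofColumn (κ : ℕ) : columnComponents (ofColumn κ).1 (-1) = 0 :=
  columnComponents_of_empty (by simp [ofColumn, column_seg])

lemma columnComponents_ofStart_neg_one (d) : columnComponents (ofStart d).1 (-1) = 2 :=
  columnComponents_of_dseg (by omega) (by omega) (by omega) (column_ofStart_neg_one d)

lemma columnComponents_ofStart_neg_two (d) : columnComponents (ofStart d).1 (-2) = 0 :=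
  columnComponents_of_empty (column_ofStart_neg_two d)

lemma columnComponents_ofSimple (d) : columnComponents (ofSimple d).1 (-1) = 1 :=
  columnComponents_of_seg (by omega) (column_ofSimple_neg_one d)

lemma columnComponents_ofDuplex_neg_one (d) : columnComponents (ofDuplex d).1 (-1) = 2 :=
  columnComponents_of_dseg (by omega) (by omega) (by omega) (column_ofDuplex_neg_one d)

lemma columnComponents_ofDuplex_neg_two (d) : columnComponents (ofDuplex d).1 (-2) = 1 :=
  columnComponents_of_seg (by omega) (column_ofDuplex_neg_two d)

lemma ofColumn_injective : Function.Injective ofColumn := by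
  intro κ κ' h
  rw [← size_ofColumn κ, h, size_ofColumn]

lemma ofStart_injective : Function.Injective ofStart := by
  intro d d' h
  have h1 := size_ofStart d
  have h2 := column_ofStart_neg_one d
  rw [h, size_ofStart] at h1
  rw [h, column_ofStart_neg_one] at h2
  obtain ⟨⟨κ, a, b⟩, ⟨⟨g, i⟩, hi⟩⟩ := d
  obtain ⟨⟨κ', a', b'⟩, ⟨⟨g', i'⟩, hi'⟩⟩ := d'
  obtain ⟨-, e1, e2, e3, e4⟩ := dseg_inj (by omega) (by omega) (by omega) (by omega) (by omega)
    (by omega) h2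
  simp only [neg_inj, Nat.add_right_cancel_iff] at h1 e1 e2 e3 e4
  subst h1 e1 e2 e3 e4
  rfl

lemma ofSimple_injective : Function.Injective ofSimple := by
  intro d d' h
  have h1 := size_ofSimple d
  rw [h, size_ofSimple] at h1
  obtain ⟨h2, h3, -⟩ := glue_inj (fun _ hc => (simpleBlock_bounds hc).1)
    (column_simpleBlock _ _ _) (fun _ hc => (simpleBlock_bounds hc).1)
    (column_simpleBlock _ _ _) (congrArg Subtype.val h)
  obtain ⟨P, κ, y, hy⟩ := d
  obtain ⟨P', κ', y', hy'⟩ := d'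
  simp only at h1 h2 h3
  subst h1 h2 h3
  rfl

lemma ofDuplex_injective : Function.Injective ofDuplex := by
  intro d d' h
  have h1 := size_ofDuplex d
  rw [h, size_ofDuplex] at h1
  have h4 := column_ofDuplex_neg_one d
  rw [h, column_ofDuplex_neg_one] at h4
  obtain ⟨h2, h3, -⟩ := glue_inj (fun _ hc => (duplexBlock_bounds hc).1)
    (column_duplexBlock _ _ _ _ _) (fun _ hc => (duplexBlock_bounds hc).1)
    (column_duplexBlock _ _ _ _ _) (congrArg Subtype.val h)
  obtain ⟨P, ⟨κ, a, b⟩, ⟨⟨g, i, j⟩, hv⟩⟩ := d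
  obtain ⟨P', ⟨κ', a', b'⟩, ⟨⟨g', i', j'⟩, hv'⟩⟩ := d'
  obtain ⟨-, e1, e2, e3, e4⟩ := dseg_inj (by omega) (by omega) (by omega) (by omega) (by omega)
    (by omega) h4
  simp only [neg_inj, Nat.add_right_cancel_iff] at h1 h2 h3 e1 e2 e3 e4
  subst h1 h2 e1 e2 e3 e4
  rw [sub_left_inj] at h3
  subst h3
  rfl

lemma rightPart_neg_one {Q : Finset (ℤ × ℤ)} (h : ∀ c ∈ Q, c.1 ≤ 0) :
    rightPart Q (-1) = column Q (-1) ∪ column Q 0 := by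
  ext c
  simp only [mem_rightPart, Finset.mem_union, mem_column, ← and_or_left]
  refine and_congr_right fun hc => ?_
  have := h c hc
  omega

lemma rightPart_neg_two {Q : Finset (ℤ × ℤ)} (h : ∀ c ∈ Q, c.1 ≤ 0) :
    rightPart Q (-2) = column Q (-2) ∪ column Q (-1) ∪ column Q 0 := by
  ext c
  simp only [mem_rightPart, Finset.mem_union, mem_column, ← and_or_left]
  refine and_congr_right fun hc => ?_
  have := h c hc
  omega

/-- A connected set with a cell to the right of an empty column lies to the right of it. -/
lemma rightPart_eq_self {Q : Finset (ℤ × ℤ)} (hQ : Conn Q) {x : ℤ} (e : column Q x = ∅)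
    {c : ℤ × ℤ} (hc : c ∈ Q) (hcx : x < c.1) : rightPart Q x = Q :=
  Finset.filter_true_of_mem fun d hd => (hQ.lt_of_column_eq_empty e hc hcx d hd).le

lemma columnComponents_cases {P : Finset (ℤ × ℤ)} (hP : IsSimplexDuplex P) (x : ℤ) :
    column P x = ∅ ∨ (∃ y : ℤ, ∃ s : ℕ, column P x = seg x y (s + 1)) ∨
      (columnComponents P x = 2 ∧
        ∃ y : ℤ, ∃ a g b : ℕ, column P x = dseg x y (a + 1) (g + 1) (b + 1)) := by
  have h2 := (isSimplexDuplex_iff.1 hP).2.1 x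
  interval_cases h : columnComponents P x
  · exact Or.inl (column_eq_empty_of_columnComponents h)
  · obtain ⟨y, k, hk, e⟩ := numComponents_column_eq_one.1 h
    obtain ⟨s, rfl⟩ := Nat.exists_eq_add_of_le' hk
    exact Or.inr (Or.inl ⟨y, s, e⟩)
  · obtain ⟨y, a, g, b, ha, hg, hb, e⟩ := numComponents_column_eq_two.1 h
    obtain ⟨a, rfl⟩ := Nat.exists_eq_add_of_le' ha
    obtain ⟨g, rfl⟩ := Nat.exists_eq_add_of_le' hg
    obtain ⟨b, rfl⟩ := Nat.exists_eq_add_of_le' hb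
    exact Or.inr (Or.inr ⟨rfl, y, a, g, b, e⟩)

/-- Every simplex-duplex polyomino whose last column is simplex arises in one of four ways,
according to the number of components of its last columns but one and two. -/
lemma simplexEnded_cases (Q : SimplexEnded) : (∃ κ, ofColumn κ = Q) ∨ (∃ d, ofStart d = Q) ∨
    (∃ d, ofSimple d = Q) ∨ ∃ d, ofDuplex d = Q := by
  obtain ⟨Q, hQ, hle, κ, hκ⟩ := Q
  have hconn := (isSimplexDuplex_iff.1 hQ).1
  have h0 : ((0, 0) : ℤ × ℤ) ∈ Q :=
    (mem_column.1 (hκ ▸ mem_seg.2 ⟨rfl, le_rfl, by simp⟩ : ((0, 0) : ℤ × ℤ) ∈ column Q 0)).1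
  rcases columnComponents_cases hQ (-1) with h | ⟨y, s, h⟩ | ⟨h2, z, a, g, b, h⟩
  · refine Or.inl ⟨κ, Subtype.ext ?_⟩
    have := rightPart_eq_self hconn h h0 (by simp)
    rw [rightPart_neg_one hle, h, Finset.empty_union, hκ] at this
    exact this
  · obtain ⟨P, rfl, e⟩ := exists_eq_glue hQ h
    have hr : rightPart Q (-1) = simpleBlock P.size κ y := by
      rw [rightPart_neg_one hle, h, hκ, simpleBlock, neg_add_cancel]
    have hsd := ((isSimplexDuplex_iff_of_cut (by omega) h).1 hQ).2
    rw [hr, simpleBlock, isSimplexDuplex_seg_seg (by omega) (by omega)] at hsd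
    refine Or.inr (Or.inr (Or.inl ⟨⟨P, κ, y, Finset.mem_Ioo.2 ?_⟩, Subtype.ext ?_⟩))
    · push_cast at hsd
      omega
    · rw [hr] at e
      exact e.symm
  · rcases columnComponents_cases hQ (-2) with h' | ⟨y, s, h'⟩ | ⟨h2', -⟩
    · have := rightPart_eq_self hconn h' h0 (by simp)
      rw [rightPart_neg_two hle, h, h', Finset.empty_union, hκ, Finset.union_comm] at this
      have hc := hconn
      rw [← this, conn_seg_dseg (Or.inr (by ring)) (by omega) (by omega) (by omega) (by omega),
        ← mem_endPlacements] at hc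
      refine Or.inr (Or.inl ⟨⟨(κ, a, b), ⟨g, -z⟩, ?_⟩, Subtype.ext ?_⟩)
      · rwa [zero_sub] at hc
      · change startBlock κ a b ⟨g, -z⟩ = Q
        rw [← this, startBlock]
        simp
    · obtain ⟨P, rfl, e⟩ := exists_eq_glue hQ h'
      have hr : rightPart Q (-2) = duplexBlock P.size κ a b ⟨g, y - z, -z⟩ := by
        rw [rightPart_neg_two hle, h, h', hκ, duplexBlock, block]
        simp
      have hsd := ((isSimplexDuplex_iff_of_cut (by omega) h').1 hQ).2
      rw [hr, duplexBlock, isSimplexDuplex_of_single (columnComponents_block (by omega) (by omega)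
        (by omega) (by omega) (by omega)), conn_block (by omega) (by omega)
        (by omega) (by omega) (by omega), sub_neg_eq_add, sub_add_cancel, sub_neg_eq_add,
        zero_add, ← mem_duplexPlacements] at hsd
      refine Or.inr (Or.inr (Or.inr ⟨⟨P, (κ, a, b), ⟨g, y - z, -z⟩, hsd⟩, Subtype.ext ?_⟩))
      rw [hr] at e
      change glue P (-2) (y - z - -z) (duplexBlock P.size κ a b ⟨g, y - z, -z⟩) = Q
      rw [sub_neg_eq_add, sub_add_cancel]
      exact e.symm
    · have := (isSimplexDuplex_iff.1 hQ).2.2 (-2) h2'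
      exact absurd h2 this

/-- The decomposition of the polyominoes with a simplex last column: a single column, a duplex
column followed by a simplex column, or a smaller polyomino extended by a simplex column or by a
duplex and a simplex column. -/
lemma decompose_bijective : Function.Bijective
    (Sum.elim (Sum.elim ofColumn ofStart) (Sum.elim ofSimple ofDuplex)) := by
  constructor
  · refine Function.Injective.sumElim
      (ofColumn_injective.sumElim ofStart_injective fun κ d h => ?_)
      (ofSimple_injective.sumElim ofDuplex_injective fun d d' h => ?_) ?_
    · have := columnComponents_ofColumn κ
      rw [h, columnComponents_ofStart_neg_one] at this
      omega
    · have := columnComponents_ofSimple d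
      rw [h, columnComponents_ofDuplex_neg_one] at this
      omega
    · rintro (κ | d) (d' | d') h
      · have := columnComponents_ofColumn κ
        rw [Sum.elim_inl, Sum.elim_inl] at h
        rw [h, columnComponents_ofSimple] at this
        omega
      · have := columnComponents_ofColumn κ
        rw [Sum.elim_inl, Sum.elim_inr] at h
        rw [h, columnComponents_ofDuplex_neg_one] at this
        omega
      · have := columnComponents_ofStart_neg_one d
        rw [Sum.elim_inr, Sum.elim_inl] at h
        rw [h, columnComponents_ofSimple] at this
        omega
      · have := columnComponents_ofStart_neg_two d
        rw [Sum.elim_inr, Sum.elim_inr] at h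
        rw [h, columnComponents_ofDuplex_neg_two] at this
        omega
  · intro Q
    rcases simplexEnded_cases Q with ⟨d, h⟩ | ⟨d, h⟩ | ⟨d, h⟩ | ⟨d, h⟩
    · exact ⟨Sum.inl (Sum.inl d), h⟩
    · exact ⟨Sum.inl (Sum.inr d), h⟩
    · exact ⟨Sum.inr (Sum.inl d), h⟩
    · exact ⟨Sum.inr (Sum.inr d), h⟩

/-- The columns from a segment of height `s + 1` at `-1` to a duplex column at `0`. -/
def endBlock (s a b : ℕ) (v : Σ _ : ℕ, ℤ) : Finset (ℤ × ℤ) :=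
  seg (-1) v.2 (s + 1) ∪ dseg 0 0 (a + 1) (v.1 + 1) (b + 1)

lemma endBlock_bounds {s a b : ℕ} {v : Σ _ : ℕ, ℤ} {c : ℤ × ℤ} (hc : c ∈ endBlock s a b v) :
    -1 ≤ c.1 ∧ c.1 ≤ 0 := by
  rw [endBlock, Finset.mem_union, mem_seg, mem_dseg] at hc
  omega

lemma column_endBlock (s a b : ℕ) (v : Σ _ : ℕ, ℤ) :
    column (endBlock s a b v) (-1) = seg (-1) v.2 (s + 1) := by
  simp [endBlock, column_union, column_seg, column_dseg]

lemma column_endBlock_zero (s a b : ℕ) (v : Σ _ : ℕ, ℤ) :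
    column (endBlock s a b v) 0 = dseg 0 0 (a + 1) (v.1 + 1) (b + 1) := by
  simp [endBlock, column_union, column_seg, column_dseg]

/-- Adding a last column that is duplex. -/
def ofEnd (d : Σ P : SimplexEnded, Σ d : ℕ × ℕ, endPlacements P.size d.1) : DuplexEnded :=
  have hB := fun c hc => (endBlock_bounds (s := d.1.size) (a := d.2.1.1)
    (b := d.2.1.2) (v := d.2.2.1) (c := c) hc).1
  ⟨glue d.1 (-1) _ (endBlock d.1.size d.2.1.1 d.2.1.2 d.2.2.1),
    isSimplexDuplex_glue hB (column_endBlock _ _ _ _) (by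
      rw [endBlock, isSimplexDuplex_of_single (columnComponents_seg_dseg (Or.inl (by ring))
        (by omega) (by omega) (by omega) (by omega)), conn_seg_dseg (Or.inl (by ring))
        (by omega) (by omega) (by omega) (by omega), sub_zero, ← mem_endPlacements]
      exact d.2.2.2), by
    intro c hc
    rcases Finset.mem_union.1 hc with h | h
    · exact (d.1.fst_le_of_mem_shift h).trans (by omega)
    · exact (endBlock_bounds h).2, d.2.1.1, d.2.2.1.1, d.2.1.2, by
    rw [column_glue_of_lt hB (column_endBlock _ _ _ _) (by omega), column_endBlock_zero]⟩

lemma column_ofEnd_zero (d) : column (ofEnd d).1 0 =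
    dseg 0 0 (d.2.1.1 + 1) (d.2.2.1.1 + 1) (d.2.1.2 + 1) :=
  (column_glue_of_lt (fun _ hc => (endBlock_bounds hc).1) (column_endBlock _ _ _ _)
    (by omega)).trans (column_endBlock_zero _ _ _ _)

/-- A duplex last column is preceded by a simplex column, since alone it is not connected. -/
lemma ofEnd_bijective : Function.Bijective ofEnd := by
  constructor
  · intro d d' h
    have h4 := column_ofEnd_zero d
    rw [h, column_ofEnd_zero] at h4
    obtain ⟨h2, h3, -⟩ := glue_inj (fun _ hc => (endBlock_bounds hc).1)
      (column_endBlock _ _ _ _) (fun _ hc => (endBlock_bounds hc).1)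
      (column_endBlock _ _ _ _) (congrArg Subtype.val h)
    obtain ⟨P, ⟨a, b⟩, ⟨⟨g, i⟩, hv⟩⟩ := d
    obtain ⟨P', ⟨a', b'⟩, ⟨⟨g', i'⟩, hv'⟩⟩ := d'
    obtain ⟨-, -, e2, e3, e4⟩ := dseg_inj (by omega) (by omega) (by omega) (by omega) (by omega)
      (by omega) h4
    simp only [Nat.add_right_cancel_iff] at h2 h3 e2 e3 e4
    subst h2 h3 e2 e3 e4
    rfl
  · rintro ⟨Q, hQ, hle, a, g, b, h⟩
    have hconn := (isSimplexDuplex_iff.1 hQ).1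
    have h0 : ((0, 0) : ℤ × ℤ) ∈ Q := (mem_column.1 (h ▸ mem_dseg.2
      ⟨rfl, Or.inl ⟨le_rfl, by simp⟩⟩ : ((0, 0) : ℤ × ℤ) ∈ column Q 0)).1
    rcases columnComponents_cases hQ (-1) with h' | ⟨y, s, h'⟩ | ⟨h2, -⟩
    · have := rightPart_eq_self hconn h' h0 (by simp)
      rw [rightPart_neg_one hle, h', Finset.empty_union, h] at this
      rw [← this] at hconn
      exact absurd hconn (not_conn_dseg (by omega) (by omega) (by omega))
    · obtain ⟨P, rfl, e⟩ := exists_eq_glue hQ h'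
      have hr : rightPart Q (-1) = endBlock P.size a b ⟨g, y⟩ := by
        rw [rightPart_neg_one hle, h, h', endBlock]
      have hsd := ((isSimplexDuplex_iff_of_cut (by omega) h').1 hQ).2
      rw [hr, endBlock, isSimplexDuplex_of_single (columnComponents_seg_dseg (Or.inl (by ring))
        (by omega) (by omega) (by omega) (by omega)), conn_seg_dseg (Or.inl (by ring))
        (by omega) (by omega) (by omega) (by omega), sub_zero, ← mem_endPlacements] at hsd
      refine ⟨⟨P, (a, b), ⟨g, y⟩, hsd⟩, Subtype.ext ?_⟩
      rw [hr] at e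
      exact e.symm
    · have := (isSimplexDuplex_iff.1 hQ).2.2 (-1) h2
      rw [neg_add_cancel] at this
      exact absurd (columnComponents_of_dseg (by omega) (by omega) (by omega) h) this

/-! ### Areas, duplex columns and the number of placements -/

lemma card_ofColumn (κ : ℕ) : (ofColumn κ).1.card = κ + 1 := card_seg _ _ _

lemma card_duplexIndices_ofColumn (κ : ℕ) : (duplexIndices (ofColumn κ).1).card = 0 := by
  simp [ofColumn, duplexIndices_seg]

lemma card_seg_union_dseg {x x' y z : ℤ} {h a g b : ℕ} (hx : x ≠ x') :
    (seg x y h ∪ dseg x' z a g b).card = h + (a + b) := by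
  rw [Finset.card_union_of_disjoint, card_seg, card_dseg]
  rw [Finset.disjoint_left]
  intro c h1 h2
  rw [mem_seg] at h1
  rw [mem_dseg] at h2
  omega

lemma card_ofStart (d) : (ofStart d).1.card = (d.1.1 + 1) + ((d.1.2.1 + 1) + (d.1.2.2 + 1)) :=
  card_seg_union_dseg (by omega)

lemma card_duplexIndices_ofStart (d) : (duplexIndices (ofStart d).1).card = 1 := by
  have : duplexIndices (ofStart d).1 = {-1} := duplexIndices_of_single
    (columnComponents_seg_dseg (Or.inr (by ring)) (by omega) (by omega) (by omega) (by omega))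
  rw [this, Finset.card_singleton]

lemma card_ofSimple (d) : (ofSimple d).1.card = d.1.1.card + (d.2.1 + 1) := by
  have h1 := card_glue (P := d.1) (y := d.2.2.1) (fun _ hc => (simpleBlock_bounds hc).1)
    (column_simpleBlock d.1.size d.2.1 _)
  have h2 : (simpleBlock d.1.size d.2.1 d.2.2.1).card = (d.1.size + 1) + (d.2.1 + 1) := by
    rw [simpleBlock, Finset.card_union_of_disjoint, card_seg, card_seg]
    rw [Finset.disjoint_left]
    intro c h1 h2
    rw [mem_seg] at h1 h2
    omega
  change (glue d.1 (-1) d.2.2.1 _).card = _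
  omega

lemma card_duplexIndices_ofSimple (d) :
    (duplexIndices (ofSimple d).1).card = (duplexIndices d.1.1).card := by
  have h1 := card_duplexIndices_glue (P := d.1) (y := d.2.2.1)
    (fun _ hc => (simpleBlock_bounds hc).1) (column_simpleBlock d.1.size d.2.1 _)
  rw [simpleBlock, duplexIndices_seg_seg (by omega) (by omega)] at h1
  exact h1

lemma card_ofDuplex (d) : (ofDuplex d).1.card =
    d.1.1.card + ((d.2.1.1 + 1) + ((d.2.1.2.1 + 1) + (d.2.1.2.2 + 1))) := by
  have h1 := card_glue (P := d.1) (fun _ hc => (duplexBlock_bounds hc).1)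
    (column_duplexBlock d.1.size d.2.1.1 d.2.1.2.1 d.2.1.2.2 d.2.2.1)
  have h2 : (duplexBlock d.1.size d.2.1.1 d.2.1.2.1 d.2.1.2.2 d.2.2.1).card =
      (d.1.size + 1) + (d.2.1.1 + 1) + ((d.2.1.2.1 + 1) + (d.2.1.2.2 + 1)) := by
    rw [duplexBlock, block, Finset.card_union_of_disjoint, card_seg_union_dseg (by omega), card_seg]
    · omega
    · rw [Finset.disjoint_left]
      intro c h1 h2
      rw [Finset.mem_union, mem_seg, mem_dseg] at h1
      rw [mem_seg] at h2
      omega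
  change (glue d.1 (-2) _ _).card = _
  omega

lemma card_duplexIndices_ofDuplex (d) :
    (duplexIndices (ofDuplex d).1).card = (duplexIndices d.1.1).card + 1 := by
  have h1 := card_duplexIndices_glue (P := d.1) (fun _ hc => (duplexBlock_bounds hc).1)
    (column_duplexBlock d.1.size d.2.1.1 d.2.1.2.1 d.2.1.2.2 d.2.2.1)
  rw [duplexBlock, duplexIndices_of_single (columnComponents_block (by omega) (by omega)
        (by omega) (by omega) (by omega)), Finset.card_singleton] at h1
  exact h1

lemma card_ofEnd (d) : (ofEnd d).1.card = d.1.1.card + ((d.2.1.1 + 1) + (d.2.1.2 + 1)) := by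
  have h1 := card_glue (P := d.1) (fun _ hc => (endBlock_bounds hc).1)
    (column_endBlock d.1.size d.2.1.1 d.2.1.2 d.2.2.1)
  have h2 : (endBlock d.1.size d.2.1.1 d.2.1.2 d.2.2.1).card =
      (d.1.size + 1) + ((d.2.1.1 + 1) + (d.2.1.2 + 1)) := card_seg_union_dseg (by omega)
  change (glue d.1 (-1) _ _).card = _
  omega

lemma card_duplexIndices_ofEnd (d) :
    (duplexIndices (ofEnd d).1).card = (duplexIndices d.1.1).card + 1 := by
  have h1 := card_duplexIndices_glue (P := d.1) (fun _ hc => (endBlock_bounds hc).1)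
    (column_endBlock d.1.size d.2.1.1 d.2.1.2 d.2.2.1)
  rw [endBlock, duplexIndices_of_single (columnComponents_seg_dseg (Or.inl (by ring))
        (by omega) (by omega) (by omega) (by omega)), Finset.card_singleton] at h1
  exact h1

lemma card_touchBoth (h a g : ℕ) : (touchBoth h a g).card = h - g - 1 := by
  rw [touchBoth, Int.card_Ioo]
  omega

/-- Inclusion and exclusion: `a + h - 1` heights touch the lower component, `b + h - 1` the upper one
and `h - g - 1` both. -/
lemma card_touchAny {h a g b : ℕ} (hh : 1 ≤ h) (ha : 1 ≤ a) (hb : 1 ≤ b) :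
    (touchAny h a g b).card + (h - g - 1) = a + b + 2 * h - 2 := by
  have : Finset.Ioo (-(h : ℤ)) a ∩ Finset.Ioo ((a : ℤ) + g - h) (a + g + b) =
      touchBoth h a g := by
    ext i
    rw [touchBoth, Finset.mem_inter, Finset.mem_Ioo, Finset.mem_Ioo, Finset.mem_Ioo]
    omega
  rw [← card_touchBoth h a g, ← this, touchAny, Finset.card_union_add_card_inter, Int.card_Ioo,
    Int.card_Ioo]
  omega

lemma touchBoth_subset_touchAny {h a g b : ℕ} (ha : 1 ≤ a) (hb : 1 ≤ b) :
    touchBoth h a g ⊆ touchAny h a g b := by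
  intro i hi
  rw [mem_touchBoth_iff ha hb] at hi
  exact mem_touchAny_iff.2 (Or.inl hi.1)

/-- Inclusion and exclusion, with `card_touchAny` for the second factors. The intersection is counted
three times in the correction: once for itself and once for each of the two products. -/
lemma card_blockPairs {h k a g b : ℕ} (hh : 1 ≤ h) (hk : 1 ≤ k) (ha : 1 ≤ a) (hb : 1 ≤ b) :
    (blockPairs h k a g b).card + 3 * ((h - g - 1) * (k - g - 1)) =
      (h - g - 1) * (a + b + 2 * k - 2) + (k - g - 1) * (a + b + 2 * h - 2) := by
  have h1 := Finset.card_union_add_card_inter (touchBoth h a g ×ˢ touchAny k a g b)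
    (touchAny h a g b ×ˢ touchBoth k a g)
  have h2 : (touchBoth h a g ×ˢ touchAny k a g b) ∩ (touchAny h a g b ×ˢ touchBoth k a g) =
      touchBoth h a g ×ˢ touchBoth k a g := by
    ext c
    have c1 : c.1 ∈ touchBoth h a g → c.1 ∈ touchAny h a g b :=
      fun hc => touchBoth_subset_touchAny ha hb hc
    have c2 : c.2 ∈ touchBoth k a g → c.2 ∈ touchAny k a g b :=
      fun hc => touchBoth_subset_touchAny ha hb hc
    simp only [Finset.mem_inter, Finset.mem_product]
    tauto
  rw [h2, Finset.card_product, Finset.card_product, Finset.card_product, card_touchBoth,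
    card_touchBoth] at h1
  rw [blockPairs, ← card_touchAny hh ha hb (g := g), ← card_touchAny hk ha hb (g := g)]
  linarith [h1, mul_comm (touchAny h a g b).card (k - g - 1)]

/-- The sum of `(s - g) (κ - g)` over the gaps `1 ≤ g < min s κ`; the other terms vanish by truncated
subtraction. It counts the pairs of segments of heights `s + 1` and `κ + 1` that both touch both
components of a duplex column between them. -/
def gapSum (s κ : ℕ) : ℕ := ∑ g ∈ Finset.range κ, (s - (g + 1)) * (κ - (g + 1))

lemma sum_range_sub_choose (s m : ℕ) :
    ∑ g ∈ Finset.range (s + m), (s - (g + 1)) = s.choose 2 := by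
  rw [Finset.sum_range_add, Finset.sum_eq_zero (s := Finset.range m) (fun g _ => by omega),
    add_zero]
  induction s with
  | zero => rfl
  | succ s ih =>
    rw [Finset.sum_range_succ', Nat.choose_succ_succ' s 1, ← ih, Nat.choose_one_right, add_comm]
    congr 1
    refine Finset.sum_congr rfl fun g _ => by omega

/-- The number does not depend on the sizes of the two components. -/
lemma card_endPlacements (s a : ℕ) : (endPlacements s a).card = s.choose 2 := by
  rw [endPlacements, Finset.card_sigma, ← sum_range_sub_choose s 0, add_zero]
  refine Finset.sum_congr rfl fun g _ => ?_
  rw [card_touchBoth]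
  omega

/-- The sum of `card_blockPairs` over all gaps. -/
lemma card_duplexPlacements (s κ a b : ℕ) :
    (duplexPlacements s κ a b).card + 3 * gapSum s κ =
      s.choose 2 * ((a + 1) + (b + 1) + 2 * κ) + κ.choose 2 * ((a + 1) + (b + 1) + 2 * s) := by
  have hgap : gapSum s κ = ∑ g ∈ Finset.range (s + κ), (s - (g + 1)) * (κ - (g + 1)) := by
    rw [add_comm s κ, Finset.sum_range_add,
      Finset.sum_eq_zero (s := Finset.range s) (fun g _ => by
        rw [show κ - (κ + g + 1) = 0 by omega, mul_zero]), add_zero, gapSum]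
  rw [duplexPlacements, Finset.card_sigma, hgap, Finset.mul_sum, ← Finset.sum_add_distrib,
    ← sum_range_sub_choose s κ, ← sum_range_sub_choose κ s, add_comm κ s, Finset.sum_mul,
    Finset.sum_mul, ← Finset.sum_add_distrib]
  refine Finset.sum_congr rfl fun g _ => ?_
  have := card_blockPairs (h := s + 1) (k := κ + 1) (a := a + 1) (b := b + 1) (g := g + 1)
    (by omega) (by omega) (by omega) (by omega)
  rw [show s + 1 - (g + 1) - 1 = s - (g + 1) by omega,
    show κ + 1 - (g + 1) - 1 = κ - (g + 1) by omega,
    show a + 1 + (b + 1) + 2 * (κ + 1) - 2 = a + 1 + (b + 1) + 2 * κ by omega,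
    show a + 1 + (b + 1) + 2 * (s + 1) - 2 = a + 1 + (b + 1) + 2 * s by omega] at this
  exact this

/-! ### Normalized representatives of the translation classes -/

/-- `P` is normalized when `(0, 0)` is the lowest cell of its last column. -/
def IsNormalized (P : Finset (ℤ × ℤ)) : Prop :=
  ((0, 0) : ℤ × ℤ) ∈ P ∧ ∀ c ∈ P, c.1 < 0 ∨ (c.1 = 0 ∧ 0 ≤ c.2)

lemma isNormalized_simplexEnded (P : SimplexEnded) : IsNormalized P.1 := by
  constructor
  · have : ((0, 0) : ℤ × ℤ) ∈ column P.1 0 := by rw [P.column_zero]; simp [mem_seg]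
    exact (mem_column.1 this).1
  · intro c hc
    have h1 := P.2.2.1 c hc
    rcases h1.lt_or_eq with h | h
    · exact Or.inl h
    · have : c ∈ column P.1 0 := mem_column.2 ⟨hc, h⟩
      rw [P.column_zero, mem_seg] at this
      exact Or.inr ⟨h, this.2.1⟩

lemma isNormalized_duplexEnded (P : DuplexEnded) : IsNormalized P.1 := by
  obtain ⟨a, g, b, e⟩ := P.2.2.2
  constructor
  · have : ((0, 0) : ℤ × ℤ) ∈ column P.1 0 := by
      rw [e, mem_dseg]; exact ⟨rfl, Or.inl ⟨le_rfl, by simp⟩⟩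
    exact (mem_column.1 this).1
  · intro c hc
    have h1 := P.2.2.1 c hc
    rcases h1.lt_or_eq with h | h
    · exact Or.inl h
    · have : c ∈ column P.1 0 := mem_column.2 ⟨hc, h⟩
      rw [e, mem_dseg] at this
      exact Or.inr ⟨h, by omega⟩

lemma exists_shift_isNormalized {P : Finset (ℤ × ℤ)} (hP : P.Nonempty) :
    ∃ v, IsNormalized (shift v P) := by
  obtain ⟨a, ha, hmax⟩ := P.exists_max_image Prod.fst hP
  obtain ⟨b, hb, hmin⟩ := (column P a.1).exists_min_image Prod.snd ⟨a, mem_column.2 ⟨ha, rfl⟩⟩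
  rw [mem_column] at hb
  refine ⟨-b, mem_shift.2 ?_, fun c hc => ?_⟩
  · have : ((0, 0) : ℤ × ℤ) - -b = b := by ext <;> simp
    rw [this]
    exact hb.1
  · rw [mem_shift, sub_neg_eq_add] at hc
    have h1 := hmax _ hc
    rw [Prod.fst_add] at h1
    by_cases h : c.1 = 0
    · have := hmin _ (mem_column.2 ⟨hc, by rw [Prod.fst_add]; omega⟩)
      rw [Prod.snd_add] at this
      exact Or.inr ⟨h, by omega⟩
    · exact Or.inl (by omega)

lemma eq_zero_of_isNormalized_shift {P : Finset (ℤ × ℤ)} {v : ℤ × ℤ} (h : IsNormalized P)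
    (h' : IsNormalized (shift v P)) : v = 0 := by
  have h1 := h'.2 v (mem_shift.2 (by rw [sub_self]; exact h.1))
  have h2 := h.2 (0 - v) (mem_shift.1 h'.1)
  rw [Prod.fst_sub, Prod.snd_sub, Prod.fst_zero, Prod.snd_zero] at h2
  ext
  · rw [Prod.fst_zero]; omega
  · rw [Prod.snd_zero]; omega

/-- Normalized simplex-duplex polyominoes, listed by the type of their last column. -/
abbrev Normal : Type := SimplexEnded ⊕ DuplexEnded

/-- The underlying set of cells. -/
def Normal.cells : Normal → Finset (ℤ × ℤ) := Sum.elim Subtype.val Subtype.val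

lemma Normal.isSimplexDuplex (P : Normal) : IsSimplexDuplex P.cells := by
  rcases P with P | P <;> exact P.2.1

lemma Normal.isNormalized (P : Normal) : IsNormalized P.cells := by
  rcases P with P | P
  · exact isNormalized_simplexEnded P
  · exact isNormalized_duplexEnded P

lemma Normal.cells_injective : Function.Injective Normal.cells := by
  refine Subtype.val_injective.sumElim Subtype.val_injective fun P P' h => ?_
  have h1 := columnComponents_of_seg (by omega) (SimplexEnded.column_zero P)
  obtain ⟨a, g, b, e⟩ := P'.2.2.2
  have h2 := columnComponents_of_dseg (by omega) (by omega) (by omega) e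
  change P.1 = P'.1 at h
  rw [h] at h1
  omega

lemma exists_normal {P : Finset (ℤ × ℤ)} (hP : IsSimplexDuplex P) (hn : IsNormalized P) :
    ∃ N : Normal, N.cells = P := by
  have hle : ∀ c ∈ P, c.1 ≤ 0 := fun c hc => by
    have := hn.2 c hc
    omega
  have h0 : ((0, 0) : ℤ × ℤ) ∈ column P 0 := mem_column.2 ⟨hn.1, rfl⟩
  rcases columnComponents_cases hP 0 with h | ⟨y, s, h⟩ | ⟨-, y, a, g, b, h⟩
  · rw [h] at h0
    simp at h0
  · have hy : ((0, y) : ℤ × ℤ) ∈ column P 0 := by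
      rw [h, mem_seg]; exact ⟨rfl, le_rfl, by simp⟩
    have h1 := hn.2 _ (mem_column.1 hy).1
    rw [h, mem_seg] at h0
    simp only at h0 h1
    have : y = 0 := by omega
    subst this
    exact ⟨Sum.inl ⟨P, hP, hle, s, h⟩, rfl⟩
  · have hy : ((0, y) : ℤ × ℤ) ∈ column P 0 := by
      rw [h, mem_dseg]; exact ⟨rfl, Or.inl ⟨le_rfl, by simp⟩⟩
    have h1 := hn.2 _ (mem_column.1 hy).1
    rw [h, mem_dseg] at h0
    simp only at h0 h1
    have : y = 0 := by omega
    subst this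
    exact ⟨Sum.inr ⟨P, hP, hle, a, g, b, h⟩, rfl⟩

lemma Normal.mk_injective :
    Function.Injective fun P : Normal => Quotient.mk translationSetoid P.cells := by
  intro P P' h
  obtain ⟨v, hv⟩ := Quotient.exact h
  have h' := P'.isNormalized
  rw [hv] at h'
  have := eq_zero_of_isNormalized_shift P.isNormalized h'
  subst this
  apply Normal.cells_injective
  rw [hv]
  exact (shift_zero _).symm

lemma classes_eq_image (n k : ℕ) : classes n k =
    (fun P : Normal => Quotient.mk translationSetoid P.cells) ''
      {P | P.cells.card = n ∧ (duplexIndices P.cells).card = k} := by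
  ext C
  constructor
  · rintro ⟨P, ⟨hP, hn, hk⟩, rfl⟩
    obtain ⟨v, hv⟩ := exists_shift_isNormalized (isSimplexDuplex_iff.1 hP).1.1
    obtain ⟨N, hN⟩ := exists_normal (isSimplexDuplex_shift.2 hP) hv
    refine ⟨N, ⟨?_, ?_⟩, ?_⟩
    · rw [hN, card_shift, hn]
    · rw [hN, duplexIndices_shift, hk]
    · exact Quotient.sound (translationSetoid.symm ⟨v, hN⟩)
  · rintro ⟨P, ⟨hn, hk⟩, rfl⟩
    exact ⟨P.cells, ⟨P.isSimplexDuplex, hn, hk⟩, rfl⟩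

/-- A coordinate that changes by at most one along edges takes all intermediate values on a
connected set. -/
lemma Conn.exists_eq_of_le {P : Finset (ℤ × ℤ)} (hP : Conn P) {π : ℤ × ℤ → ℤ}
    (hπ : ∀ a b, cellGraph.Adj a b → π b ≤ π a + 1) {a b : ℤ × ℤ} (ha : a ∈ P) (hb : b ∈ P)
    {t : ℤ} (h1 : π a ≤ t) (h2 : t ≤ π b) : ∃ c ∈ P, π c = t := by
  by_contra! hne
  have := hP.2 (fun c => π c < t) (fun c hc d hd hcd h => by
    have := hπ c d hcd
    have := hne d hd
    omega) a ha b hb (lt_of_le_of_ne h1 (hne a ha))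
  omega

lemma Conn.sub_lt_card {P : Finset (ℤ × ℤ)} (hP : Conn P) {π : ℤ × ℤ → ℤ}
    (hπ : ∀ a b, cellGraph.Adj a b → π b ≤ π a + 1) {a b : ℤ × ℤ} (ha : a ∈ P) (hb : b ∈ P) :
    π b - π a < P.card := by
  have hsub : Finset.Icc (π a) (π b) ⊆ P.image π := by
    intro t ht
    rw [Finset.mem_Icc] at ht
    rw [Finset.mem_image]
    exact hP.exists_eq_of_le hπ ha hb ht.1 ht.2
  have := (Finset.card_le_card hsub).trans Finset.card_image_le
  rw [Int.card_Icc] at this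
  omega

lemma Normal.finite_card_le (n : ℕ) : {P : Normal | P.cells.card ≤ n}.Finite := by
  let box : Finset (ℤ × ℤ) := Finset.Icc (-n : ℤ) n ×ˢ Finset.Icc (-n : ℤ) n
  refine Set.Finite.of_finite_image ((box.powerset.finite_toSet).subset ?_)
    (f := Normal.cells) Normal.cells_injective.injOn
  rintro _ ⟨P, hP, rfl⟩
  rw [Finset.mem_coe, Finset.mem_powerset]
  intro c hc
  have hconn := (isSimplexDuplex_iff.1 P.isSimplexDuplex).1
  have h0 := P.isNormalized.1
  have fst : ∀ a b : ℤ × ℤ, cellGraph.Adj a b → b.1 ≤ a.1 + 1 := fun a b h => by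
    rw [adj_iff] at h
    omega
  have snd : ∀ a b : ℤ × ℤ, cellGraph.Adj a b → b.2 ≤ a.2 + 1 := fun a b h => by
    rw [adj_iff] at h
    omega
  have h1 := hconn.sub_lt_card fst h0 hc
  have h2 := hconn.sub_lt_card fst hc h0
  have h3 := hconn.sub_lt_card snd h0 hc
  have h4 := hconn.sub_lt_card snd hc h0
  have h5 : P.cells.card ≤ n := hP
  simp only [box, Finset.mem_product, Finset.mem_Icc]
  simp only at h1 h2 h3 h4
  omega

lemma SimplexEnded.finite_card_le (n : ℕ) : {P : SimplexEnded | P.1.card ≤ n}.Finite :=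
  (Normal.finite_card_le n).preimage (f := Sum.inl) Sum.inl_injective.injOn

lemma Normal.finite_card_eq (n k : ℕ) :
    {P : Normal | P.cells.card = n ∧ (duplexIndices P.cells).card = k}.Finite :=
  (Normal.finite_card_le n).subset fun _ h => h.1.le

lemma classes_finite (n k : ℕ) : (classes n k).Finite := by
  rw [classes_eq_image]
  exact (Normal.finite_card_eq n k).image _

lemma ncard_classes (n k : ℕ) : (classes n k).ncard =
    {P : Normal | P.cells.card = n ∧ (duplexIndices P.cells).card = k}.ncard := by
  rw [classes_eq_image]
  exact Set.ncard_image_of_injective _ Normal.mk_injective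

lemma coeff_q_pow_mul_w_pow (a b : ℕ) (e : Fin 2 →₀ ℕ) :
    MvPowerSeries.coeff e (q ^ a * w ^ b) = if a = e 0 ∧ b = e 1 then (1 : ℚ) else 0 := by
  classical
  rw [q, w, MvPowerSeries.X_pow_eq, MvPowerSeries.X_pow_eq, MvPowerSeries.monomial_mul_monomial,
    MvPowerSeries.coeff_monomial, one_mul]
  refine if_congr ?_ rfl rfl
  rw [Finsupp.ext_iff, Fin.forall_fin_two]
  simp [eq_comm]

/-- The generating function is the sum of the weights of the normalized polyominoes. -/
lemma hasSum_G : HasSum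
    (fun P : Normal => q ^ P.cells.card * w ^ (duplexIndices P.cells).card) G := by
  rw [MvPowerSeries.WithPiTopology.hasSum_iff_hasSum_coeff]
  intro e
  simp only [coeff_q_pow_mul_w_pow]
  have hG : MvPowerSeries.coeff e G =
      (((Normal.finite_card_eq (e 0) (e 1)).toFinset.card : ℕ) : ℚ) := by
    change ((classes (e 0) (e 1)).ncard : ℚ) = _
    rw [ncard_classes, Set.ncard_eq_toFinset_card _ (Normal.finite_card_eq (e 0) (e 1))]
  have := hasSum_sum_of_ne_finset_zero (L := SummationFilter.unconditional _)
    (f := fun P : Normal => if P.cells.card = e 0 ∧ (duplexIndices P.cells).card = e 1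
      then (1 : ℚ) else 0) (s := (Normal.finite_card_eq (e 0) (e 1)).toFinset) (by
      intro P hP
      rw [Set.Finite.mem_toFinset] at hP
      exact if_neg hP)
  rw [Finset.sum_boole, Finset.filter_true_of_mem (p := fun P : Normal =>
    P.cells.card = e 0 ∧ (duplexIndices P.cells).card = e 1)
    fun P hP => (Set.Finite.mem_toFinset (Normal.finite_card_eq (e 0) (e 1))).1 hP] at this
  rw [hG]
  exact this

/-! ### Summation of families divisible by growing powers -/

section QAdic

variable {R : Type*} [CommRing R] [TopologicalSpace R]

/-- Every family is summable whose members are divisible by powers of `Q` with exponents tending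
to infinity. This is how formal convergence enters: `q` has the property both in `Ser` and as a
constant of the power series ring over `Ser`. -/
def QAdic (Q : R) : Prop :=
  ∀ (ι : Type) (F : ι → R) (r : ι → ℕ), (∀ n, {i | r i ≤ n}.Finite) → (∀ i, Q ^ r i ∣ F i) →
    Summable F

lemma QAdic.summable {Q : R} (hQ : QAdic Q) {ι : Type} {F : ι → R} (r : ι → ℕ)
    (hr : ∀ n, {i | r i ≤ n}.Finite) (h : ∀ i, Q ^ r i ∣ F i) : Summable F := hQ ι F r hr h

lemma QAdic.summable_nat {Q : R} (hQ : QAdic Q) {F : ℕ → R} (h : ∀ i, Q ^ i ∣ F i) :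
    Summable F := hQ.summable id (fun n => Set.finite_Iic n) h

variable [IsTopologicalRing R] [T2Space R]

lemma QAdic.hasSum_pow {Q u v : R} (hQ : QAdic Q) (hu : Q ∣ u) (hv : v * (1 - u) = 1) :
    HasSum (fun κ : ℕ => u ^ κ) v := by
  have hs : Summable fun κ : ℕ => u ^ κ := hQ.summable_nat fun κ => pow_dvd_pow_of_dvd hu κ
  have h1 := hs.one_sub_mul_tsum_pow
  have : ∑' κ : ℕ, u ^ κ = v := by linear_combination v * h1 - (∑' κ : ℕ, u ^ κ) * hv
  exact this ▸ hs.hasSum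

/-- Summation of a coefficient sequence multiplies the generating function by `u / (1 - u)`. -/
lemma QAdic.hasSum_of_succ {Q u v S : R} (hQ : QAdic Q) (hu : Q ∣ u) (hv : v * (1 - u) = 1)
    {f g : ℕ → ℕ} (hg0 : g 0 = 0) (hg : ∀ κ, g (κ + 1) = g κ + f κ)
    (hf : HasSum (fun κ => (f κ : R) * u ^ κ) S) :
    HasSum (fun κ => (g κ : R) * u ^ κ) (u * v * S) := by
  have hs : Summable fun κ : ℕ => (g κ : R) * u ^ κ :=
    hQ.summable_nat fun κ => (pow_dvd_pow_of_dvd hu κ).mul_left _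
  have h1 := hs.tsum_eq_zero_add
  have h2 : HasSum (fun κ : ℕ => (g (κ + 1) : R) * u ^ (κ + 1))
      (u * (∑' κ, (g κ : R) * u ^ κ + S)) := by
    refine ((hs.hasSum.add hf).mul_left u).congr_fun ?_
    intro κ
    rw [hg]
    push_cast
    ring
  rw [h2.tsum_eq, hg0, Nat.cast_zero, zero_mul, zero_add] at h1
  have : ∑' κ, (g κ : R) * u ^ κ = u * v * S := by
    linear_combination v * h1 - (∑' κ, (g κ : R) * u ^ κ) * hv
  exact this ▸ hs.hasSum

lemma QAdic.hasSum_id {Q u v : R} (hQ : QAdic Q) (hu : Q ∣ u) (hv : v * (1 - u) = 1) :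
    HasSum (fun κ : ℕ => (κ : R) * u ^ κ) (u * v ^ 2) := by
  have h := hQ.hasSum_of_succ hu hv (f := fun _ => 1) (g := id) (S := v) rfl (fun _ => rfl)
    (by simpa using hQ.hasSum_pow hu hv)
  rw [show u * v ^ 2 = u * v * v by ring]
  exact h

lemma QAdic.hasSum_choose_two {Q u v : R} (hQ : QAdic Q) (hu : Q ∣ u) (hv : v * (1 - u) = 1) :
    HasSum (fun κ : ℕ => (κ.choose 2 : R) * u ^ κ) (u ^ 2 * v ^ 3) := by
  have h := hQ.hasSum_of_succ hu hv (f := id) (g := fun κ => κ.choose 2) rfl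
    (fun κ => by
      rw [Nat.choose_succ_succ' κ 1, Nat.choose_one_right, id, add_comm])
    (hQ.hasSum_id hu hv)
  rw [show u ^ 2 * v ^ 3 = u * v * (u * v ^ 2) by ring]
  exact h

lemma QAdic.hasSum_sub {Q u v : R} (hQ : QAdic Q) (hu : Q ∣ u) (hv : v * (1 - u) = 1)
    (s : ℕ) : HasSum (fun κ : ℕ => ((s - (κ + 1) : ℕ) : R) * u ^ κ)
    (v ^ 2 * (s * (1 - u) - 1 + u ^ s)) := by
  induction s with
  | zero => simp
  | succ s ih =>
    have hs : Summable fun κ : ℕ => ((s + 1 - (κ + 1) : ℕ) : R) * u ^ κ :=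
      hQ.summable_nat fun κ => (pow_dvd_pow_of_dvd hu κ).mul_left _
    have h1 := hs.tsum_eq_zero_add
    have h2 : HasSum (fun κ : ℕ => ((s + 1 - (κ + 1 + 1) : ℕ) : R) * u ^ (κ + 1))
        (u * (v ^ 2 * (s * (1 - u) - 1 + u ^ s))) := by
      refine (ih.mul_left u).congr_fun ?_
      intro κ
      rw [show s + 1 - (κ + 1 + 1) = s - (κ + 1) by omega]
      ring
    rw [h2.tsum_eq, zero_add, Nat.add_sub_cancel, pow_zero, mul_one] at h1
    have : v ^ 2 * (((s + 1 : ℕ) : R) * (1 - u) - 1 + u ^ (s + 1)) =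
        ∑' κ : ℕ, ((s + 1 - (κ + 1) : ℕ) : R) * u ^ κ := by
      rw [h1]
      push_cast
      linear_combination (s * (1 + v * (1 - u))) * hv
    rw [this]
    exact hs.hasSum

/-- Two summations of the sequence `s - (κ + 1)`. The term `u ^ s` is the source of the value of the
generating function at `Q * t` in the functional equation. -/
lemma QAdic.hasSum_gapSum {Q u v : R} (hQ : QAdic Q) (hu : Q ∣ u) (hv : v * (1 - u) = 1)
    (s : ℕ) : HasSum (fun κ : ℕ => (gapSum s κ : R) * u ^ κ)
    (u ^ 2 * v ^ 4 * (s * (1 - u) - 1 + u ^ s)) := by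
  have h1 := hQ.hasSum_of_succ hu hv (f := fun κ => s - (κ + 1))
    (g := fun κ => ∑ g ∈ Finset.range κ, (s - (g + 1))) rfl
    (fun κ => Finset.sum_range_succ _ _) (hQ.hasSum_sub hu hv s)
  have h2 := hQ.hasSum_of_succ hu hv (g := gapSum s) rfl (fun κ => by
    rw [gapSum, gapSum, Finset.sum_range_succ, Nat.sub_self, mul_zero, add_zero,
      ← Finset.sum_add_distrib]
    refine Finset.sum_congr rfl fun g hg => ?_
    rw [Finset.mem_range] at hg
    rw [show κ + 1 - (g + 1) = κ - (g + 1) + 1 by omega, mul_add, mul_one]) h1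
  rw [show u ^ 2 * v ^ 4 * (s * (1 - u) - 1 + u ^ s) =
    u * v * (u * v * (v ^ 2 * (s * (1 - u) - 1 + u ^ s))) by ring]
  exact h2

lemma QAdic.hasSum_mul {Q : R} (hQ : QAdic Q) {f g : ℕ → R} {a b : R} (hf : ∀ i, Q ^ i ∣ f i)
    (hg : ∀ i, Q ^ i ∣ g i) (hfa : HasSum f a) (hgb : HasSum g b) :
    HasSum (fun d : ℕ × ℕ => f d.1 * g d.2) (a * b) := by
  have fin : ∀ n, {d : ℕ × ℕ | d.1 + d.2 ≤ n}.Finite := fun n =>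
    (Set.finite_Iic (n, n)).subset <| by
      rintro ⟨i, j⟩ (hd : i + j ≤ n)
      exact Prod.mk_le_mk.2 ⟨by omega, by omega⟩
  exact HasSum.mul hfa hgb (hQ.summable (fun d => d.1 + d.2) fin fun d => by
      rw [pow_add]
      exact mul_dvd_mul (hf _) (hg _))

lemma QAdic.hasSum_mul_mul {Q : R} (hQ : QAdic Q) {f g h : ℕ → R} {a b c : R}
    (hf : ∀ i, Q ^ i ∣ f i) (hg : ∀ i, Q ^ i ∣ g i) (hh : ∀ i, Q ^ i ∣ h i) (hfa : HasSum f a)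
    (hgb : HasSum g b) (hhc : HasSum h c) :
    HasSum (fun d : ℕ × ℕ × ℕ => f d.1 * (g d.2.1 * h d.2.2)) (a * (b * c)) := by
  have fin : ∀ n, {d : ℕ × ℕ × ℕ | d.1 + (d.2.1 + d.2.2) ≤ n}.Finite := fun n =>
    (Set.finite_Iic (n, n, n)).subset <| by
      rintro ⟨i, j, k⟩ (hd : i + (j + k) ≤ n)
      exact Prod.mk_le_mk.2 ⟨by omega, Prod.mk_le_mk.2 ⟨by omega, by omega⟩⟩
  have hs : Summable fun d : ℕ × ℕ × ℕ => f d.1 * (g d.2.1 * h d.2.2) :=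
    hQ.summable (fun d => d.1 + (d.2.1 + d.2.2)) fin fun d => by
      rw [pow_add, pow_add]
      exact mul_dvd_mul (hf _) (mul_dvd_mul (hg _) (hh _))
  exact HasSum.mul (g := fun d : ℕ × ℕ => g d.1 * h d.2) hfa (hQ.hasSum_mul hg hh hgb hhc) hs

end QAdic

lemma hasSum_of_eq {R ι : Type*} [AddCommMonoid R] [TopologicalSpace R] {f g : ι → R} {a b : R}
    (h : HasSum f a) (hab : a = b) (hfg : ∀ i, g i = f i) : HasSum g b := by
  rw [← hab, show g = f from funext hfg]
  exact h

/-- A sum over pairs in which the second entry ranges over a finite set that matters only through its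
size. -/
lemma hasSum_sigma_finset {R : Type*} [CommRing R] [TopologicalSpace R] [IsTopologicalRing R]
    [T2Space R] {ι : Type*} {κ : ι → Type*} {S : ∀ i, Finset (κ i)} {F : (Σ i, S i) → R}
    {c : ι → R} {a : R} (hF : Summable F) (hc : ∀ i x, F ⟨i, x⟩ = c i)
    (h : HasSum (fun i => ((S i).card : R) * c i) a) : HasSum F a := by
  refine h.sigma_of_hasSum (fun i => ?_) hF
  simp only [hc]
  have := hasSum_fintype (fun _ : S i => c i) (L := SummationFilter.unconditional _)
  rwa [Finset.sum_const, Finset.card_univ, Fintype.card_coe, nsmul_eq_mul] at this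

/-! ### The functional equation -/

section FunctionalEquation

variable {R : Type*} [CommRing R]

/-- The weight of a polyomino: `Q` marks the area and `W` the duplex columns. -/
def weight (Q W : R) (P : Finset (ℤ × ℤ)) : R := Q ^ P.card * W ^ (duplexIndices P).card

lemma weight_ofColumn (Q W : R) (κ : ℕ) : weight Q W (ofColumn κ).1 = Q ^ (κ + 1) := by
  rw [weight, card_ofColumn, card_duplexIndices_ofColumn, pow_zero, mul_one]

lemma weight_ofStart (Q W : R) (d) :
    weight Q W (ofStart d).1 = Q ^ (d.1.1 + d.1.2.1 + d.1.2.2 + 3) * W := by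
  rw [weight, card_ofStart, card_duplexIndices_ofStart, pow_one]
  congr 2
  ring

lemma weight_ofSimple (Q W : R) (d) :
    weight Q W (ofSimple d).1 = weight Q W d.1.1 * Q ^ (d.2.1 + 1) := by
  rw [weight, card_ofSimple, card_duplexIndices_ofSimple, weight]
  ring

lemma weight_ofDuplex (Q W : R) (d) : weight Q W (ofDuplex d).1 =
    weight Q W d.1.1 * (Q ^ (d.2.1.1 + d.2.1.2.1 + d.2.1.2.2 + 3) * W) := by
  rw [weight, card_ofDuplex, card_duplexIndices_ofDuplex, weight]
  ring

lemma weight_ofEnd (Q W : R) (d) : weight Q W (ofEnd d).1 =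
    weight Q W d.1.1 * (Q ^ (d.2.1.1 + d.2.1.2 + 2) * W) := by
  rw [weight, card_ofEnd, card_duplexIndices_ofEnd, weight]
  ring

variable [TopologicalSpace R]

/-- The sum of `f` over the sizes of the last columns of all polyominoes with a simplex last
column, weighted by area and duplex columns. -/
def moment (Q W : R) (f : ℕ → R) : R := ∑' P : SimplexEnded, weight Q W P.1 * f P.size

lemma QAdic.summable_weight {Q : R} (hQ : QAdic Q) (W : R) (f : ℕ → R) {ι : Type}
    {e : ι → SimplexEnded} (he : Function.Injective e) :
    Summable fun i => weight Q W (e i).1 * f (e i).size := by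
  refine hQ.summable (fun i => (e i).1.card)
    (fun n => (SimplexEnded.finite_card_le n).preimage he.injOn) fun i => ?_
  rw [weight, mul_assoc]
  exact dvd_mul_right _ _

lemma QAdic.hasSum_moment {Q : R} (hQ : QAdic Q) (W : R) (f : ℕ → R) :
    HasSum (fun P : SimplexEnded => weight Q W P.1 * f P.size) (moment Q W f) :=
  (hQ.summable_weight W f (e := id) Function.injective_id).hasSum

variable [IsTopologicalRing R]

lemma hasSum_of_decompose {F : SimplexEnded → R} {a₁ a₂ a₃ a₄ : R}
    (h₁ : HasSum (fun d => F (ofColumn d)) a₁) (h₂ : HasSum (fun d => F (ofStart d)) a₂)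
    (h₃ : HasSum (fun d => F (ofSimple d)) a₃) (h₄ : HasSum (fun d => F (ofDuplex d)) a₄) :
    HasSum F (a₁ + a₂ + (a₃ + a₄)) := by
  rw [← (Equiv.ofBijective _ decompose_bijective).hasSum_iff]
  exact HasSum.sum (HasSum.sum h₁ h₂) (HasSum.sum h₃ h₄)

variable [T2Space R] {Q W t v m : R}

lemma QAdic.hasSum_ofColumn (hQ : QAdic Q) (hv : v * (1 - Q * t) = 1) :
    HasSum (fun κ => weight Q W (ofColumn κ).1 * t ^ (ofColumn κ).size) (Q * v) := by
  refine ((hQ.hasSum_pow (dvd_mul_right Q t) hv).mul_left Q).congr_fun fun κ => ?_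
  rw [weight_ofColumn, size_ofColumn]
  ring

lemma QAdic.hasSum_geom (hQ : QAdic Q) (hm : m * (1 - Q) = 1) :
    HasSum (fun a : ℕ => Q ^ a) m := hQ.hasSum_pow dvd_rfl hm

lemma QAdic.hasSum_succ_mul_geom (hQ : QAdic Q) (hm : m * (1 - Q) = 1) :
    HasSum (fun a : ℕ => ((a : R) + 1) * Q ^ a) (m ^ 2) := by
  have h := (hQ.hasSum_id dvd_rfl hm).add (hQ.hasSum_geom hm)
  rw [show m ^ 2 = Q * m ^ 2 + m by linear_combination m * hm]
  refine h.congr_fun fun a => ?_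
  ring

lemma QAdic.hasSum_ofStart (hQ : QAdic Q) (hv : v * (1 - Q * t) = 1) (hm : m * (1 - Q) = 1) :
    HasSum (fun d => weight Q W (ofStart d).1 * t ^ (ofStart d).size)
      (W * Q ^ 3 * ((Q * t) ^ 2 * v ^ 3 * (m * m))) := by
  have hg := hQ.hasSum_geom hm
  have h := (hQ.hasSum_mul_mul (fun i => (pow_dvd_pow_of_dvd (dvd_mul_right Q t) i).mul_left _)
    (fun i => dvd_rfl) (fun i => dvd_rfl) (hQ.hasSum_choose_two (dvd_mul_right Q t) hv) hg
    hg).mul_left (W * Q ^ 3)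
  refine hasSum_sigma_finset (c := fun d : ℕ × ℕ × ℕ => Q ^ (d.1 + d.2.1 + d.2.2 + 3) * W *
    t ^ d.1) (hQ.summable_weight W _ ofStart_injective) (fun d x => ?_) (h.congr_fun fun d => ?_)
  · rw [weight_ofStart, size_ofStart]
  · rw [card_endPlacements]
    ring

/-- A segment of height `κ + 1` can be attached to one of height `s + 1` in `s + κ + 1` ways. -/
lemma QAdic.hasSum_ofSimple (hQ : QAdic Q) (hv : v * (1 - Q * t) = 1) :
    HasSum (fun d => weight Q W (ofSimple d).1 * t ^ (ofSimple d).size)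
      (Q * v * moment Q W (fun s => (s : R)) + Q * v ^ 2 * moment Q W (fun _ => 1)) := by
  have h := ((hQ.hasSum_moment W fun s => (s : R)).mul_left (Q * v)).add
    ((hQ.hasSum_moment W fun _ => 1).mul_left (Q * v ^ 2))
  refine h.sigma_of_hasSum (fun P => ?_) (hQ.summable_weight W _ ofSimple_injective)
  refine hasSum_sigma_finset (c := fun κ : ℕ => weight Q W P.1 * Q ^ (κ + 1) * t ^ κ)
    (hQ.summable_weight W _ (ofSimple_injective.comp sigma_mk_injective)) (fun κ x => ?_) ?_
  · rw [weight_ofSimple, size_ofSimple]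
  · have h1 := ((hQ.hasSum_id (dvd_mul_right Q t) hv).add
      ((hQ.hasSum_pow (dvd_mul_right Q t) hv).mul_left ((P.size : R) + 1))).mul_left
      (weight Q W P.1 * Q)
    rw [show Q * v * (weight Q W P.1 * (P.size : R)) + Q * v ^ 2 * (weight Q W P.1 * 1) =
      weight Q W P.1 * Q * (Q * t * v ^ 2 + ((P.size : R) + 1) * v) by
        linear_combination (weight Q W P.1 * Q * v) * hv]
    refine h1.congr_fun fun κ => ?_
    rw [Int.card_Ioo, show ((κ : ℤ) + 1 - -((P.size : ℤ) + 1) - 1).toNat = P.size + κ + 1 by omega]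
    push_cast
    ring

lemma QAdic.hasSum_card_duplexPlacements (hQ : QAdic Q) (hv : v * (1 - Q * t) = 1)
    (hm : m * (1 - Q) = 1) (s : ℕ) :
    HasSum (fun d : ℕ × ℕ × ℕ => ((duplexPlacements s d.1 d.2.1 d.2.2).card : R) *
      (Q ^ (d.1 + d.2.1 + d.2.2) * t ^ d.1))
      (2 * (s.choose 2) * v * m ^ 3 + 2 * (s.choose 2) * (Q * t) * v ^ 2 * m ^ 2 +
        2 * (Q * t) ^ 2 * v ^ 3 * m ^ 3 + 2 * s * (Q * t) ^ 2 * v ^ 3 * m ^ 2 -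
        3 * ((Q * t) ^ 2 * v ^ 4 * (s * (1 - Q * t) - 1 + (Q * t) ^ s)) * m ^ 2) := by
  have hu := dvd_mul_right Q t
  have hu' : ∀ i, Q ^ i ∣ (Q * t) ^ i := fun i => pow_dvd_pow_of_dvd hu i
  have g0 := hQ.hasSum_geom hm
  have g1 := hQ.hasSum_succ_mul_geom hm
  have d0 : ∀ i : ℕ, Q ^ i ∣ Q ^ i := fun i => dvd_rfl
  have d1 : ∀ i : ℕ, Q ^ i ∣ ((i : R) + 1) * Q ^ i := fun i => dvd_mul_left _ _
  have t0 := hQ.hasSum_pow hu hv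
  have t1 := hQ.hasSum_id hu hv
  have t2 := hQ.hasSum_choose_two hu hv
  have t3 := hQ.hasSum_gapSum hu hv s
  have e1 := (hQ.hasSum_mul_mul hu' d1 d0 t0 g1 g0).add (hQ.hasSum_mul_mul hu' d0 d1 t0 g0 g1)
  have e2 := hQ.hasSum_mul_mul (fun i => (hu' i).mul_left _) d0 d0 t1 g0 g0
  have e3 := (hQ.hasSum_mul_mul (fun i => (hu' i).mul_left _) d1 d0 t2 g1 g0).add
    (hQ.hasSum_mul_mul (fun i => (hu' i).mul_left _) d0 d1 t2 g0 g1)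
  have e4 := hQ.hasSum_mul_mul (fun i => (hu' i).mul_left _) d0 d0 t2 g0 g0
  have e5 := hQ.hasSum_mul_mul (fun i => (hu' i).mul_left _) d0 d0 t3 g0 g0
  have h := ((((e1.mul_left (s.choose 2 : R)).add (e2.mul_left (2 * (s.choose 2 : R)))).add
    e3).add (e4.mul_left (2 * (s : R)))).sub (e5.mul_left 3)
  refine hasSum_of_eq h ?_ fun d => ?_
  · ring
  · have := congrArg (Nat.cast (R := R)) (card_duplexPlacements s d.1 d.2.1 d.2.2)
    push_cast at this
    rw [eq_sub_of_add_eq this]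
    ring

lemma QAdic.hasSum_ofDuplex (hQ : QAdic Q) (hv : v * (1 - Q * t) = 1) (hm : m * (1 - Q) = 1) :
    HasSum (fun d => weight Q W (ofDuplex d).1 * t ^ (ofDuplex d).size)
      (W * Q ^ 3 * ((2 * v * m ^ 3 + 2 * (Q * t) * v ^ 2 * m ^ 2) *
          moment Q W (fun s => (s.choose 2 : R)) +
        (2 * (Q * t) ^ 2 * v ^ 3 * m ^ 3 + 3 * (Q * t) ^ 2 * v ^ 4 * m ^ 2) *
          moment Q W (fun _ => 1) -
        (Q * t) ^ 2 * v ^ 3 * m ^ 2 * moment Q W (fun s => (s : R)) -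
        3 * (Q * t) ^ 2 * v ^ 4 * m ^ 2 * moment Q W (fun s => (Q * t) ^ s))) := by
  have h := (((((hQ.hasSum_moment W fun s => (s.choose 2 : R)).mul_left
    (2 * v * m ^ 3 + 2 * (Q * t) * v ^ 2 * m ^ 2)).add
    ((hQ.hasSum_moment W fun _ => 1).mul_left
      (2 * (Q * t) ^ 2 * v ^ 3 * m ^ 3 + 3 * (Q * t) ^ 2 * v ^ 4 * m ^ 2))).sub
    ((hQ.hasSum_moment W fun s => (s : R)).mul_left ((Q * t) ^ 2 * v ^ 3 * m ^ 2))).sub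
    ((hQ.hasSum_moment W fun s => (Q * t) ^ s).mul_left
      (3 * (Q * t) ^ 2 * v ^ 4 * m ^ 2))).mul_left (W * Q ^ 3)
  refine h.sigma_of_hasSum (fun P => ?_) (hQ.summable_weight W _ ofDuplex_injective)
  refine hasSum_sigma_finset (c := fun d : ℕ × ℕ × ℕ =>
      weight Q W P.1 * (Q ^ (d.1 + d.2.1 + d.2.2 + 3) * W) * t ^ d.1)
    (hQ.summable_weight W _ (ofDuplex_injective.comp sigma_mk_injective)) (fun d x => ?_) ?_
  · rw [weight_ofDuplex, size_ofDuplex]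
  · have h1 := (hQ.hasSum_card_duplexPlacements hv hm P.size).mul_left
      (weight Q W P.1 * (W * Q ^ 3))
    refine hasSum_of_eq h1 ?_ fun d => ?_
    · linear_combination
        -(3 * weight Q W P.1 * W * Q ^ 3 * (Q * t) ^ 2 * v ^ 3 * P.size * m ^ 2) * hv
    · ring

/-- The functional equation for the series `∑ weight P * t ^ size P`. The moments of order at most
two come from the numbers of ways to attach new columns to a last column of a given size; the value
at `Q * t` comes from the bounded gaps of a duplex column between two segments. -/
lemma QAdic.functional_equation (hQ : QAdic Q) (hv : v * (1 - Q * t) = 1)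
    (hm : m * (1 - Q) = 1) {A B C : R} (hA : moment Q W (fun _ => 1) = A)
    (hB : moment Q W (fun s => (s : R)) = B) (hC : moment Q W (fun s => (s.choose 2 : R)) = C) :
    moment Q W (fun s => t ^ s) =
      Q * v * (1 + B + W * Q ^ 2 * m ^ 2 * C * (2 * m - 2)) +
      Q * v ^ 2 * (A + 2 * (W * Q ^ 2 * m ^ 2) * C) +
      W * Q ^ 3 * m ^ 2 * (Q * t) ^ 2 * v ^ 3 * (1 + 2 * m * A - B) +
      3 * (W * Q ^ 3 * m ^ 2 * (Q * t) ^ 2 * v ^ 4) * A -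
      3 * (W * Q ^ 3 * m ^ 2 * (Q * t) ^ 2 * v ^ 4) * moment Q W (fun s => (Q * t) ^ s) := by
  have h := (hQ.hasSum_moment W fun s => t ^ s).unique (hasSum_of_decompose
    (hQ.hasSum_ofColumn hv) (hQ.hasSum_ofStart hv hm) (hQ.hasSum_ofSimple hv)
    (hQ.hasSum_ofDuplex hv hm))
  rw [h, hA, hB, hC]
  linear_combination (-(2 * W * Q ^ 3 * m ^ 2 * C * v)) * hv

lemma QAdic.hasSum_ofEnd (hQ : QAdic Q) (hm : m * (1 - Q) = 1) :
    HasSum (fun d => weight Q W (ofEnd d).1)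
      (W * Q ^ 2 * m ^ 2 * moment Q W (fun s => (s.choose 2 : R))) := by
  have hinj : Function.Injective fun d => (Sum.inr (ofEnd d) : Normal) :=
    Sum.inr_injective.comp ofEnd_bijective.1
  have hs : Summable fun d => weight Q W (ofEnd d).1 := by
    refine hQ.summable (fun d => (ofEnd d).1.card)
      (fun n => (Normal.finite_card_le n).preimage hinj.injOn) fun d => ?_
    exact dvd_mul_right _ _
  have h := (hQ.hasSum_moment W fun s => (s.choose 2 : R)).mul_left (W * Q ^ 2 * m ^ 2)
  refine h.sigma_of_hasSum (fun P => ?_) hs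
  have hsP : Summable fun d => weight Q W (ofEnd ⟨P, d⟩).1 := by
    refine hQ.summable (fun d => (ofEnd ⟨P, d⟩).1.card)
      (fun n => (Normal.finite_card_le n).preimage (hinj.comp sigma_mk_injective).injOn)
      fun d => ?_
    exact dvd_mul_right _ _
  refine hasSum_sigma_finset (c := fun d : ℕ × ℕ => weight Q W P.1 * (Q ^ (d.1 + d.2 + 2) * W))
    hsP (fun d x => weight_ofEnd Q W _) ?_
  have hg := hQ.hasSum_geom hm
  refine hasSum_of_eq ((hQ.hasSum_mul (fun _ => dvd_rfl) (fun _ => dvd_rfl) hg hg).mul_left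
    (weight Q W P.1 * (P.size.choose 2 : R) * (W * Q ^ 2))) (by ring) fun d => ?_
  rw [card_endPlacements]
  ring

end FunctionalEquation

/-! ### Iterating the functional equation -/

lemma qAdic_q : QAdic (q : Ser) := by
  intro ι F r hr h
  rw [MvPowerSeries.WithPiTopology.summable_iff_summable_coeff]
  intro e
  refine summable_of_hasFiniteSupport ((hr (e 0)).subset fun i hi => ?_)
  by_contra hlt
  exact hi (MvPowerSeries.X_pow_dvd_iff.1 (h i) e (not_le.1 hlt))

lemma qAdic_C_q : QAdic (PowerSeries.C q : PowerSeries Ser) := by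
  intro ι F r hr h
  rw [PowerSeries.WithPiTopology.summable_iff_summable_coeff]
  intro n
  refine qAdic_q.summable r hr fun i => ?_
  obtain ⟨g, hg⟩ := h i
  rw [hg, ← map_pow, PowerSeries.coeff_C_mul]
  exact dvd_mul_right _ _

lemma pow_dvd_prod_range {R : Type*} [CommRing R] {Q : R} {K : ℕ → R} (hK : ∀ i, Q ∣ K i) (i : ℕ) :
    Q ^ i ∣ ∏ j ∈ Finset.range i, K j := by
  have := Finset.prod_dvd_prod_of_dvd (s := Finset.range i) (fun _ => Q) K fun j _ => hK j
  rwa [Finset.prod_const, Finset.card_range] at this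

/-- The solution of the recursion `Φ i = s i + K i * Φ (i + 1)`. -/
lemma QAdic.hasSum_iterate {R : Type*} [CommRing R] [TopologicalSpace R] [IsTopologicalRing R]
    [T2Space R] {Q : R} (hQ : QAdic Q) {Φ K s : ℕ → R} (hK : ∀ i, Q ∣ K i)
    (h : ∀ i, Φ i = s i + K i * Φ (i + 1)) :
    HasSum (fun i => (∏ j ∈ Finset.range i, K j) * s i) (Φ 0) := by
  have hs : Summable fun i => (∏ j ∈ Finset.range i, K j) * Φ i :=
    hQ.summable_nat fun i => (pow_dvd_prod_range hK i).mul_right _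
  have h1 := hs.hasSum.sub ((hasSum_nat_add_iff' 1).2 hs.hasSum)
  refine hasSum_of_eq h1 (by simp) fun i => ?_
  rw [Finset.prod_range_succ, h i]
  ring

/-- The first three coefficients of `X` are those of `x * exp (F * T + S * T ^ 2 / 2)`: `F` and `S` are
the first two derivatives at `0` of `log X`. Hence `x` is multiplicative in `X`, and `F` and `S` are
additive. -/
structure IsJet (X : PowerSeries Ser) (x F S : Ser) : Prop where
  coeff_zero : PowerSeries.coeff 0 X = x
  coeff_one : PowerSeries.coeff 1 X = x * F
  two_mul_coeff_two : 2 * PowerSeries.coeff 2 X = x * (F ^ 2 + S)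

lemma IsJet.mul {X Y : PowerSeries Ser} {x F S y F' S' : Ser} (h : IsJet X x F S)
    (h' : IsJet Y y F' S') : IsJet (X * Y) (x * y) (F + F') (S + S') := by
  obtain ⟨a0, a1, a2⟩ := h
  obtain ⟨b0, b1, b2⟩ := h'
  refine ⟨?_, ?_, ?_⟩
  · rw [PowerSeries.coeff_mul, Finset.Nat.antidiagonal_zero, Finset.sum_singleton, a0, b0]
  · rw [PowerSeries.coeff_mul, Finset.Nat.sum_antidiagonal_eq_sum_range_succ_mk,
      Finset.sum_range_succ, Finset.sum_range_one]
    simp only [Nat.sub_zero, Nat.sub_self, a0, a1, b0, b1]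
    ring
  · rw [PowerSeries.coeff_mul, Finset.Nat.sum_antidiagonal_eq_sum_range_succ_mk,
      Finset.sum_range_succ, Finset.sum_range_succ, Finset.sum_range_one]
    simp only [Nat.sub_zero, Nat.sub_self, a0, a1, b0, b1, show 2 - 1 = 1 from rfl]
    linear_combination x * b2 + y * a2

lemma isJet_C (x : Ser) : IsJet (PowerSeries.C x) x 0 0 := by
  refine ⟨by simp, ?_, ?_⟩
  · rw [PowerSeries.coeff_C]; simp
  · rw [PowerSeries.coeff_C]; simp

lemma isJet_one : IsJet 1 1 0 0 := by
  have := isJet_C 1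
  rwa [map_one] at this

lemma IsJet.pow {X : PowerSeries Ser} {x F S : Ser} (h : IsJet X x F S) (n : ℕ) :
    IsJet (X ^ n) (x ^ n) (n * F) (n * S) := by
  induction n with
  | zero => simpa using isJet_one
  | succ n ih =>
    have := ih.mul h
    rw [pow_succ, pow_succ]
    convert this using 1 <;> push_cast <;> ring

lemma isJet_one_add_X : IsJet (1 + PowerSeries.X) 1 1 (-1) := by
  refine ⟨by simp, ?_, ?_⟩
  · simp [PowerSeries.coeff_one]
  · simp [PowerSeries.coeff_one, PowerSeries.coeff_X]

/-- The series `1 / (1 - q ^ k)`. -/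
def geo (k : ℕ) : Ser := (1 - q ^ k)⁻¹

lemma constantCoeff_one_sub_q_pow {k : ℕ} (hk : 1 ≤ k) :
    MvPowerSeries.constantCoeff (1 - q ^ k : Ser) = 1 := by
  rw [map_sub, map_one, map_pow, q, MvPowerSeries.constantCoeff_X, zero_pow (by omega), sub_zero]

lemma geo_mul {k : ℕ} (hk : 1 ≤ k) : geo k * (1 - q ^ k) = 1 := by
  rw [geo, MvPowerSeries.inv_mul_cancel]
  rw [constantCoeff_one_sub_q_pow hk]
  exact one_ne_zero

/-- The series `1 / (1 - q ^ k * (1 + X))`. -/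
def geoJet (k : ℕ) : PowerSeries Ser := PowerSeries.mk fun n => geo k * (q ^ k * geo k) ^ n

lemma isJet_geoJet (k : ℕ) : IsJet (geoJet k) (geo k) (q ^ k * geo k) ((q ^ k * geo k) ^ 2) := by
  refine ⟨?_, ?_, ?_⟩
  · rw [geoJet, PowerSeries.coeff_mk, pow_zero, mul_one]
  · rw [geoJet, PowerSeries.coeff_mk, pow_one]
  · rw [geoJet, PowerSeries.coeff_mk]
    ring

lemma geoJet_mul {k : ℕ} (hk : 1 ≤ k) :
    geoJet k * (1 - PowerSeries.C q ^ k * (1 + PowerSeries.X)) = 1 := by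
  have hg := geo_mul hk
  have : geoJet k * (1 - PowerSeries.C q ^ k * (1 + PowerSeries.X)) =
      PowerSeries.C (1 - q ^ k) * geoJet k - PowerSeries.C (q ^ k) * (geoJet k * PowerSeries.X) := by
    rw [map_sub, map_one, map_pow]
    ring
  rw [this]
  ext1 n
  rw [map_sub, PowerSeries.coeff_C_mul, PowerSeries.coeff_C_mul]
  rcases n with _ | n
  · rw [PowerSeries.coeff_zero_mul_X, geoJet, PowerSeries.coeff_mk, PowerSeries.coeff_zero_one]
    linear_combination hg
  · rw [PowerSeries.coeff_succ_mul_X, geoJet, PowerSeries.coeff_mk, PowerSeries.coeff_mk,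
      PowerSeries.coeff_one, if_neg (by omega), pow_succ]
    linear_combination (q ^ k * geo k * (q ^ k * geo k) ^ n) * hg

/-- The factor that the functional equation at `q ^ i * (1 + X)` gives to the series at
`q ^ (i + 1) * (1 + X)`. -/
def kernelJet (i : ℕ) : PowerSeries Ser :=
  PowerSeries.C (-3 * (w * q ^ 3 * geo 1 ^ 2) * q ^ (2 * (i + 1))) *
    ((1 + PowerSeries.X) ^ 2 * geoJet (i + 1) ^ 4)

lemma C_q_dvd_kernelJet (i : ℕ) : PowerSeries.C q ∣ kernelJet i := by
  rw [kernelJet]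
  refine Dvd.dvd.mul_right (map_dvd _ ⟨-3 * (w * q ^ 2 * geo 1 ^ 2) * q ^ (2 * (i + 1)), ?_⟩) _
  ring

/-- The value at `X = 0` of the product of the first `i` factors. -/
def kernel (i : ℕ) : Ser := (-3) ^ i * w ^ i * q ^ (i ^ 2 + 4 * i) * geo 1 ^ (2 * i) *
  (∏ k ∈ Finset.Ico 1 (i + 1), geo k) ^ 4

lemma isJet_kernelJet (i : ℕ) : IsJet (kernelJet i)
    (-3 * (w * q ^ 3 * geo 1 ^ 2) * q ^ (2 * (i + 1)) * geo (i + 1) ^ 4)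
    (2 + 4 * (q ^ (i + 1) * geo (i + 1))) (-2 + 4 * (q ^ (i + 1) * geo (i + 1)) ^ 2) := by
  have := (isJet_C (-3 * (w * q ^ 3 * geo 1 ^ 2) * q ^ (2 * (i + 1)))).mul
    ((isJet_one_add_X.pow 2).mul ((isJet_geoJet (i + 1)).pow 4))
  rw [kernelJet]
  convert this using 1 <;> push_cast <;> ring

lemma isJet_prod_kernelJet (i : ℕ) : IsJet (∏ j ∈ Finset.range i, kernelJet j) (kernel i)
    (2 * i + 4 * ∑ k ∈ Finset.Ico 1 (i + 1), q ^ k * geo k)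
    (-2 * i + 4 * ∑ k ∈ Finset.Ico 1 (i + 1), (q ^ k * geo k) ^ 2) := by
  induction i with
  | zero => simpa [kernel] using isJet_one
  | succ i ih =>
    rw [Finset.prod_range_succ]
    convert ih.mul (isJet_kernelJet i) using 1
    · rw [kernel, kernel, Finset.prod_Ico_succ_top (by omega)]
      ring
    · rw [Finset.sum_Ico_succ_top (by omega)]
      push_cast
      ring
    · rw [Finset.sum_Ico_succ_top (by omega)]
      push_cast
      ring

/-- At the argument `1 + X` the generating function of the sizes encodes the binomial moments. -/
lemma coeff_moment (n : ℕ) : PowerSeries.coeff n (moment (PowerSeries.C q)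
    (PowerSeries.C w) fun s => (1 + PowerSeries.X) ^ s) =
      moment q w fun s => (s.choose n : Ser) := by
  have h := (qAdic_C_q.hasSum_moment (PowerSeries.C w)
    fun s => (1 + PowerSeries.X : PowerSeries Ser) ^ s).map (PowerSeries.coeff n)
    (PowerSeries.WithPiTopology.continuous_coeff Ser n)
  refine h.unique (hasSum_of_eq (qAdic_q.hasSum_moment w fun s => (s.choose n : Ser)) rfl
    fun P => ?_)
  simp only [Function.comp, weight, ← map_pow, ← map_mul, PowerSeries.coeff_C_mul]
  have : (1 + PowerSeries.X : PowerSeries Ser) ^ P.size =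
      (((1 + Polynomial.X) ^ P.size : Polynomial Ser) : PowerSeries Ser) := by simp
  rw [this, Polynomial.coeff_coe, Polynomial.coeff_one_add_X_pow]

lemma moment_C (f : ℕ → Ser) : moment (PowerSeries.C q) (PowerSeries.C w)
    (fun s => PowerSeries.C (f s)) = PowerSeries.C (moment q w f) := by
  refine (qAdic_C_q.hasSum_moment (PowerSeries.C w) _).unique
    (hasSum_of_eq ((qAdic_q.hasSum_moment w f).map PowerSeries.C
      PowerSeries.WithPiTopology.continuous_C) rfl fun P => ?_)
  simp [weight]

/-- The moments of the sizes of the last columns in terms of the four series into which the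
solution of the functional equation splits. -/
lemma moment_one_add_X {A B D : Ser} (hA : moment q w (fun _ => 1) = A)
    (hB : moment q w (fun s => (s : Ser)) = B)
    (hD : moment q w (fun s => (s.choose 2 : Ser)) = D) :
    HasSum (fun i => (∏ j ∈ Finset.range i, kernelJet j) *
      (PowerSeries.C (1 + B + w * q ^ 2 * geo 1 ^ 2 * D * (2 * geo 1 - 2)) *
          (PowerSeries.C q * geoJet (i + 1)) +
        PowerSeries.C (A + 2 * (w * q ^ 2 * geo 1 ^ 2) * D) *
          (PowerSeries.C q * geoJet (i + 1) ^ 2) +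
        PowerSeries.C (1 + 2 * geo 1 * A - B) *
          (PowerSeries.C (w * q ^ 3 * geo 1 ^ 2 * q ^ (2 * (i + 1))) *
            ((1 + PowerSeries.X) ^ 2 * geoJet (i + 1) ^ 3)) -
        PowerSeries.C A * kernelJet i))
      (moment (PowerSeries.C q) (PowerSeries.C w) fun s => (1 + PowerSeries.X) ^ s) := by
  have h := qAdic_C_q.hasSum_iterate (K := kernelJet)
    (Φ := fun i => moment (PowerSeries.C q) (PowerSeries.C w)
      fun s => (PowerSeries.C q ^ i * (1 + PowerSeries.X)) ^ s)
    (s := fun i => (PowerSeries.C (1 + B + w * q ^ 2 * geo 1 ^ 2 * D * (2 * geo 1 - 2)) *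
          (PowerSeries.C q * geoJet (i + 1)) +
        PowerSeries.C (A + 2 * (w * q ^ 2 * geo 1 ^ 2) * D) *
          (PowerSeries.C q * geoJet (i + 1) ^ 2) +
        PowerSeries.C (1 + 2 * geo 1 * A - B) *
          (PowerSeries.C (w * q ^ 3 * geo 1 ^ 2 * q ^ (2 * (i + 1))) *
            ((1 + PowerSeries.X) ^ 2 * geoJet (i + 1) ^ 3)) -
        PowerSeries.C A * kernelJet i)) ?_ ?_
  · simpa only [pow_zero, one_mul] using h
  · exact C_q_dvd_kernelJet
  · intro i
    have hv : geoJet (i + 1) *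
        (1 - PowerSeries.C q * (PowerSeries.C q ^ i * (1 + PowerSeries.X))) = 1 := by
      rw [← mul_assoc, ← pow_succ']
      exact geoJet_mul (by omega)
    have hm : PowerSeries.C (geo 1) * (1 - PowerSeries.C q) = (1 : PowerSeries Ser) := by
      rw [← map_one PowerSeries.C, ← map_sub, ← map_mul]
      have := geo_mul (le_refl 1)
      rw [pow_one] at this
      rw [this]
    have hA' : moment (PowerSeries.C q) (PowerSeries.C w) (fun _ => (1 : PowerSeries Ser)) =
        PowerSeries.C A := by
      rw [← hA, ← moment_C]
      simp only [map_one]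
    have hB' : moment (PowerSeries.C q) (PowerSeries.C w) (fun s => (s : PowerSeries Ser)) =
        PowerSeries.C B := by
      rw [← hB, ← moment_C]
      simp only [map_natCast]
    have hD' : moment (PowerSeries.C q) (PowerSeries.C w)
        (fun s => (s.choose 2 : PowerSeries Ser)) = PowerSeries.C D := by
      rw [← hD, ← moment_C]
      simp only [map_natCast]
    rw [qAdic_C_q.functional_equation hv hm hA' hB' hD']
    simp only [← mul_assoc (PowerSeries.C q), ← pow_succ']
    simp only [kernelJet, map_add, map_mul, map_sub, map_pow, map_one, map_neg, map_ofNat]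
    ring

/-! ### The twelve series as coefficients -/

lemma inv_pow_eq_geo {k : ℕ} (hk : 1 ≤ k) : ((1 - q ^ k : Ser) ^ 2)⁻¹ = geo k ^ 2 := by
  symm
  rw [MvPowerSeries.eq_inv_iff_mul_eq_one, ← mul_pow, geo_mul hk, one_pow]
  rw [map_pow, constantCoeff_one_sub_q_pow hk, one_pow]
  exact one_ne_zero

lemma inv_denominator (a m i : ℕ) (hi : 1 ≤ i) :
    ((1 - q : Ser) ^ a * (∏ k ∈ Finset.Ico 1 i, (1 - q ^ k)) ^ 4 * (1 - q ^ i) ^ m)⁻¹ =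
      geo 1 ^ a * (∏ k ∈ Finset.Ico 1 i, geo k) ^ 4 * geo i ^ m := by
  have h1 : geo 1 * (1 - q) = 1 := by simpa using geo_mul (le_refl 1)
  have h2 : (∏ k ∈ Finset.Ico 1 i, geo k) * ∏ k ∈ Finset.Ico 1 i, (1 - q ^ k) = 1 := by
    rw [← Finset.prod_mul_distrib]
    exact Finset.prod_eq_one fun k hk => geo_mul (Finset.mem_Ico.1 hk).1
  have c1 : MvPowerSeries.constantCoeff (1 - q : Ser) = 1 := by
    simpa using constantCoeff_one_sub_q_pow (le_refl 1)
  symm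
  rw [MvPowerSeries.eq_inv_iff_mul_eq_one]
  · calc _ = (geo 1 * (1 - q)) ^ a * ((∏ k ∈ Finset.Ico 1 i, geo k) *
          ∏ k ∈ Finset.Ico 1 i, (1 - q ^ k)) ^ 4 * (geo i * (1 - q ^ i)) ^ m := by
            rw [mul_pow (geo 1), mul_pow (∏ k ∈ Finset.Ico 1 i, geo k), mul_pow (geo i)]
            ring
      _ = 1 := by rw [h1, h2, geo_mul hi]; simp
  · rw [map_mul, map_mul, map_pow, map_pow, map_pow, map_prod, c1, constantCoeff_one_sub_q_pow hi,
      Finset.prod_congr rfl fun k hk => constantCoeff_one_sub_q_pow (Finset.mem_Ico.1 hk).1]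
    simp

lemma factor₁_succPNat (c m n : ℕ) : factor₁ c m n.succPNat =
    c + 4 * ∑ k ∈ Finset.Ico 1 (n + 1), q ^ k * geo k + m * (q ^ (n + 1) * geo (n + 1)) := by
  rw [factor₁, Nat.succPNat_coe, Nat.succ_eq_add_one, mul_assoc (m : Ser)]
  rfl

lemma factor₂_succPNat (c m n : ℕ) : factor₂ c m n.succPNat = factor₁ c m n.succPNat ^ 2 +
    (-c + 4 * ∑ k ∈ Finset.Ico 1 (n + 1), (q ^ k * geo k) ^ 2 +
      m * (q ^ (n + 1) * geo (n + 1)) ^ 2) := by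
  rw [factor₂, Nat.succPNat_coe, Nat.succ_eq_add_one, inv_pow_eq_geo (by omega),
    Finset.sum_congr rfl fun k hk => by
      rw [inv_pow_eq_geo (Finset.mem_Ico.1 hk).1, mul_comm 2 k, pow_mul, ← mul_pow]]
  ring

/-- The terms of the series `alpha` and `beta` are values of the terms of the iteration, and the
two factors describe their derivatives. -/
lemma isJet_baseA (m n : ℕ) :
    IsJet ((∏ j ∈ Finset.range n, kernelJet j) * (PowerSeries.C q * geoJet (n + 1) ^ m))
      (baseA m n.succPNat) (factor₁ (2 * (n.succPNat : ℕ) - 2) m n.succPNat)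
      (factor₂ (2 * (n.succPNat : ℕ) - 2) m n.succPNat -
        factor₁ (2 * (n.succPNat : ℕ) - 2) m n.succPNat ^ 2) := by
  have h := (isJet_prod_kernelJet n).mul ((isJet_C q).mul ((isJet_geoJet (n + 1)).pow m))
  have e : 2 * (n + 1) - 2 = 2 * n := by omega
  rw [factor₂_succPNat, factor₁_succPNat]
  simp only [Nat.succPNat_coe, Nat.succ_eq_add_one, e]
  convert h using 1
  · rw [baseA, Nat.succPNat_coe, Nat.succ_eq_add_one, inv_denominator _ _ _ (by omega), e, kernel,
      show (n + 1) ^ 2 + 2 * (n + 1) - 2 = n ^ 2 + 4 * n + 1 by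
        have : (n + 1) ^ 2 + 2 * (n + 1) = n ^ 2 + 4 * n + 1 + 2 := by ring
        omega, Nat.add_sub_cancel]
    ring
  · push_cast
    ring
  · push_cast
    ring

/-- The corresponding statement for the series `gamma` and `delta`. -/
lemma isJet_baseC {Y : PowerSeries Ser} {m s n : ℕ} {z : Ser}
    (hY : Y = PowerSeries.C (z * (w * q ^ 3 * geo 1 ^ 2) * q ^ (2 * (n + 1))) *
      ((1 + PowerSeries.X) ^ 2 * geoJet (n + 1) ^ m)) (hz : (-3) ^ n * z = (-3) ^ s) :
    IsJet ((∏ j ∈ Finset.range n, kernelJet j) * Y)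
      (baseC m s n.succPNat) (factor₁ (2 * (n.succPNat : ℕ)) m n.succPNat)
      (factor₂ (2 * (n.succPNat : ℕ)) m n.succPNat -
        factor₁ (2 * (n.succPNat : ℕ)) m n.succPNat ^ 2) := by
  have h := (isJet_prod_kernelJet n).mul ((isJet_C (z * (w * q ^ 3 * geo 1 ^ 2) *
    q ^ (2 * (n + 1)))).mul ((isJet_one_add_X.pow 2).mul ((isJet_geoJet (n + 1)).pow m)))
  rw [factor₂_succPNat, factor₁_succPNat, hY]
  simp only [Nat.succPNat_coe, Nat.succ_eq_add_one]
  convert h using 1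
  · rw [baseC, Nat.succPNat_coe, Nat.succ_eq_add_one, inv_denominator _ _ _ (by omega), kernel,
      ← hz]
    ring
  · push_cast
    ring
  · push_cast
    ring

lemma hasSum_of_isJet {X : ℕ → PowerSeries Ser} {x F H : ℕ+ → Ser} {Y : PowerSeries Ser}
    (hX : ∀ n, IsJet (X n) (x n.succPNat) (F n.succPNat) (H n.succPNat - F n.succPNat ^ 2))
    (h : HasSum X Y) : HasSum x (PowerSeries.coeff 0 Y) ∧
      HasSum (fun i => x i * F i) (PowerSeries.coeff 1 Y) ∧
      HasSum (fun i => x i * H i) (2 * PowerSeries.coeff 2 Y) := by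
  have hc := fun j => h.map (PowerSeries.coeff j) (PowerSeries.WithPiTopology.continuous_coeff Ser j)
  refine ⟨?_, ?_, ?_⟩ <;> rw [← Equiv.pnatEquivNat.symm.hasSum_iff]
  · exact hasSum_of_eq (hc 0) rfl fun n => (hX n).coeff_zero.symm
  · exact hasSum_of_eq (hc 1) rfl fun n => (hX n).coeff_one.symm
  · refine hasSum_of_eq ((hc 2).mul_left 2) rfl fun n => ?_
    have := (hX n).two_mul_coeff_two
    rw [add_sub_cancel] at this
    exact this.symm

/-- The summands of the iteration that carry `alpha` (`m = 1`) and `beta` (`m = 2`). -/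
def jetA (m n : ℕ) : PowerSeries Ser :=
  (∏ j ∈ Finset.range n, kernelJet j) * (PowerSeries.C q * geoJet (n + 1) ^ m)

/-- The summands of the iteration that carry `gamma`. -/
def jetC (n : ℕ) : PowerSeries Ser :=
  (∏ j ∈ Finset.range n, kernelJet j) *
    (PowerSeries.C (w * q ^ 3 * geo 1 ^ 2 * q ^ (2 * (n + 1))) *
      ((1 + PowerSeries.X) ^ 2 * geoJet (n + 1) ^ 3))

/-- The summands of the iteration that carry `delta`. -/
def jetD (n : ℕ) : PowerSeries Ser := (∏ j ∈ Finset.range n, kernelJet j) * kernelJet n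

lemma summable_prod_kernelJet_mul (Y : ℕ → PowerSeries Ser) :
    Summable fun n => (∏ j ∈ Finset.range n, kernelJet j) * Y n :=
  qAdic_C_q.summable_nat fun n => (pow_dvd_prod_range C_q_dvd_kernelJet n).mul_right _

lemma hasSum_baseA (m : ℕ) :
    HasSum (fun i : ℕ+ => baseA m i) (PowerSeries.coeff 0 (∑' n, jetA m n)) ∧
      HasSum (fun i : ℕ+ => baseA m i * factor₁ (2 * (i : ℕ) - 2) m i)
        (PowerSeries.coeff 1 (∑' n, jetA m n)) ∧
      HasSum (fun i : ℕ+ => baseA m i * factor₂ (2 * (i : ℕ) - 2) m i)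
        (2 * PowerSeries.coeff 2 (∑' n, jetA m n)) :=
  hasSum_of_isJet (isJet_baseA m) (summable_prod_kernelJet_mul _).hasSum

lemma hasSum_baseC : HasSum gammaTerm (PowerSeries.coeff 0 (∑' n, jetC n)) ∧
    HasSum etaTerm (PowerSeries.coeff 1 (∑' n, jetC n)) ∧
    HasSum lambdaTerm (2 * PowerSeries.coeff 2 (∑' n, jetC n)) :=
  hasSum_of_isJet (x := gammaTerm) (F := fun i => factor₁ (2 * (i : ℕ)) 3 i)
    (H := fun i => factor₂ (2 * (i : ℕ)) 3 i)
    (fun n => isJet_baseC (z := 1) (by rw [one_mul]) (by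
      rw [mul_one, Nat.succPNat_coe, Nat.succ_eq_add_one, Nat.add_sub_cancel]))
    (summable_prod_kernelJet_mul _).hasSum

lemma hasSum_baseD : HasSum deltaTerm (PowerSeries.coeff 0 (∑' n, jetD n)) ∧
    HasSum thetaTerm (PowerSeries.coeff 1 (∑' n, jetD n)) ∧
    HasSum muTerm (2 * PowerSeries.coeff 2 (∑' n, jetD n)) :=
  hasSum_of_isJet (x := deltaTerm) (F := fun i => factor₁ (2 * (i : ℕ)) 4 i)
    (H := fun i => factor₂ (2 * (i : ℕ)) 4 i)
    (fun n => isJet_baseC (z := -3) rfl (by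
      rw [Nat.succPNat_coe, Nat.succ_eq_add_one, pow_succ]))
    (summable_prod_kernelJet_mul _).hasSum

lemma C_half_mul_two (x : Ser) : MvPowerSeries.C (1 / 2 : ℚ) * (2 * x) = x := by
  rw [← mul_assoc, show (2 : Ser) = MvPowerSeries.C (2 : ℚ) from (map_ofNat _ 2).symm, ← map_mul]
  norm_num

lemma coeff_tsum_jet_one : PowerSeries.coeff 0 (∑' n, jetA 1 n) = alpha ∧
    PowerSeries.coeff 1 (∑' n, jetA 1 n) = epsilon ∧
    PowerSeries.coeff 2 (∑' n, jetA 1 n) = iota := by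
  refine ⟨(hasSum_baseA 1).1.tsum_eq.symm, (hasSum_baseA 1).2.1.tsum_eq.symm, ?_⟩
  have := (hasSum_baseA 1).2.2.tsum_eq
  rw [iota]
  change _ = _ * ∑' i : ℕ+, baseA 1 i * factor₂ (2 * (i : ℕ) - 2) 1 i
  rw [this, C_half_mul_two]

lemma coeff_tsum_jet_two : PowerSeries.coeff 0 (∑' n, jetA 2 n) = beta ∧
    PowerSeries.coeff 1 (∑' n, jetA 2 n) = zeta ∧
    PowerSeries.coeff 2 (∑' n, jetA 2 n) = kappa := by
  refine ⟨(hasSum_baseA 2).1.tsum_eq.symm, (hasSum_baseA 2).2.1.tsum_eq.symm, ?_⟩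
  have := (hasSum_baseA 2).2.2.tsum_eq
  rw [kappa]
  change _ = _ * ∑' i : ℕ+, baseA 2 i * factor₂ (2 * (i : ℕ) - 2) 2 i
  rw [this, C_half_mul_two]

lemma coeff_tsum_jetC : PowerSeries.coeff 0 (∑' n, jetC n) = gamma ∧
    PowerSeries.coeff 1 (∑' n, jetC n) = eta ∧
    PowerSeries.coeff 2 (∑' n, jetC n) = lambda := by
  refine ⟨hasSum_baseC.1.tsum_eq.symm, hasSum_baseC.2.1.tsum_eq.symm, ?_⟩
  rw [lambda, hasSum_baseC.2.2.tsum_eq, C_half_mul_two]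

lemma coeff_tsum_jetD : PowerSeries.coeff 0 (∑' n, jetD n) = delta ∧
    PowerSeries.coeff 1 (∑' n, jetD n) = theta ∧
    PowerSeries.coeff 2 (∑' n, jetD n) = mu := by
  refine ⟨hasSum_baseD.1.tsum_eq.symm, hasSum_baseD.2.1.tsum_eq.symm, ?_⟩
  rw [mu, hasSum_baseD.2.2.tsum_eq, C_half_mul_two]

/-! ### The linear system for the moments and its solution -/

/-- The three linear equations for the moments `A`, `B`, `D` of order zero, one and two. -/
lemma moment_equations {A B D : Ser} (hA : moment q w (fun _ => 1) = A)
    (hB : moment q w (fun s => (s : Ser)) = B)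
    (hD : moment q w (fun s => (s.choose 2 : Ser)) = D) :
    (A = (1 + B + w * q ^ 2 * geo 1 ^ 2 * D * (2 * geo 1 - 2)) * alpha +
        (A + 2 * (w * q ^ 2 * geo 1 ^ 2) * D) * beta + (1 + 2 * geo 1 * A - B) * gamma -
        A * delta) ∧
    (B = (1 + B + w * q ^ 2 * geo 1 ^ 2 * D * (2 * geo 1 - 2)) * epsilon +
        (A + 2 * (w * q ^ 2 * geo 1 ^ 2) * D) * zeta + (1 + 2 * geo 1 * A - B) * eta -
        A * theta) ∧
    (D = (1 + B + w * q ^ 2 * geo 1 ^ 2 * D * (2 * geo 1 - 2)) * iota +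
        (A + 2 * (w * q ^ 2 * geo 1 ^ 2) * D) * kappa + (1 + 2 * geo 1 * A - B) * lambda -
        A * mu) := by
  have hs : ∀ m, HasSum (jetA m) (∑' n, jetA m n) :=
    fun m => (summable_prod_kernelJet_mul _).hasSum
  have hC : HasSum jetC (∑' n, jetC n) := (summable_prod_kernelJet_mul _).hasSum
  have hD' : HasSum jetD (∑' n, jetD n) := (summable_prod_kernelJet_mul _).hasSum
  have key := (moment_one_add_X hA hB hD).unique (hasSum_of_eq
    (((((hs 1).mul_left (PowerSeries.C (1 + B + w * q ^ 2 * geo 1 ^ 2 * D * (2 * geo 1 - 2)))).add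
      ((hs 2).mul_left (PowerSeries.C (A + 2 * (w * q ^ 2 * geo 1 ^ 2) * D)))).add
      (hC.mul_left (PowerSeries.C (1 + 2 * geo 1 * A - B)))).sub
      (hD'.mul_left (PowerSeries.C A))) rfl fun n => by
        simp only [jetA, jetC, jetD]
        ring)
  have hc := fun j => congrArg (PowerSeries.coeff j) key
  simp only [coeff_moment, map_sub (PowerSeries.coeff _), map_add (PowerSeries.coeff _),
    PowerSeries.coeff_C_mul] at hc
  refine ⟨?_, ?_, ?_⟩
  · have h0 := hc 0
    simp only [Nat.choose_zero_right, Nat.cast_one, hA] at h0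
    rw [coeff_tsum_jet_one.1, coeff_tsum_jet_two.1, coeff_tsum_jetC.1, coeff_tsum_jetD.1] at h0
    exact h0
  · have h1 := hc 1
    simp only [Nat.choose_one_right, hB] at h1
    rw [coeff_tsum_jet_one.2.1, coeff_tsum_jet_two.2.1, coeff_tsum_jetC.2.1,
      coeff_tsum_jetD.2.1] at h1
    exact h1
  · have h2 := hc 2
    simp only [hD] at h2
    rw [coeff_tsum_jet_one.2.2, coeff_tsum_jet_two.2.2, coeff_tsum_jetC.2.2,
      coeff_tsum_jetD.2.2] at h2
    exact h2

/-- The generating function in terms of the moments: the last column is simplex or duplex. -/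
lemma G_eq_moments : G = moment q w (fun _ => 1) +
    w * q ^ 2 * geo 1 ^ 2 * moment q w (fun s => (s.choose 2 : Ser)) := by
  have hm : geo 1 * (1 - q) = 1 := by simpa using geo_mul (le_refl 1)
  refine hasSum_G.unique (HasSum.sum ?_ ?_)
  · exact hasSum_of_eq (qAdic_q.hasSum_moment w fun _ => 1) rfl fun P => (mul_one _).symm
  · have := qAdic_q.hasSum_ofEnd (W := w) hm
    exact (Equiv.ofBijective _ ofEnd_bijective).hasSum_iff.1 this

/-- Cramer's rule. The unknowns are scaled by powers of `1 - q` to avoid denominators. -/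
lemma G_mul_DEN : G * DEN = NUM := by
  obtain ⟨e1, e2, e3⟩ := moment_equations rfl rfl rfl
  have hm : geo 1 * (1 - q) = 1 := by simpa using geo_mul (le_refl 1)
  rw [G_eq_moments]
  set A : Ser := moment q w (fun _ => 1)
  set B : Ser := moment q w (fun s => (s : Ser))
  set D : Ser := moment q w (fun s => (s.choose 2 : Ser))
  set m := geo 1
  obtain ⟨a, ha⟩ : ∃ a, a = m * A := ⟨_, rfl⟩
  obtain ⟨d, hd⟩ : ∃ d, d = m ^ 3 * D := ⟨_, rfl⟩
  have hA : A = (1 - q) * a := by rw [ha]; linear_combination -A * hm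
  have hD : D = (1 - q) ^ 3 * d := by
    rw [hd]; linear_combination (-D * (1 + m * (1 - q) + (m * (1 - q)) ^ 2)) * hm
  have hp : w * q ^ 2 * m ^ 2 * D = w * q ^ 2 * (1 - q) * d := by
    rw [hD]; linear_combination (w * q ^ 2 * (1 - q) * d * (1 + m * (1 - q))) * hm
  have hp' : w * q ^ 2 * m ^ 2 * D * (2 * m - 2) = 2 * w * q ^ 3 * d := by
    rw [hp]; linear_combination (2 * w * q ^ 2 * d) * hm
  have hp2 : 2 * (w * q ^ 2 * m ^ 2) * D = 2 * (w * q ^ 2 * (1 - q) * d) := by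
    rw [← hp]; ring
  have hma : 2 * m * A = 2 * a := by rw [ha]; ring
  rw [hp', hp2, hma] at e1 e2 e3
  rw [hp]
  rw [hA] at e1 e2 e3 ⊢
  rw [hD] at e3
  rw [DEN, NUM]
  clear_value A B D m
  -- The coefficients are the cofactors of the matrix of the scaled system, whose determinant is
  -- `DEN`.
  linear_combination
    ((1 - q) * ((1 - epsilon + eta) * ((1 - q) ^ 3 - 2 * w * q ^ 3 * iota -
          2 * w * q ^ 2 * (1 - q) * kappa) -
        (2 * w * q ^ 3 * epsilon + 2 * w * q ^ 2 * (1 - q) * zeta) * (iota - lambda)) +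
      w * q ^ 2 * (1 - q) * (((1 - q) * zeta + 2 * eta - (1 - q) * theta) * (iota - lambda) +
        (1 - epsilon + eta) * ((1 - q) * kappa + 2 * lambda - (1 - q) * mu))) * e1 +
    ((1 - q) * ((alpha - gamma) * ((1 - q) ^ 3 - 2 * w * q ^ 3 * iota -
          2 * w * q ^ 2 * (1 - q) * kappa) +
        (2 * w * q ^ 3 * alpha + 2 * w * q ^ 2 * (1 - q) * beta) * (iota - lambda)) +
      w * q ^ 2 * (1 - q) * (((1 - q) * (1 - beta + delta) - 2 * gamma) * (iota - lambda) +
        (alpha - gamma) * ((1 - q) * kappa + 2 * lambda - (1 - q) * mu))) * e2 +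
    ((1 - q) * ((alpha - gamma) * (2 * w * q ^ 3 * epsilon + 2 * w * q ^ 2 * (1 - q) * zeta) +
        (1 - epsilon + eta) * (2 * w * q ^ 3 * alpha + 2 * w * q ^ 2 * (1 - q) * beta)) +
      w * q ^ 2 * (1 - q) * (((1 - q) * (1 - beta + delta) - 2 * gamma) * (1 - epsilon + eta) -
        (alpha - gamma) * ((1 - q) * zeta + 2 * eta - (1 - q) * theta))) * e3

lemma constantCoeff_tsum_eq_zero {f : ℕ+ → Ser} (hf : Summable f)
    (h : ∀ i, MvPowerSeries.constantCoeff (f i) = 0) :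
    MvPowerSeries.constantCoeff (∑' i, f i) = 0 := by
  rw [hf.map_tsum MvPowerSeries.constantCoeff
    (MvPowerSeries.WithPiTopology.continuous_constantCoeff ℚ)]
  simp [h]

lemma constantCoeff_baseA (m : ℕ) (i : ℕ+) : MvPowerSeries.constantCoeff (baseA m i) = 0 := by
  have h : (i : ℕ) ^ 2 + 2 * i - 2 ≠ 0 := by
    have := i.pos
    have := Nat.one_le_pow 2 (i : ℕ) i.pos
    omega
  simp [baseA, q, h]

lemma constantCoeff_baseC (m s : ℕ) (i : ℕ+) :
    MvPowerSeries.constantCoeff (baseC m s i) = 0 := by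
  simp [baseC, q]

lemma constantCoeff_DEN : MvPowerSeries.constantCoeff DEN = 1 := by
  have h1 : MvPowerSeries.constantCoeff beta = 0 :=
    constantCoeff_tsum_eq_zero (hasSum_baseA 2).1.summable (constantCoeff_baseA 2)
  have h2 : MvPowerSeries.constantCoeff delta = 0 :=
    constantCoeff_tsum_eq_zero hasSum_baseD.1.summable fun i => constantCoeff_baseC 4 _ i
  have h3 : MvPowerSeries.constantCoeff epsilon = 0 :=
    constantCoeff_tsum_eq_zero (hasSum_baseA 1).2.1.summable fun i => by
      rw [epsilonTerm, map_mul, constantCoeff_baseA, zero_mul]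
  have h4 : MvPowerSeries.constantCoeff eta = 0 :=
    constantCoeff_tsum_eq_zero hasSum_baseC.2.1.summable fun i => by
      rw [etaTerm, map_mul, constantCoeff_baseC, zero_mul]
  have h5 : MvPowerSeries.constantCoeff alpha = 0 :=
    constantCoeff_tsum_eq_zero (hasSum_baseA 1).1.summable (constantCoeff_baseA 1)
  have h6 : MvPowerSeries.constantCoeff gamma = 0 :=
    constantCoeff_tsum_eq_zero hasSum_baseC.1.summable fun i => constantCoeff_baseC 3 _ i
  have h7 : MvPowerSeries.constantCoeff (q : Ser) = 0 := by rw [q, MvPowerSeries.constantCoeff_X]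
  simp [DEN, h1, h2, h3, h4, h5, h6, h7]

end SimplexDuplex

end

theorem theorem2 :
    (∀ n k : ℕ, (SimplexDuplex.classes n k).Finite) ∧
    (Summable SimplexDuplex.alphaTerm ∧ Summable SimplexDuplex.betaTerm ∧
      Summable SimplexDuplex.gammaTerm ∧ Summable SimplexDuplex.deltaTerm) ∧
    (Summable SimplexDuplex.epsilonTerm ∧ Summable SimplexDuplex.zetaTerm ∧
      Summable SimplexDuplex.etaTerm ∧ Summable SimplexDuplex.thetaTerm) ∧
    (Summable SimplexDuplex.iotaTerm ∧ Summable SimplexDuplex.kappaTerm ∧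
      Summable SimplexDuplex.lambdaTerm ∧ Summable SimplexDuplex.muTerm) ∧
    IsUnit SimplexDuplex.DEN ∧
    SimplexDuplex.G = SimplexDuplex.NUM * SimplexDuplex.DEN⁻¹ := by
  have hD := SimplexDuplex.constantCoeff_DEN
  have hA := SimplexDuplex.hasSum_baseA 1
  have hB := SimplexDuplex.hasSum_baseA 2
  have hC := SimplexDuplex.hasSum_baseC
  have hE := SimplexDuplex.hasSum_baseD
  refine ⟨SimplexDuplex.classes_finite,
    ⟨hA.1.summable, hB.1.summable, hC.1.summable, hE.1.summable⟩,
    ⟨hA.2.1.summable, hB.2.1.summable, hC.2.1.summable, hE.2.1.summable⟩,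
    ⟨hA.2.2.summable, hB.2.2.summable, hC.2.2.summable, hE.2.2.summable⟩, ?_, ?_⟩
  · rw [MvPowerSeries.isUnit_iff_constantCoeff, hD]
    exact isUnit_one
  · rw [MvPowerSeries.eq_mul_inv_iff_mul_eq (by rw [hD]; exact one_ne_zero)]
    exact SimplexDuplex.G_mul_DEN
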